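/- For an integer $k\ge 0$ define integers $d_k(n)$ by $\sum_{n\ge 0} d_k(n)q^n=\prod_{m\ge 1}\frac{(1-q^{2m})^k}{(1-q^m)^{3k+1}}$. For $\alpha\ge 1$ put $$\lambda_\alpha=\frac{1+3\cdot 5^{\alpha}}{4},\qquad \psi(\alpha)=\left\lfloor \frac{5^{\alpha+1}}{4}\right\rfloor,\qquad \beta(\alpha)=\alpha+1-2\left\lfloor\frac{\alpha+1}{2}\right\rfloor\in\{0,1\};$$ thus $\lambda_\alpha$ is the least positive integer $y$ with $4y\equiv 1\pmod{5^\alpha}$. For $\tau$ in the upper half plane $\mathbb{H}$ let $q=e^{2\pi i\tau}$ and $(q^a;q^a)_\infty=\prod_{m\ge 1}(1-q^{am})$, and define functions on $\mathbb{H}$ by $$x=q\,\frac{(q^2;q^2)_\infty\,(q^{10};q^{10})_\infty^3}{(q;q)_\infty^3\,(q^5;q^5)_\infty},$$ $$L_\alpha=\frac{(q^5;q^5)_\infty^{16}}{(q^{10};q^{10})_\infty^{5}}\sum_{n\ge 0}d_5(5^\alpha n+\lambda_\alpha)q^{n+2}\ \ (\alpha\text{ odd}),\qquad L_\alpha=\frac{(q;q)_\infty^{16}}{(q^{2};q^{2})_\infty^{5}}\sum_{n\ge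 0}d_5(5^\alpha n+\lambda_\alpha)q^{n+1}\ \ (\alpha\text{ even}).$$ Then for every $\alpha\ge 1$ the series in $L_\alpha$ converges absolutely for every $\tau\in\mathbb{H}$, and $$\frac{(1+5x)^{\psi(\alpha)-\beta(\alpha)}}{5^{\lfloor\alpha/2\rfloor+1}}\cdot L_\alpha\in\mathbb{Z}[x],$$ that is, it is a polynomial in $x$ with integer coefficients. -/

import Mathlib

noncomputable section

namespace ElongatedDiamond

section FormalGeneratingFunction

open scoped PowerSeries PowerSeries.WithPiTopology

/-- The factor `(1 - q^(2m))^k / (1 - q^m)^(3k+1)` with `m = i + 1`, as an integral power series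
in the formal variable `q = X`. -/
def factor (k i : ℕ) : ℤ⟦X⟧ :=
  (1 - PowerSeries.X ^ (2 * (i + 1))) ^ k *
    PowerSeries.invOfUnit (1 - PowerSeries.X ^ (i + 1)) 1 ^ (3 * k + 1)

/-- `PowerSeries.invOfUnit` in `factor` is the inverse of `1 - q^m`. -/
theorem factor_mul (k i : ℕ) :
    factor k i * (1 - PowerSeries.X ^ (i + 1)) ^ (3 * k + 1) =
      (1 - PowerSeries.X ^ (2 * (i + 1))) ^ k := by
  have h : PowerSeries.invOfUnit (1 - PowerSeries.X ^ (i + 1) : ℤ⟦X⟧) 1 *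
      (1 - PowerSeries.X ^ (i + 1)) = 1 :=
    PowerSeries.invOfUnit_mul _ _ (by simp)
  rw [factor, mul_assoc, ← mul_pow, h, one_pow, mul_one]

/-- `D_k(q) = ∏_{m ≥ 1} (1 - q^(2m))^k / (1 - q^m)^(3k+1)`, an infinite product in `ℤ⟦q⟧`
(coefficientwise convergence). -/
def genFun (k : ℕ) : ℤ⟦X⟧ := ∏' i : ℕ, factor k i

/-- The infinite product defining `genFun` converges. -/
theorem multipliable_factor (k : ℕ) : Multipliable (factor k) := by
  have h : Multipliable fun i => 1 + (factor k i - 1) := by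
    apply PowerSeries.WithPiTopology.multipliable_one_add_of_tendsto_order_atTop_nhds_top
    have hd : ∀ i, (PowerSeries.X : ℤ⟦X⟧) ^ (i + 1) ∣ factor k i - 1 := by
      intro i
      have hinv : PowerSeries.invOfUnit (1 - PowerSeries.X ^ (i + 1) : ℤ⟦X⟧) 1 *
          (1 - PowerSeries.X ^ (i + 1)) = 1 :=
        PowerSeries.invOfUnit_mul _ _ (by simp)
      rw [factor, ← Ideal.mem_span_singleton, ← Ideal.Quotient.eq_zero_iff_mem]
      have hx : Ideal.Quotient.mk (Ideal.span {(PowerSeries.X : ℤ⟦X⟧) ^ (i + 1)})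
          (PowerSeries.X ^ (i + 1)) = 0 :=
        Ideal.Quotient.eq_zero_iff_mem.2 (Ideal.mem_span_singleton_self _)
      have h1 := congrArg (Ideal.Quotient.mk
        (Ideal.span {(PowerSeries.X : ℤ⟦X⟧) ^ (i + 1)})) hinv
      rw [map_mul, map_sub, hx, map_one, sub_zero, mul_one] at h1
      rw [map_sub, map_mul, map_pow, map_pow, h1, map_sub, mul_comm 2, pow_mul, map_pow, hx]
      simp
    rw [ENat.tendsto_nhds_top_iff_natCast_lt]
    intro n
    filter_upwards [Filter.eventually_ge_atTop n] with i hi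
    refine lt_of_lt_of_le ?_ (PowerSeries.X_pow_dvd_iff.mp (hd i) |>
      PowerSeries.nat_le_order (factor k i - 1) (i + 1))
    exact_mod_cast Nat.lt_succ_of_le hi
  simpa using h

/-- `d_k(n)`, the coefficient of `q^n` in `D_k(q)`. -/
def d (k n : ℕ) : ℤ := PowerSeries.coeff n (genFun k)

end FormalGeneratingFunction

/-- `λ_α = (1 + 3 * 5^α) / 4`; the division is exact since `5^α ≡ 1 (mod 4)`. -/
def lam (α : ℕ) : ℕ := (1 + 3 * 5 ^ α) / 4

/-- `lam α` is the least positive integer `y` with `4 y ≡ 1 (mod 5^α)`. -/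
theorem isLeast_lam (α : ℕ) (hα : 1 ≤ α) :
    IsLeast {y : ℕ | 0 < y ∧ 4 * y ≡ 1 [MOD 5 ^ α]} (lam α) := by
  have h5 : 5 ^ α % 4 = 1 := by simp [Nat.pow_mod]
  have hp : 5 ≤ 5 ^ α := by simpa using Nat.pow_le_pow_right (n := 5) (by norm_num) hα
  have hlam : 4 * lam α = 1 + 3 * 5 ^ α := by unfold lam; omega
  refine ⟨⟨by omega, ?_⟩, ?_⟩
  · rw [hlam]
    simp [Nat.ModEq]
  · rintro y ⟨hy0, hy⟩
    obtain ⟨c, hc⟩ := (Nat.modEq_iff_dvd' (by omega)).mp hy.symm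
    have h3 : 3 ≤ c := by
      by_contra hlt
      have : c = 0 ∨ c = 1 ∨ c = 2 := by omega
      rcases this with rfl | rfl | rfl <;> omega
    have : 5 ^ α * 3 ≤ 5 ^ α * c := Nat.mul_le_mul_left _ h3
    omega

/-- The nome `q = exp(2 π i τ)`. -/
def nome (τ : UpperHalfPlane) : ℂ := Complex.exp (2 * Real.pi * Complex.I * (τ : ℂ))

/-- The infinite product `(q^a; q^a)_∞ = ∏_{m ≥ 1} (1 - q^(a m))` at `q = exp(2 π i τ)`. -/
def poch (a : ℕ) (τ : UpperHalfPlane) : ℂ := ∏' i : ℕ, (1 - nome τ ^ (a * (i + 1)))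

/-- The Hauptmodul `x = q (q^2;q^2)_∞ (q^10;q^10)_∞^3 / ((q;q)_∞^3 (q^5;q^5)_∞)`. -/
def hauptmodul (τ : UpperHalfPlane) : ℂ :=
  nome τ * (poch 2 τ * poch 10 τ ^ 3) / (poch 1 τ ^ 3 * poch 5 τ)

/-- The terms `d_5(5^α n + λ_α) q^(n + s)` of the series in `L_α`, where `s = 2` if `α` is odd and
`s = 1` if `α` is even. -/
def term (α : ℕ) (τ : UpperHalfPlane) (n : ℕ) : ℂ :=
  (d 5 (5 ^ α * n + lam α) : ℂ) * nome τ ^ (n + if Odd α then 2 else 1)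

/-- The function `L_α` on the upper half plane, for `α ≥ 1`: the series `∑ d_5(5^α n + λ_α) q^(n+s)`
times `(q^5;q^5)_∞^16 / (q^10;q^10)_∞^5` if `α` is odd, and times `(q;q)_∞^16 / (q^2;q^2)_∞^5` if
`α` is even. -/
def L (α : ℕ) (τ : UpperHalfPlane) : ℂ :=
  (if Odd α then poch 5 τ ^ 16 / poch 10 τ ^ 5 else poch 1 τ ^ 16 / poch 2 τ ^ 5) *
    ∑' n : ℕ, term α τ n

/-- `ψ(α) = ⌊5^(α+1) / 4⌋`. -/
def psi (α : ℕ) : ℕ := 5 ^ (α + 1) / 4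

/-- `β(α) = α + 1 - 2 ⌊(α+1)/2⌋ ∈ {0, 1}`. -/
def beta (α : ℕ) : ℕ := α + 1 - 2 * ((α + 1) / 2)

end ElongatedDiamond

end

/-! The argument takes place in `ℤ⟦X⟧`; evaluation at the nome comes last. Let U keep the
coefficients of index divisible by 5, and put D = `dser`, A = q^6 D(q) / D(q^25) = `aser`, y = 1 +
5x, p = `pser`, t = x(q^5). Because λ_{α+1} = λ_α + 3·5^α, the formal L_α arises from 1 by applying
f ↦ U(A f) and f ↦ U(f) alternately (`ell`, `ell_eq`).

Explicit action of U. Theta function identities, obtained from the Jacobi triple product and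
sublattice decompositions of ℤ², express x and the auxiliary eta quotients through the
Rogers-Ramanujan continued fraction r and Ramanujan's parameter k = r(q) r(q²)². With ρ = r(q^5), σ
= r(q^10), κ = k(q^5) = ρσ², the elements 1, ρ(1+κ), σ(1-κ), ρσ(1+κ), σ²(1-κ) span a ℤ[κ]-algebra.
Their exponents of q lie in the classes 0, 1, 2, 3, 4 mod 5, so U just reads off the first
coordinate. Finite integer arithmetic then gives U(x^j) and y U(x^j p) for j < 5, and an equation of
degree five for x over ℤ[t] (`modular_equation`). The latter makes U(x^m g) a linear recurrence in m
with coefficients in ℤ[x].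

Polynomiality. The modular equation also shows that y divides y(q^5)^5 in ℤ[x, t], and U maps ℤ[x,
t] to ℤ[x]. Hence U multiplies the exponent of y in the denominator by 5, and f ↦ U(A f) does the
same and adds 6. This matches the recursion of ψ - β (`yser_pow_mul_ell_mem`).

Divisibility. Polynomials are filtered by weight, x counting 5 and the prime 5 counting -10, and the
filtration is completed 5-adically so that 1/y has weight 0. Both operators essentially divide the
weight by 5 and add a constant. On weight 25 the double step f ↦ U(U(A f)) is divisible by 5: modulo
5 only x^0, ..., x^5 survive, and they are checked directly. The quotient again has weight at most
25 (`lam_step`), so every double step gains a factor 5; the first gains 25 (`exists_U_UA_one`).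

Finally x is X times a unit, so an integer dividing g(x) in `ℤ⟦X⟧` divides the polynomial g
(`dvd_of_dvd_xev`), and the two halves combine. -/

noncomputable section

/-! ### Integral power series converging on the unit disc, and their evaluation. -/

namespace ElongatedDiamond

open PowerSeries
open scoped PowerSeries.WithPiTopology NNReal ENNReal

/-- The weighted `ℓ¹` norm `∑ |f_n| r^n` of an integral power series. -/
def nrm (r : ℝ≥0) (f : ℤ⟦X⟧) : ℝ≥0∞ := ∑' n, ‖coeff n f‖ₑ * (r : ℝ≥0∞) ^ n

theorem nrm_add_le (r : ℝ≥0) (f g : ℤ⟦X⟧) : nrm r (f + g) ≤ nrm r f + nrm r g := by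
  rw [nrm, nrm, nrm, ← ENNReal.tsum_add]
  refine ENNReal.tsum_le_tsum fun n => ?_
  rw [← add_mul, map_add]
  gcongr
  exact enorm_add_le _ _

theorem nrm_neg (r : ℝ≥0) (f : ℤ⟦X⟧) : nrm r (-f) = nrm r f := by
  simp [nrm]

/-- Values in `ℝ≥0∞` allow the double sum to be rearranged along antidiagonals with no summability
hypothesis; convergence is then just finiteness. -/
theorem nrm_mul_le (r : ℝ≥0) (f g : ℤ⟦X⟧) : nrm r (f * g) ≤ nrm r f * nrm r g := by
  have h1 : nrm r f * nrm r g = ∑' p : ℕ × ℕ,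
      (‖coeff p.1 f‖ₑ * (r : ℝ≥0∞) ^ p.1) * (‖coeff p.2 g‖ₑ * (r : ℝ≥0∞) ^ p.2) := by
    rw [ENNReal.tsum_prod', nrm, nrm, ← ENNReal.tsum_mul_right]
    refine tsum_congr fun n => ?_
    rw [← ENNReal.tsum_mul_left]
  rw [h1, ← (Finset.HasAntidiagonal.sigmaAntidiagonalEquivProd (A := ℕ)).tsum_eq, ENNReal.tsum_sigma', nrm]
  refine ENNReal.tsum_le_tsum fun n => ?_
  rw [tsum_fintype, coeff_mul]
  calc ‖∑ p ∈ Finset.HasAntidiagonal.antidiagonal n, coeff p.1 f * coeff p.2 g‖ₑ * (r : ℝ≥0∞) ^ n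
      ≤ (∑ p ∈ Finset.HasAntidiagonal.antidiagonal n, ‖coeff p.1 f * coeff p.2 g‖ₑ) * (r : ℝ≥0∞) ^ n := by
        gcongr; exact enorm_sum_le _ _
    _ = ∑ p ∈ Finset.HasAntidiagonal.antidiagonal n,
        (‖coeff p.1 f‖ₑ * (r : ℝ≥0∞) ^ p.1) * (‖coeff p.2 g‖ₑ * (r : ℝ≥0∞) ^ p.2) := by
        rw [Finset.sum_mul]
        refine Finset.sum_congr rfl fun p hp => ?_
        rw [enorm_mul, ← Finset.HasAntidiagonal.mem_antidiagonal.mp hp, pow_add]; ring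
    _ ≤ _ := by
        rw [← Finset.sum_coe_sort (Finset.HasAntidiagonal.antidiagonal n)]
        exact le_of_eq (Finset.sum_congr rfl fun p _ => rfl)

theorem nrm_one (r : ℝ≥0) : nrm r 1 = 1 := by
  rw [nrm, tsum_eq_single 0]
  · simp
  · intro n hn; simp [coeff_one, hn]

theorem nrm_X_pow (r : ℝ≥0) (e : ℕ) : nrm r (X ^ e) = (r : ℝ≥0∞) ^ e := by
  rw [nrm, tsum_eq_single e]
  · simp [coeff_X_pow]
  · intro n hn; simp [coeff_X_pow, hn]

/-- The power series converges absolutely on the open unit disc. -/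
def Conv (f : ℤ⟦X⟧) : Prop := ∀ r : ℝ≥0, r < 1 → nrm r f ≠ ∞

/-- The value at `q` of a power series. -/
def ev (q : ℂ) (f : ℤ⟦X⟧) : ℂ := ∑' n, ((coeff n f : ℤ) : ℂ) * q ^ n

theorem enorm_term (f : ℤ⟦X⟧) (q : ℂ) (n : ℕ) :
    ‖((coeff n f : ℤ) : ℂ) * q ^ n‖ₑ = ‖coeff n f‖ₑ * ((‖q‖₊ : ℝ≥0) : ℝ≥0∞) ^ n := by
  rw [enorm_mul, enorm_pow]
  congr 1
  rw [← ofReal_norm, ← ofReal_norm]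
  simp [Int.norm_eq_abs]

theorem Conv.summable_norm {f : ℤ⟦X⟧} (hf : Conv f) {q : ℂ} (hq : ‖q‖ < 1) :
    Summable fun n => ‖((coeff n f : ℤ) : ℂ) * q ^ n‖ := by
  have h := hf ‖q‖₊ (by exact_mod_cast hq)
  rw [nrm, tsum_congr fun n => (enorm_term f q n).symm] at h
  have := ENNReal.summable_toReal h
  simpa using this

theorem Conv.summable {f : ℤ⟦X⟧} (hf : Conv f) {q : ℂ} (hq : ‖q‖ < 1) :
    Summable fun n => ((coeff n f : ℤ) : ℂ) * q ^ n :=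
  (hf.summable_norm hq).of_norm

theorem enorm_ev_le (f : ℤ⟦X⟧) {q : ℂ} : ‖ev q f‖ₑ ≤ nrm ‖q‖₊ f := by
  rw [ev, nrm, tsum_congr fun n => (enorm_term f q n).symm]
  exact enorm_tsum_le_tsum_enorm

theorem conv_X_pow (e : ℕ) : Conv (X ^ e) := fun r _ => by
  rw [nrm_X_pow]; exact ENNReal.pow_ne_top ENNReal.coe_ne_top

theorem conv_X : Conv X := by simpa using conv_X_pow 1

theorem conv_one : Conv 1 := by simpa using conv_X_pow 0

theorem Conv.add {f g : ℤ⟦X⟧} (hf : Conv f) (hg : Conv g) : Conv (f + g) := fun r hr =>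
  ne_top_of_le_ne_top (ENNReal.add_ne_top.mpr ⟨hf r hr, hg r hr⟩) (nrm_add_le r f g)

theorem Conv.neg {f : ℤ⟦X⟧} (hf : Conv f) : Conv (-f) := fun r hr => by
  rw [nrm_neg]; exact hf r hr

theorem Conv.mul {f g : ℤ⟦X⟧} (hf : Conv f) (hg : Conv g) : Conv (f * g) := fun r hr =>
  ne_top_of_le_ne_top (ENNReal.mul_ne_top (hf r hr) (hg r hr)) (nrm_mul_le r f g)

/-- The ring of integral power series that converge on the open unit disc. -/
def convRing : Subring ℤ⟦X⟧ where
  carrier := {f | Conv f}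
  mul_mem' hf hg := hf.mul hg
  one_mem' := conv_one
  add_mem' hf hg := hf.add hg
  zero_mem' := by simpa using conv_one.add conv_one.neg
  neg_mem' hf := hf.neg

theorem ev_mul {f g : ℤ⟦X⟧} (hf : Conv f) (hg : Conv g) {q : ℂ} (hq : ‖q‖ < 1) :
    ev q (f * g) = ev q f * ev q g := by
  rw [ev, ev, ev, tsum_mul_tsum_eq_tsum_sum_antidiagonal_of_summable_norm
    (hf.summable_norm hq) (hg.summable_norm hq)]
  refine tsum_congr fun n => ?_
  rw [coeff_mul, Int.cast_sum, Finset.sum_mul]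
  refine Finset.sum_congr rfl fun p hp => ?_
  rw [← Finset.HasAntidiagonal.mem_antidiagonal.mp hp, pow_add]; push_cast; ring

theorem ev_add {f g : ℤ⟦X⟧} (hf : Conv f) (hg : Conv g) {q : ℂ} (hq : ‖q‖ < 1) :
    ev q (f + g) = ev q f + ev q g := by
  rw [ev, ev, ev, ← (hf.summable hq).tsum_add (hg.summable hq)]
  refine tsum_congr fun n => ?_
  rw [map_add]; push_cast; ring

theorem ev_X_pow (q : ℂ) (e : ℕ) : ev q (X ^ e) = q ^ e := by
  rw [ev, tsum_eq_single e]
  · simp [coeff_X_pow]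
  · intro n hn; simp [coeff_X_pow, hn]

theorem ev_one (q : ℂ) : ev q 1 = 1 := by simpa using ev_X_pow q 0

/-- Evaluation at a point of the open unit disc. -/
def evHom (q : ℂ) (hq : ‖q‖ < 1) : convRing →+* ℂ where
  toFun f := ev q f.1
  map_one' := ev_one q
  map_mul' f g := ev_mul f.2 g.2 hq
  map_zero' := by simp [ev]
  map_add' f g := ev_add f.2 g.2 hq

theorem Conv.pow {f : ℤ⟦X⟧} (hf : Conv f) (n : ℕ) : Conv (f ^ n) := convRing.pow_mem hf n

theorem Conv.sub {f g : ℤ⟦X⟧} (hf : Conv f) (hg : Conv g) : Conv (f - g) := by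
  rw [sub_eq_add_neg]; exact hf.add hg.neg

theorem ev_pow {f : ℤ⟦X⟧} (hf : Conv f) {q : ℂ} (hq : ‖q‖ < 1) (n : ℕ) :
    ev q (f ^ n) = ev q f ^ n :=
  map_pow (evHom q hq) ⟨f, hf⟩ n

theorem ev_sub {f g : ℤ⟦X⟧} (hf : Conv f) (hg : Conv g) {q : ℂ} (hq : ‖q‖ < 1) :
    ev q (f - g) = ev q f - ev q g := by
  rw [eq_sub_iff_add_eq, ← ev_add (hf.sub hg) hg hq, sub_add_cancel]

theorem ev_X (q : ℂ) : ev q X = q := by simpa using ev_X_pow q 1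

/-! ### Infinite products of power series. -/

section Products

variable {F : ℕ → ℤ⟦X⟧}

theorem multipliable_of_dvd (hF : ∀ i, (X : ℤ⟦X⟧) ^ (i + 1) ∣ F i - 1) : Multipliable F := by
  have h : Multipliable fun i => 1 + (F i - 1) := by
    apply PowerSeries.WithPiTopology.multipliable_one_add_of_tendsto_order_atTop_nhds_top
    rw [ENat.tendsto_nhds_top_iff_natCast_lt]
    intro n
    filter_upwards [Filter.eventually_ge_atTop n] with i hi
    refine lt_of_lt_of_le ?_ (PowerSeries.X_pow_dvd_iff.mp (hF i) |>
      PowerSeries.nat_le_order (F i - 1) (i + 1))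
    exact_mod_cast Nat.lt_succ_of_le hi
  simpa using h

/-- The factor of index i is 1 modulo `X ^ (i + 1)`, so factors from N on do not affect coefficients
of index at most N. -/
theorem coeff_prod_range_eq (hF : ∀ i, (X : ℤ⟦X⟧) ^ (i + 1) ∣ F i - 1) {n N M : ℕ}
    (hN : n ≤ N) (hM : N ≤ M) :
    coeff n (∏ i ∈ Finset.range M, F i) = coeff n (∏ i ∈ Finset.range N, F i) := by
  induction M, hM using Nat.le_induction with
  | base => rfl
  | succ M hM ih =>
    rw [Finset.prod_range_succ, ← ih]
    have h : (X : ℤ⟦X⟧) ^ (M + 1) ∣ (∏ i ∈ Finset.range M, F i) * F M - ∏ i ∈ Finset.range M, F i := by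
      rw [← mul_sub_one]; exact (hF M).mul_left _
    have := X_pow_dvd_iff.mp h n (by omega)
    rw [map_sub] at this
    linarith

theorem coeff_tprod (hF : ∀ i, (X : ℤ⟦X⟧) ^ (i + 1) ∣ F i - 1) {n N : ℕ} (hN : n ≤ N) :
    coeff n (∏' i, F i) = coeff n (∏ i ∈ Finset.range N, F i) := by
  have h := (multipliable_of_dvd hF).hasProd.tendsto_prod_nat
  have h2 := ((PowerSeries.WithPiTopology.continuous_coeff ℤ n).tendsto _).comp h
  refine tendsto_nhds_unique h2 (tendsto_const_nhds.congr' ?_)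
  filter_upwards [Filter.eventually_ge_atTop N] with M hM
  exact (coeff_prod_range_eq hF hN hM).symm

theorem nrm_prod_le {u : ℕ → ℝ≥0} {r : ℝ≥0} (hu : ∀ i, nrm r (F i - 1) ≤ u i) (hs : Summable u)
    (N : ℕ) : nrm r (∏ i ∈ Finset.range N, F i) ≤ ENNReal.ofReal (Real.exp (∑' i, (u i : ℝ))) := by
  have h1 : nrm r (∏ i ∈ Finset.range N, F i) ≤ ∏ i ∈ Finset.range N, (1 + (u i : ℝ≥0∞)) := by
    induction N with
    | zero => simp [nrm_one]
    | succ N ih =>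
      rw [Finset.prod_range_succ, Finset.prod_range_succ]
      refine (nrm_mul_le _ _ _).trans ?_
      gcongr
      calc nrm r (F N) = nrm r (1 + (F N - 1)) := by congr 1; ring
        _ ≤ _ := (nrm_add_le _ _ _).trans (by rw [nrm_one]; gcongr; exact hu N)
  refine h1.trans ?_
  have h2 : ∏ i ∈ Finset.range N, (1 + (u i : ℝ≥0∞)) =
      ENNReal.ofReal (∏ i ∈ Finset.range N, (1 + (u i : ℝ))) := by
    rw [ENNReal.ofReal_prod_of_nonneg (fun i _ => by positivity)]
    refine Finset.prod_congr rfl fun i _ => ?_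
    rw [ENNReal.ofReal_add zero_le_one (NNReal.coe_nonneg _)]; simp
  rw [h2]
  refine ENNReal.ofReal_le_ofReal ?_
  calc ∏ i ∈ Finset.range N, (1 + (u i : ℝ)) ≤ ∏ i ∈ Finset.range N, Real.exp (u i) := by
        gcongr with i; linarith [Real.add_one_le_exp (u i : ℝ)]
    _ = Real.exp (∑ i ∈ Finset.range N, (u i : ℝ)) := (Real.exp_sum _ _).symm
    _ ≤ _ := Real.exp_le_exp.mpr ((NNReal.summable_coe.mpr hs).sum_le_tsum _ (fun _ _ => by positivity))

theorem nrm_prod_sub_le {u : ℕ → ℝ≥0} {r : ℝ≥0} (hu : ∀ i, nrm r (F i - 1) ≤ u i)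
    (hs : Summable u) (N m : ℕ) :
    nrm r (∏ i ∈ Finset.range (m + N), F i - ∏ i ∈ Finset.range N, F i) ≤
      ENNReal.ofReal (Real.exp (∑' i, (u i : ℝ))) * ∑ i ∈ Finset.range m, (u (i + N) : ℝ≥0∞) := by
  induction m with
  | zero => simp [nrm]
  | succ m ih =>
    rw [Finset.sum_range_succ, mul_add, Nat.succ_add, Finset.prod_range_succ]
    calc nrm r ((∏ i ∈ Finset.range (m + N), F i) * F (m + N) - ∏ i ∈ Finset.range N, F i)
        = nrm r ((∏ i ∈ Finset.range (m + N), F i - ∏ i ∈ Finset.range N, F i) +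
          (∏ i ∈ Finset.range (m + N), F i) * (F (m + N) - 1)) := by congr 1; ring
      _ ≤ _ := (nrm_add_le _ _ _).trans (add_le_add ih ((nrm_mul_le _ _ _).trans ?_))
    gcongr
    · exact nrm_prod_le hu hs _
    · exact hu _

/-- Each partial sum of the norm only sees finitely many coefficients, and these agree with those of
a long finite product, to which the telescoping bound applies. This tail estimate yields both
convergence of the product and its compatibility with evaluation. -/
theorem nrm_tprod_sub_le (hF : ∀ i, (X : ℤ⟦X⟧) ^ (i + 1) ∣ F i - 1) {u : ℕ → ℝ≥0} {r : ℝ≥0}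
    (hu : ∀ i, nrm r (F i - 1) ≤ u i) (hs : Summable u) (N : ℕ) :
    nrm r (∏' i, F i - ∏ i ∈ Finset.range N, F i) ≤
      ENNReal.ofReal (Real.exp (∑' i, (u i : ℝ))) * ∑' i, (u (i + N) : ℝ≥0∞) := by
  rw [nrm, ENNReal.tsum_eq_iSup_nat]
  refine iSup_le fun M => ?_
  calc ∑ n ∈ Finset.range M, ‖coeff n (∏' i, F i - ∏ i ∈ Finset.range N, F i)‖ₑ * (r : ℝ≥0∞) ^ n
      = ∑ n ∈ Finset.range M, ‖coeff n (∏ i ∈ Finset.range (M + N), F i -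
          ∏ i ∈ Finset.range N, F i)‖ₑ * (r : ℝ≥0∞) ^ n := by
        refine Finset.sum_congr rfl fun n hn => ?_
        rw [map_sub, map_sub, coeff_tprod hF (N := M + N)]
        have := Finset.mem_range.mp hn
        omega
    _ ≤ nrm r (∏ i ∈ Finset.range (M + N), F i - ∏ i ∈ Finset.range N, F i) :=
        ENNReal.sum_le_tsum _
    _ ≤ _ := (nrm_prod_sub_le hu hs N M).trans (by gcongr; exact ENNReal.sum_le_tsum _)

/-- An infinite product of power series whose factors are summably close to `1` on every smaller
disc converges on the open unit disc. -/
theorem conv_tprod (hF : ∀ i, (X : ℤ⟦X⟧) ^ (i + 1) ∣ F i - 1)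
    (hu : ∀ r : ℝ≥0, r < 1 → ∃ u : ℕ → ℝ≥0, Summable u ∧ ∀ i, nrm r (F i - 1) ≤ u i) :
    Conv (∏' i, F i) := fun r hr => by
  obtain ⟨u, hs, hu⟩ := hu r hr
  have h := nrm_tprod_sub_le hF hu hs 0
  have h2 : nrm r (∏' i, F i) ≤ nrm r (∏' i, F i - ∏ i ∈ Finset.range 0, F i) + nrm r 1 := by
    refine le_trans (le_of_eq ?_) (nrm_add_le _ _ _)
    congr 1; simp
  refine ne_top_of_le_ne_top ?_ h2
  rw [nrm_one]
  refine ENNReal.add_ne_top.mpr ⟨ne_top_of_le_ne_top ?_ h, ENNReal.one_ne_top⟩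
  exact ENNReal.mul_ne_top ENNReal.ofReal_ne_top (ENNReal.tsum_coe_ne_top_iff_summable.mpr hs)

/-- The bridge between the formal product and the analytic product at q: the norm bounds the error
of evaluation. -/
theorem tendsto_ev_prod (hF : ∀ i, (X : ℤ⟦X⟧) ^ (i + 1) ∣ F i - 1) (hc : ∀ i, Conv (F i))
    (hu : ∀ r : ℝ≥0, r < 1 → ∃ u : ℕ → ℝ≥0, Summable u ∧ ∀ i, nrm r (F i - 1) ≤ u i)
    {q : ℂ} (hq : ‖q‖ < 1) :
    Filter.Tendsto (fun N => ∏ i ∈ Finset.range N, ev q (F i)) Filter.atTop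
      (nhds (ev q (∏' i, F i))) := by
  obtain ⟨u, hs, hu'⟩ := hu ‖q‖₊ (by exact_mod_cast hq)
  have hP : ∀ N, Conv (∏ i ∈ Finset.range N, F i) := fun N => convRing.prod_mem fun i _ => hc i
  have he : ∀ N, ∏ i ∈ Finset.range N, ev q (F i) = ev q (∏ i ∈ Finset.range N, F i) := by
    intro N
    induction N with
    | zero => simp [ev_one]
    | succ N ih => rw [Finset.prod_range_succ, Finset.prod_range_succ, ih, ev_mul (hP N) (hc N) hq]
  rw [tendsto_iff_edist_tendsto_0]
  have ht : Filter.Tendsto (fun N => ENNReal.ofReal (Real.exp (∑' i, (u i : ℝ))) *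
      ∑' i, (u (i + N) : ℝ≥0∞)) Filter.atTop (nhds 0) := by
    have := ENNReal.Tendsto.const_mul (a := ENNReal.ofReal (Real.exp (∑' i, (u i : ℝ))))
      (ENNReal.tendsto_sum_nat_add (fun i => (u i : ℝ≥0∞))
        (ENNReal.tsum_coe_ne_top_iff_summable.mpr hs)) (Or.inr ENNReal.ofReal_ne_top)
    simpa using this
  refine tendsto_of_tendsto_of_tendsto_of_le_of_le tendsto_const_nhds ht (fun _ => bot_le) ?_
  intro N
  change edist _ _ ≤ _
  rw [he, edist_comm, edist_eq_enorm_sub, ← ev_sub (conv_tprod hF hu) (hP N) hq]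
  exact (enorm_ev_le _).trans (nrm_tprod_sub_le hF hu' hs N)

end Products

end ElongatedDiamond

namespace ElongatedDiamond

/-! ### The Jacobi triple product as a limit of the finite q-binomial theorem. -/

section JacobiTripleProduct

open Filter Topology

/-- Gaussian binomial coefficients with base `s ^ 2`. -/
def gauss (s : ℂ) : ℕ → ℕ → ℂ
  | _, 0 => 1
  | 0, _ + 1 => 0
  | N + 1, k + 1 => gauss s N (k + 1) + s ^ (2 * (N - k)) * gauss s N k

theorem gauss_zero_right (s : ℂ) (N : ℕ) : gauss s N 0 = 1 := by cases N <;> rfl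

theorem gauss_succ_succ (s : ℂ) (N k : ℕ) :
    gauss s (N + 1) (k + 1) = gauss s N (k + 1) + s ^ (2 * (N - k)) * gauss s N k := rfl

theorem gauss_eq_zero (s : ℂ) {N k : ℕ} (h : N < k) : gauss s N k = 0 := by
  induction N generalizing k with
  | zero => obtain ⟨k, rfl⟩ := Nat.exists_eq_succ_of_ne_zero (by omega : k ≠ 0); rfl
  | succ N ih =>
    obtain ⟨k, rfl⟩ := Nat.exists_eq_succ_of_ne_zero (by omega : k ≠ 0)
    rw [gauss_succ_succ, ih (by omega), ih (by omega)]; simp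

/-- The finite product `(s^2; s^2)_N`. -/
def qfac (s : ℂ) (N : ℕ) : ℂ := ∏ i ∈ Finset.range N, (1 - s ^ (2 * i + 2))

theorem qfac_succ (s : ℂ) (N : ℕ) : qfac s (N + 1) = qfac s N * (1 - s ^ (2 * N + 2)) :=
  Finset.prod_range_succ _ _

/-- The quotient formula for Gaussian binomials, kept free of division; it supplies their bounds and
their limits. -/
theorem gauss_mul_qfac (s : ℂ) {N k : ℕ} (h : k ≤ N) :
    gauss s N k * (qfac s k * qfac s (N - k)) = qfac s N := by
  induction N generalizing k with
  | zero => obtain rfl : k = 0 := by omega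
            simp [gauss, qfac]
  | succ N ih =>
    rcases k with _ | k
    · simp [gauss_zero_right, qfac]
    · rw [gauss_succ_succ, qfac_succ s k, Nat.succ_sub_succ]
      have h2 := ih (k := k) (by omega)
      rcases Nat.lt_or_ge k N with hk | hk
      · have h1 := ih (k := k + 1) (by omega)
        obtain ⟨d, rfl⟩ : ∃ d, N = k + 1 + d := ⟨N - (k + 1), by omega⟩
        rw [show k + 1 + d - (k + 1) = d by omega, qfac_succ] at h1
        rw [show k + 1 + d - k = d + 1 by omega, qfac_succ] at h2 ⊢
        rw [qfac_succ]
        linear_combination (1 - s ^ (2 * d + 2)) * h1 + s ^ (2 * (d + 1)) * (1 - s ^ (2 * k + 2)) * h2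
      · obtain rfl : k = N := by omega
        rw [gauss_eq_zero s (by omega : k < k + 1)]
        rw [qfac_succ]
        simp only [Nat.sub_self] at h2 ⊢
        linear_combination (1 - s ^ (2 * k + 2)) * h2

/-- The finite q-binomial theorem, by the q-Pascal rule that defines `gauss`. -/
theorem prod_eq_sum_gauss (s v : ℂ) (N : ℕ) :
    ∏ i ∈ Finset.range N, (1 - v * s ^ (2 * i + 1)) =
      ∑ k ∈ Finset.range (N + 1), (-1) ^ k * s ^ (k ^ 2) * gauss s N k * v ^ k := by
  induction N with
  | zero => simp [gauss]
  | succ N ih =>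
    rw [Finset.prod_range_succ, ih, Finset.sum_range_succ' _ (N + 1), gauss_zero_right]
    have h1 : ∑ k ∈ Finset.range (N + 1),
        (-1) ^ (k + 1) * s ^ ((k + 1) ^ 2) * gauss s (N + 1) (k + 1) * v ^ (k + 1) =
        ∑ k ∈ Finset.range (N + 1),
          (-1) ^ (k + 1) * s ^ ((k + 1) ^ 2) * gauss s N (k + 1) * v ^ (k + 1) -
        v * s ^ (2 * N + 1) * ∑ k ∈ Finset.range (N + 1),
          (-1) ^ k * s ^ (k ^ 2) * gauss s N k * v ^ k := by
      rw [Finset.mul_sum, ← Finset.sum_sub_distrib]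
      refine Finset.sum_congr rfl fun k hk => ?_
      obtain ⟨d, rfl⟩ : ∃ d, N = k + d := ⟨N - k, by have := Finset.mem_range.mp hk; omega⟩
      rw [gauss_succ_succ, show k + d - k = d by omega]
      ring
    have h2 : ∑ k ∈ Finset.range (N + 1), (-1) ^ k * s ^ (k ^ 2) * gauss s N k * v ^ k =
        ∑ k ∈ Finset.range (N + 1),
          (-1) ^ (k + 1) * s ^ ((k + 1) ^ 2) * gauss s N (k + 1) * v ^ (k + 1) + 1 := by
      have := Finset.sum_range_succ (fun k => (-1) ^ k * s ^ (k ^ 2) * gauss s N k * v ^ k) (N + 1)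
      rw [Finset.sum_range_succ', gauss_eq_zero s (by omega : N < N + 1), gauss_zero_right] at this
      simp only [pow_zero, ne_eq, OfNat.ofNat_ne_zero, not_false_eq_true, zero_pow, mul_one,
        mul_zero, zero_mul, add_zero] at this
      exact this.symm
    rw [h1]
    simp only [pow_zero, ne_eq, OfNat.ofNat_ne_zero, not_false_eq_true, zero_pow, mul_one]
    linear_combination h2

theorem sum_range_odd (n : ℕ) : ∑ i ∈ Finset.range n, (2 * i + 1) = n ^ 2 := by
  induction n with
  | zero => rfl
  | succ n ih => rw [Finset.sum_range_succ, ih]; ring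

/-- Take the q-binomial theorem with 2n factors at v s^(-2n). The upper half of the product gives
the factors in v; the lower half, reversed, gives those in v⁻¹ after a monomial is pulled out of
each. Recentring the sum at k = n + m completes the squares. -/
theorem prod_sym_eq_sum {s v : ℂ} (hs : s ≠ 0) (hv : v ≠ 0) (n : ℕ) :
    ∏ i ∈ Finset.range n, ((1 - v * s ^ (2 * i + 1)) * (1 - v⁻¹ * s ^ (2 * i + 1))) =
      ∑ m ∈ Finset.Icc (-n : ℤ) n,
        (-1) ^ m * s ^ (m ^ 2) * v ^ m * gauss s (2 * n) (n + m).toNat := by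
  have h := prod_eq_sum_gauss s (v * (s ^ (2 * n))⁻¹) (2 * n)
  rw [two_mul, Finset.prod_range_add, ← two_mul] at h
  have h1 : ∏ i ∈ Finset.range n, (1 - v * (s ^ (2 * n))⁻¹ * s ^ (2 * (n + i) + 1)) =
      ∏ i ∈ Finset.range n, (1 - v * s ^ (2 * i + 1)) := by
    refine Finset.prod_congr rfl fun i _ => ?_
    rw [show 2 * (n + i) + 1 = 2 * n + (2 * i + 1) by ring, pow_add s (2 * n)]
    field_simp
  have h2 : ∏ i ∈ Finset.range n, (1 - v * (s ^ (2 * n))⁻¹ * s ^ (2 * i + 1)) =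
      (-v) ^ n * (s ^ (n ^ 2))⁻¹ * ∏ i ∈ Finset.range n, (1 - v⁻¹ * s ^ (2 * i + 1)) := by
    rw [← Finset.prod_range_reflect]
    have h3 : (-v) ^ n * (s ^ (n ^ 2))⁻¹ =
        ∏ i ∈ Finset.range n, (-v * (s ^ (2 * i + 1))⁻¹) := by
      rw [Finset.prod_mul_distrib, Finset.prod_const, Finset.card_range, Finset.prod_inv_distrib,
        Finset.prod_pow_eq_pow_sum, sum_range_odd]
    rw [h3, ← Finset.prod_mul_distrib]
    refine Finset.prod_congr rfl fun i hi => ?_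
    have hi' := Finset.mem_range.mp hi
    obtain ⟨d, rfl⟩ : ∃ d, n = i + 1 + d := ⟨n - (i + 1), by omega⟩
    rw [show i + 1 + d - 1 - i = d by omega,
      show 2 * (i + 1 + d) = (2 * i + 1) + (2 * d + 1) by ring, pow_add]
    field_simp
    ring
  rw [h1, h2] at h
  have h4 : ∏ i ∈ Finset.range n, ((1 - v * s ^ (2 * i + 1)) * (1 - v⁻¹ * s ^ (2 * i + 1))) =
      (((-v) ^ n)⁻¹ * s ^ (n ^ 2)) * ∑ k ∈ Finset.range (2 * n + 1),
        (-1) ^ k * s ^ (k ^ 2) * gauss s (2 * n) k * (v * (s ^ (2 * n))⁻¹) ^ k := by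
    rw [← h, Finset.prod_mul_distrib]
    have : (-v) ^ n ≠ 0 := pow_ne_zero _ (neg_ne_zero.mpr hv)
    field_simp
  rw [h4, Finset.mul_sum]
  refine Finset.sum_bij (fun k _ => (k : ℤ) - n) ?_ ?_ ?_ ?_
  · intro k hk
    have := Finset.mem_range.mp hk
    rw [Finset.mem_Icc]; omega
  · intro a _ b _ hab; omega
  · intro m hm
    rw [Finset.mem_Icc] at hm
    exact ⟨(m + n).toNat, by rw [Finset.mem_range]; omega, by omega⟩
  · intro k _
    rw [show ((n : ℤ) + ((k : ℤ) - n)).toNat = k by omega]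
    rw [show ((k : ℤ) - n) ^ 2 = (k : ℤ) ^ 2 + (n : ℤ) ^ 2 - 2 * n * k by ring, zpow_sub₀ hs,
      zpow_add₀ hs, zpow_sub₀ hv, zpow_sub₀ (by norm_num : (-1 : ℂ) ≠ 0), neg_pow v, mul_pow, inv_pow,
      ← pow_mul, show s ^ ((k : ℤ) ^ 2) = s ^ (k ^ 2) by norm_cast,
      show s ^ ((n : ℤ) ^ 2) = s ^ (n ^ 2) by norm_cast,
      show s ^ (2 * (n : ℤ) * k) = s ^ (2 * n * k) by norm_cast, zpow_natCast, zpow_natCast,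
      zpow_natCast, zpow_natCast]
    have hn : (-1 : ℂ) ^ n ≠ 0 := pow_ne_zero _ (by norm_num)
    generalize (-1 : ℂ) ^ n = en at hn
    field_simp

/-- The term is (r^n c)^n, and r^n c is eventually below 1/2. -/
theorem summable_sq_mul_pow {r c : ℝ} (hr0 : 0 < r) (hr : r < 1) (hc : 0 < c) :
    Summable fun n : ℕ => r ^ (n ^ 2) * c ^ n := by
  refine Summable.of_norm_bounded_eventually_nat (summable_geometric_two) ?_
  have h : Tendsto (fun n : ℕ => r ^ n * c) atTop (𝓝 (0 * c)) :=
    (tendsto_pow_atTop_nhds_zero_of_lt_one hr0.le hr).mul_const c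
  rw [zero_mul] at h
  filter_upwards [h.eventually (gt_mem_nhds (by norm_num : (0 : ℝ) < 1 / 2))] with n hn
  rw [Real.norm_of_nonneg (by positivity), sq, pow_mul, ← mul_pow]
  exact pow_le_pow_left₀ (by positivity) hn.le n

theorem summable_zpow_sq {r c : ℝ} (hr0 : 0 < r) (hr : r < 1) (hc : 0 < c) :
    Summable fun n : ℤ => r ^ (n ^ 2) * c ^ n := by
  refine Summable.of_nat_of_neg ?_ ?_
  · exact_mod_cast summable_sq_mul_pow hr0 hr hc
  · have := summable_sq_mul_pow hr0 hr (inv_pos.mpr hc)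
    refine this.congr fun n => ?_
    rw [neg_sq, zpow_neg, inv_pow]
    norm_cast

theorem summable_norm_theta {s v : ℂ} (hs0 : s ≠ 0) (hs : ‖s‖ < 1) (hv : v ≠ 0) :
    Summable fun n : ℤ => ‖(-1) ^ n * s ^ (n ^ 2) * v ^ n‖ := by
  refine (summable_zpow_sq (norm_pos_iff.mpr hs0) hs (norm_pos_iff.mpr hv)).congr fun n => ?_
  simp

theorem one_sub_pow_ne_zero {s : ℂ} (hs : ‖s‖ < 1) {n : ℕ} (hn : n ≠ 0) : 1 - s ^ n ≠ 0 := by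
  intro h
  have h1 : s ^ n = 1 := by linear_combination -h
  have h2 : ‖s‖ ^ n = 1 := by rw [← norm_pow, h1, norm_one]
  have := pow_lt_one₀ (norm_nonneg s) hs hn
  linarith

theorem qfac_ne_zero {s : ℂ} (hs : ‖s‖ < 1) (N : ℕ) : qfac s N ≠ 0 :=
  Finset.prod_ne_zero_iff.mpr fun _ _ => one_sub_pow_ne_zero hs (by omega)

theorem exists_tendsto_qfac {s : ℂ} (hs : ‖s‖ < 1) :
    ∃ l : ℂ, l ≠ 0 ∧ Tendsto (qfac s) atTop (𝓝 l) := by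
  have hsum : Summable fun i : ℕ => ‖-s ^ (2 * i + 2)‖ := by
    have h1 : Summable fun i : ℕ => ‖s‖ ^ i := summable_geometric_of_lt_one (norm_nonneg s) hs
    have := h1.comp_injective (i := fun i : ℕ => 2 * i + 2) (fun a b h => by simpa using h)
    simpa [Function.comp_def] using this
  refine ⟨∏' i, (1 + -s ^ (2 * i + 2)), ?_, ?_⟩
  · refine tprod_one_add_ne_zero_of_summable (fun i => ?_) hsum
    simpa [sub_eq_add_neg] using one_sub_pow_ne_zero hs (n := 2 * i + 2) (by omega)
  · have := (multipliable_one_add_of_summable hsum).hasProd.tendsto_prod_nat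
    refine this.congr fun n => ?_
    simp [qfac, sub_eq_add_neg]

theorem norm_le_of_tendsto {f : ℕ → ℂ} {l : ℂ} (h : Tendsto f atTop (𝓝 l)) :
    ∃ C, 0 < C ∧ ∀ n, ‖f n‖ ≤ C := by
  obtain ⟨C, hC⟩ := (Metric.isBounded_range_of_tendsto f h).exists_norm_le
  exact ⟨max C 1, by positivity, fun n => (hC _ ⟨n, rfl⟩).trans (le_max_left _ _)⟩

/-- The uniform bound needed for dominated convergence. Both `qfac` and its inverse are bounded
because `qfac` converges to a nonzero limit. -/
theorem exists_gauss_bound {s : ℂ} (hs : ‖s‖ < 1) : ∃ C, 0 < C ∧ ∀ N k, ‖gauss s N k‖ ≤ C := by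
  obtain ⟨l, hl, h⟩ := exists_tendsto_qfac hs
  obtain ⟨C, hC, hC'⟩ := norm_le_of_tendsto h
  obtain ⟨C₂, hC₂, hC₂'⟩ := norm_le_of_tendsto (h.inv₀ hl)
  refine ⟨C * (C₂ * C₂), by positivity, fun N k => ?_⟩
  rcases lt_or_ge N k with hk | hk
  · rw [gauss_eq_zero s hk, norm_zero]; positivity
  · have : gauss s N k = qfac s N * ((qfac s k)⁻¹ * (qfac s (N - k))⁻¹) := by
      rw [← gauss_mul_qfac s hk]
      field_simp [qfac_ne_zero hs]
    rw [this, norm_mul, norm_mul]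
    gcongr
    exacts [hC' _, hC₂' _, hC₂' _]

/-- **Jacobi triple product identity**. -/
theorem tendsto_triple_product {s v : ℂ} (hs0 : s ≠ 0) (hs : ‖s‖ < 1) (hv : v ≠ 0) :
    Tendsto (fun n => ∏ i ∈ Finset.range n, ((1 - s ^ (2 * i + 2)) *
        ((1 - v * s ^ (2 * i + 1)) * (1 - v⁻¹ * s ^ (2 * i + 1))))) atTop
      (𝓝 (∑' n : ℤ, (-1) ^ n * s ^ (n ^ 2) * v ^ n)) := by
  obtain ⟨l, hl, hq⟩ := exists_tendsto_qfac hs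
  obtain ⟨C, hC, hC'⟩ := exists_gauss_bound hs
  set w : ℕ → ℤ → ℂ := fun n m =>
    if m ∈ Finset.Icc (-n : ℤ) n then gauss s (2 * n) (n + m).toNat else 0 with hw
  -- Tannery's theorem: for fixed m the Gaussian binomial of 2n over n + m tends to l / (l · l) =
  -- l⁻¹, which the remaining factor `qfac s n` → l cancels.
  have hlim : Tendsto (fun n : ℕ => ∑' m : ℤ, (-1) ^ m * s ^ (m ^ 2) * v ^ m * w n m) atTop
      (𝓝 (∑' m : ℤ, (-1) ^ m * s ^ (m ^ 2) * v ^ m * l⁻¹)) := by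
    refine tendsto_tsum_of_dominated_convergence
      (bound := fun m : ℤ => ‖(-1) ^ m * s ^ (m ^ 2) * v ^ m‖ * C)
      ((summable_norm_theta hs0 hs hv).mul_right C) (fun m => ?_) (Eventually.of_forall fun n m => ?_)
    · refine Tendsto.const_mul _ ?_
      have h1 : Tendsto (fun n : ℕ => qfac s (2 * n) *
          ((qfac s (n + m).toNat)⁻¹ * (qfac s (n - m).toNat)⁻¹)) atTop (𝓝 (l * (l⁻¹ * l⁻¹))) := by
        refine Tendsto.mul (hq.comp ?_) (((hq.comp ?_).inv₀ hl).mul ((hq.comp ?_).inv₀ hl))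
        · exact tendsto_atTop_mono (fun n => by omega : ∀ n, n ≤ 2 * n) tendsto_id
        · refine tendsto_atTop.mpr fun b => ?_
          filter_upwards [eventually_ge_atTop (b + m.natAbs)] with n hn
          omega
        · refine tendsto_atTop.mpr fun b => ?_
          filter_upwards [eventually_ge_atTop (b + m.natAbs)] with n hn
          omega
      rw [show l * (l⁻¹ * l⁻¹) = l⁻¹ by field_simp] at h1
      refine h1.congr' ?_
      filter_upwards [eventually_ge_atTop m.natAbs] with n hn
      have hm : m ∈ Finset.Icc (-n : ℤ) n := by rw [Finset.mem_Icc]; omega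
      simp only [hw, if_pos hm]
      rw [← gauss_mul_qfac s (N := 2 * n) (k := (n + m).toNat) (by omega),
        show 2 * n - (n + m).toNat = (n - m).toNat by omega]
      field_simp [qfac_ne_zero hs]
    · rw [norm_mul]
      gcongr
      simp only [hw]
      split_ifs
      · exact hC' _ _
      · rw [norm_zero]; exact hC.le
  have h2 := hq.mul hlim
  rw [tsum_mul_right, mul_comm l, mul_assoc, inv_mul_cancel₀ hl, mul_one] at h2
  refine h2.congr fun n => ?_
  rw [Finset.prod_mul_distrib, prod_sym_eq_sum hs0 hv, qfac]
  congr 1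
  rw [tsum_eq_sum (s := Finset.Icc (-n : ℤ) n)]
  · refine Finset.sum_congr rfl fun m hm => ?_
    simp only [hw, if_pos hm]
  · intro m hm
    simp only [hw, if_neg hm, mul_zero]

end JacobiTripleProduct

end ElongatedDiamond

namespace ElongatedDiamond

/-! ### Theta series and their product identities from sublattices of ℤ². -/

section ThetaSeries

/-- The general term `ε^n q^(A n^2 + B n)` of a theta series. -/
def thetaTerm (ε q : ℂ) (A B n : ℤ) : ℂ := ε ^ n * q ^ (A * n ^ 2 + B * n)

/-- The theta series `∑ ε^n q^(A n^2 + B n)` over the integers. -/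
def theta (ε q : ℂ) (A B : ℤ) : ℂ := ∑' n : ℤ, thetaTerm ε q A B n

variable {ε q : ℂ}

theorem norm_eq_one_of_sq (hε : ε ^ 2 = 1) : ‖ε‖ = 1 := by
  rcases sq_eq_one_iff.mp hε with rfl | rfl <;> simp

theorem summable_norm_thetaTerm (hε : ε ^ 2 = 1) (hq0 : q ≠ 0) (hq : ‖q‖ < 1) {A : ℤ} (hA : 0 < A)
    (B : ℤ) : Summable fun n => ‖thetaTerm ε q A B n‖ := by
  have h : ‖q ^ A‖ < 1 := by
    lift A to ℕ using hA.le
    rw [zpow_natCast, norm_pow]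
    exact pow_lt_one₀ (norm_nonneg q) hq (by omega)
  refine (summable_norm_theta (zpow_ne_zero A hq0) h (zpow_ne_zero B hq0)).congr fun n => ?_
  rw [thetaTerm, mul_assoc, norm_mul, norm_mul, zpow_add₀ hq0, zpow_mul, zpow_mul]
  simp [norm_eq_one_of_sq hε]

theorem theta_neg (hε : ε ^ 2 = 1) (A B : ℤ) : theta ε q A (-B) = theta ε q A B := by
  rw [theta, ← (Equiv.neg ℤ).tsum_eq]
  refine tsum_congr fun n => ?_
  have : ε⁻¹ = ε := inv_eq_of_mul_eq_one_right (by rw [← sq, hε])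
  simp only [thetaTerm, Equiv.neg_apply]
  rw [zpow_neg, ← inv_zpow, this]
  congr 2; ring

theorem theta_add_two_mul (hε : ε ^ 2 = 1) (hq0 : q ≠ 0) (A B : ℤ) :
    theta ε q A (B + 2 * A) = ε * q ^ (-A - B) * theta ε q A B := by
  have hε0 : ε ≠ 0 := fun h => by simp [h] at hε
  rw [theta, theta, ← tsum_mul_left, ← (Equiv.addRight (1 : ℤ)).tsum_eq (fun n => _ * _)]
  refine tsum_congr fun n => ?_
  simp only [thetaTerm, Equiv.coe_addRight]
  rw [zpow_add₀ hε0, zpow_one]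
  have : q ^ (A * n ^ 2 + (B + 2 * A) * n) = q ^ (-A - B) * q ^ (A * (n + 1) ^ 2 + B * (n + 1)) := by
    rw [← zpow_add₀ hq0]; congr 1; ring
  rw [this]
  linear_combination -(ε ^ n * q ^ (-A - B) * q ^ (A * (n + 1) ^ 2 + B * (n + 1))) * hε

/-- Reflection and the quasi-period shift from -A to A force this value to equal its own negative.
-/
theorem theta_neg_one_self (hq0 : q ≠ 0) (A : ℤ) : theta (-1) q A A = 0 := by
  have h := theta_add_two_mul (ε := -1) (by norm_num) hq0 A (-A)
  rw [theta_neg (by norm_num), show -A + 2 * A = A by ring, show -A - -A = 0 by ring] at h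
  simp only [zpow_zero, mul_one, neg_mul, one_mul] at h
  linear_combination h / 2

/-- A product of two theta series is a sum over ℤ². When the quadratic form stays diagonal on a
sublattice, splitting into its cosets gives a finite sum of products of theta series. -/
theorem tsum_mul_tsum_eq_sum {ι : Type*} [Fintype ι] {f g : ℤ → ℂ} (hf : Summable fun n => ‖f n‖)
    (hg : Summable fun n => ‖g n‖) (e : ι × (ℤ × ℤ) ≃ ℤ × ℤ) {F G : ι → ℤ → ℂ} {K : ι → ℂ}
    (hF : ∀ c, Summable fun n => ‖F c n‖) (hG : ∀ c, Summable fun n => ‖G c n‖)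
    (h : ∀ c i j, f (e (c, (i, j))).1 * g (e (c, (i, j))).2 = K c * (F c i * G c j)) :
    (∑' n, f n) * ∑' n, g n = ∑ c, K c * ((∑' n, F c n) * ∑' n, G c n) := by
  have hs : Summable fun z : ℤ × ℤ => f z.1 * g z.2 := summable_mul_of_summable_norm hf hg
  rw [tsum_mul_tsum_of_summable_norm hf hg, ← e.tsum_eq (fun z => f z.1 * g z.2),
    Summable.tsum_prod (f := fun z => f (e z).1 * g (e z).2) (e.summable_iff.mpr hs), tsum_fintype]
  refine Finset.sum_congr rfl fun c _ => ?_
  rw [tsum_mul_tsum_of_summable_norm (hF c) (hG c), ← tsum_mul_left]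
  exact tsum_congr fun z => h c z.1 z.2

theorem neg_one_zpow_congr {a b : ℤ} (h : Even (a - b)) : (-1 : ℂ) ^ a = (-1) ^ b := by
  rw [show a = b + (a - b) by ring, zpow_add₀ (by norm_num), h.neg_one_zpow, mul_one]

/-- The decomposition of `ℤ²` into the two cosets of the index two sublattice spanned by `(1, 1)`
and `(1, -1)`. -/
def latticeTwo : Fin 2 × (ℤ × ℤ) ≃ ℤ × ℤ :=
  Equiv.ofBijective (fun z => (z.2.1 + z.2.2 + (z.1 : ℕ), z.2.1 - z.2.2)) <| by
    constructor
    · rintro ⟨⟨c, hc⟩, i, j⟩ ⟨⟨c', hc'⟩, i', j'⟩ h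
      simp only [Prod.mk.injEq, Fin.mk.injEq] at h ⊢
      omega
    · rintro ⟨m, n⟩
      refine ⟨(⟨((m + n) % 2).toNat, by omega⟩, ((m + n) / 2, (m + n) / 2 - n)), ?_⟩
      simp only [Prod.mk.injEq]
      omega

/-- The decomposition of `ℤ²` into the five cosets of the sublattice spanned by `(2, -1)` and
`(1, 2)`. -/
def latticeFive : Fin 5 × (ℤ × ℤ) ≃ ℤ × ℤ :=
  Equiv.ofBijective (fun z => (2 * z.2.1 + z.2.2 + (z.1 : ℕ), 2 * z.2.2 - z.2.1 + (z.1 : ℕ))) <| by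
    constructor
    · rintro ⟨⟨c, hc⟩, i, j⟩ ⟨⟨c', hc'⟩, i', j'⟩ h
      simp only [Prod.mk.injEq, Fin.mk.injEq] at h ⊢
      omega
    · rintro ⟨m, n⟩
      -- The coordinates are recovered from 2m - n = 5i + c and m + 2n = 5j + 3c.
      refine ⟨(⟨((2 * m - n) % 5).toNat, by omega⟩,
        ((2 * m - n) / 5, (m + 2 * n - 3 * ((2 * m - n) % 5)) / 5)), ?_⟩
      simp only [Prod.mk.injEq]
      omega

theorem latticeTwo_apply (c : Fin 2) (i j : ℤ) :
    latticeTwo (c, (i, j)) = (i + j + (c : ℕ), i - j) := rfl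

theorem latticeFive_apply (c : Fin 5) (i j : ℤ) :
    latticeFive (c, (i, j)) = (2 * i + j + (c : ℕ), 2 * j - i + (c : ℕ)) := rfl

theorem theta_mul_theta (hq0 : q ≠ 0) (hq : ‖q‖ < 1) {A : ℤ} (hA : 0 < A) (β γ : ℤ) :
    theta (-1) q A β * theta (-1) q A γ =
      theta 1 q (2 * A) (β + γ) * theta 1 q (2 * A) (β - γ) - q ^ (A - β) *
        (theta 1 q (2 * A) (2 * A - β - γ) * theta 1 q (2 * A) (2 * A - β + γ)) := by
  have h := tsum_mul_tsum_eq_sum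
    (summable_norm_thetaTerm (ε := -1) (by norm_num) hq0 hq hA (-β))
    (summable_norm_thetaTerm (ε := -1) (by norm_num) hq0 hq hA (-γ)) latticeTwo
    (F := fun c => thetaTerm 1 q (2 * A) (2 * A * (c : ℕ) - β - γ))
    (G := fun c => thetaTerm 1 q (2 * A) (2 * A * (c : ℕ) - β + γ))
    (K := fun c => (-1) ^ (c : ℕ) * q ^ ((A - β) * ((c : ℕ) : ℤ)))
    (fun c => summable_norm_thetaTerm (by norm_num) hq0 hq (by omega) _)
    (fun c => summable_norm_thetaTerm (by norm_num) hq0 hq (by omega) _) (fun c i j => by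
      have hs : ((-1 : ℂ) ^ (i + j + (c : ℕ) : ℤ)) * (-1) ^ (i - j) = (-1) ^ (c : ℕ) := by
        rw [← zpow_add₀ (by norm_num), ← zpow_natCast]
        exact neg_one_zpow_congr ⟨i, by ring⟩
      have he : q ^ (A * (i + j + (c : ℕ)) ^ 2 + -β * (i + j + (c : ℕ))) *
          q ^ (A * (i - j) ^ 2 + -γ * (i - j)) = q ^ ((A - β) * ((c : ℕ) : ℤ)) *
          (q ^ (2 * A * i ^ 2 + (2 * A * (c : ℕ) - β - γ) * i) *
          q ^ (2 * A * j ^ 2 + (2 * A * (c : ℕ) - β + γ) * j)) := by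
        have hc : ((c : ℕ) : ℤ) ^ 2 = ((c : ℕ) : ℤ) := by fin_cases c <;> simp
        rw [← zpow_add₀ hq0, ← zpow_add₀ hq0, ← zpow_add₀ hq0]
        congr 1
        linear_combination A * hc
      rw [latticeTwo_apply]
      simp only [thetaTerm, one_zpow, one_mul]
      rw [mul_mul_mul_comm, hs, he]; ring)
  rw [Fin.sum_univ_two] at h
  change theta (-1) q A (-β) * theta (-1) q A (-γ) = _ * (theta 1 q _ _ * theta 1 q _ _) +
    _ * (theta 1 q _ _ * theta 1 q _ _) at h
  rw [theta_neg (by norm_num), theta_neg (by norm_num)] at h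
  rw [h]
  have e1 : theta 1 q (2 * A) (-β - γ) = theta 1 q (2 * A) (β + γ) := by
    rw [← theta_neg (by norm_num)]; congr 1; ring
  have e2 : theta 1 q (2 * A) (-β + γ) = theta 1 q (2 * A) (β - γ) := by
    rw [← theta_neg (by norm_num)]; congr 1; ring
  simp only [Fin.val_zero, Fin.val_one, Nat.cast_zero, Nat.cast_one, mul_zero, mul_one, zero_sub,
    pow_zero, pow_one, zpow_zero, one_mul, e1, e2]
  ring

/-- The vectors (2, -1) and (1, 2) are orthogonal of squared length 5, so the form m² + n² becomes
5(i² + j²) plus linear terms. After reduction by quasi-periods the four cosets with c ≠ 0 contribute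
equally. -/
theorem theta_sq_eq (hq0 : q ≠ 0) (hq : ‖q‖ < 1) :
    theta (-1) q 1 0 ^ 2 =
      theta (-1) q 5 0 ^ 2 - 4 * q * (theta (-1) q 5 4 * theta (-1) q 5 2) := by
  have h := tsum_mul_tsum_eq_sum
    (summable_norm_thetaTerm (ε := -1) (by norm_num) hq0 hq one_pos 0)
    (summable_norm_thetaTerm (ε := -1) (by norm_num) hq0 hq one_pos 0) latticeFive
    (F := fun c => thetaTerm (-1) q 5 (2 * (c : ℕ)))
    (G := fun c => thetaTerm (-1) q 5 (6 * (c : ℕ)))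
    (K := fun c => q ^ (2 * ((c : ℕ) : ℤ) ^ 2))
    (fun c => summable_norm_thetaTerm (by norm_num) hq0 hq (by omega) _)
    (fun c => summable_norm_thetaTerm (by norm_num) hq0 hq (by omega) _) (fun c i j => by
      have hs : ((-1 : ℂ) ^ (2 * i + j + (c : ℕ) : ℤ)) * (-1) ^ (2 * j - i + (c : ℕ) : ℤ) =
          (-1) ^ i * (-1) ^ j := by
        rw [← zpow_add₀ (by norm_num), ← zpow_add₀ (by norm_num)]
        exact neg_one_zpow_congr ⟨j + (c : ℕ), by ring⟩
      have he : q ^ (1 * (2 * i + j + (c : ℕ)) ^ 2 + 0 * (2 * i + j + (c : ℕ))) *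
          q ^ (1 * (2 * j - i + (c : ℕ)) ^ 2 + 0 * (2 * j - i + (c : ℕ))) =
          q ^ (2 * ((c : ℕ) : ℤ) ^ 2) *
          (q ^ (5 * i ^ 2 + 2 * (c : ℕ) * i) * q ^ (5 * j ^ 2 + 6 * (c : ℕ) * j)) := by
        rw [← zpow_add₀ hq0, ← zpow_add₀ hq0, ← zpow_add₀ hq0]
        congr 1
        ring
      rw [latticeFive_apply]
      simp only [thetaTerm]
      rw [mul_mul_mul_comm, hs, he]; ring)
  rw [Fin.sum_univ_five] at h
  change theta (-1) q 1 0 * theta (-1) q 1 0 = _ * (theta (-1) q _ _ * theta (-1) q _ _) +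
    _ * (theta (-1) q _ _ * theta (-1) q _ _) + _ * (theta (-1) q _ _ * theta (-1) q _ _) +
    _ * (theta (-1) q _ _ * theta (-1) q _ _) + _ * (theta (-1) q _ _ * theta (-1) q _ _) at h
  have hn : (-1 : ℂ) ^ 2 = 1 := by norm_num
  have s (B : ℤ) := theta_add_two_mul hn hq0 5 B
  have n (B : ℤ) := theta_neg (q := q) hn 5 B
  have e6 : theta (-1) q 5 6 = -1 * q ^ (-1 : ℤ) * theta (-1) q 5 4 := by simpa [n] using s (-4)
  have e8 : theta (-1) q 5 8 = -1 * q ^ (-3 : ℤ) * theta (-1) q 5 2 := by simpa [n] using s (-2)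
  have e12 : theta (-1) q 5 12 = -1 * q ^ (-7 : ℤ) * theta (-1) q 5 2 := by simpa using s 2
  have e18 : theta (-1) q 5 18 = -1 * q ^ (-13 : ℤ) * theta (-1) q 5 8 := by simpa using s 8
  have e24 : theta (-1) q 5 24 = -1 * q ^ (-19 : ℤ) * theta (-1) q 5 14 := by simpa using s 14
  have e14 : theta (-1) q 5 14 = -1 * q ^ (-9 : ℤ) * theta (-1) q 5 4 := by simpa using s 4
  rw [sq, h]
  norm_num [e6, e12, e18, e24, e14, e8]
  field_simp
  ring

/-- The same sublattice as in `theta_sq_eq`. The cosets c = 1 and c = 3 contain the vanishing factor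
`theta (-1) q 25 25`, which leaves three terms. With q² for q this becomes the quadratic relation
`rr_quadratic`. -/
theorem theta_mul_theta_eq (hq0 : q ≠ 0) (hq : ‖q‖ < 1) :
    theta (-1) q 5 3 * theta (-1) q 5 1 = theta (-1) q 25 5 ^ 2 -
      q ^ 2 * (theta (-1) q 25 15 * theta (-1) q 25 5) - q ^ 4 * theta (-1) q 25 15 ^ 2 := by
  have hn : (-1 : ℂ) ^ 2 = 1 := by norm_num
  have h := tsum_mul_tsum_eq_sum
    (summable_norm_thetaTerm (ε := -1) (by norm_num) hq0 hq (A := 5) (by norm_num) (-3))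
    (summable_norm_thetaTerm (ε := -1) (by norm_num) hq0 hq (A := 5) (by norm_num) (-1)) latticeFive
    (F := fun c => thetaTerm (-1) q 25 (10 * (c : ℕ) - 5))
    (G := fun c => thetaTerm (-1) q 25 (30 * (c : ℕ) - 5))
    (K := fun c => q ^ (10 * ((c : ℕ) : ℤ) ^ 2 - 4 * (c : ℕ)))
    (fun c => summable_norm_thetaTerm (by norm_num) hq0 hq (by omega) _)
    (fun c => summable_norm_thetaTerm (by norm_num) hq0 hq (by omega) _) (fun c i j => by
      have hs : ((-1 : ℂ) ^ (2 * i + j + (c : ℕ) : ℤ)) * (-1) ^ (2 * j - i + (c : ℕ) : ℤ) =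
          (-1) ^ i * (-1) ^ j := by
        rw [← zpow_add₀ (by norm_num), ← zpow_add₀ (by norm_num)]
        exact neg_one_zpow_congr ⟨j + (c : ℕ), by ring⟩
      have he : q ^ (5 * (2 * i + j + (c : ℕ)) ^ 2 + -3 * (2 * i + j + (c : ℕ))) *
          q ^ (5 * (2 * j - i + (c : ℕ)) ^ 2 + -1 * (2 * j - i + (c : ℕ))) =
          q ^ (10 * ((c : ℕ) : ℤ) ^ 2 - 4 * (c : ℕ)) *
          (q ^ (25 * i ^ 2 + (10 * (c : ℕ) - 5) * i) * q ^ (25 * j ^ 2 + (30 * (c : ℕ) - 5) * j)) := by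
        rw [← zpow_add₀ hq0, ← zpow_add₀ hq0, ← zpow_add₀ hq0]
        congr 1
        ring
      rw [latticeFive_apply]
      simp only [thetaTerm]
      rw [mul_mul_mul_comm, hs, he]; ring)
  rw [Fin.sum_univ_five] at h
  change theta (-1) q 5 (-3) * theta (-1) q 5 (-1) = _ * (theta (-1) q _ _ * theta (-1) q _ _) +
    _ * (theta (-1) q _ _ * theta (-1) q _ _) + _ * (theta (-1) q _ _ * theta (-1) q _ _) +
    _ * (theta (-1) q _ _ * theta (-1) q _ _) + _ * (theta (-1) q _ _ * theta (-1) q _ _) at h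
  rw [theta_neg hn, theta_neg hn] at h
  have s (B : ℤ) := theta_add_two_mul hn hq0 25 B
  have n (B : ℤ) := theta_neg (q := q) hn 25 B
  have z : theta (-1) q 25 25 = 0 := theta_neg_one_self hq0 25
  have e35 : theta (-1) q 25 35 = -1 * q ^ (-10 : ℤ) * theta (-1) q 25 15 := by
    simpa [n] using s (-15)
  have e55 : theta (-1) q 25 55 = -1 * q ^ (-30 : ℤ) * theta (-1) q 25 5 := by simpa using s 5
  have e65 : theta (-1) q 25 65 = -1 * q ^ (-40 : ℤ) * theta (-1) q 25 15 := by simpa using s 15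
  have e115 : theta (-1) q 25 115 = -1 * q ^ (-90 : ℤ) * theta (-1) q 25 65 := by simpa using s 65
  rw [h]
  norm_num [e35, e55, e65, e115, z, n]
  field_simp
  ring

/-- By `theta_mul_theta` every product of two of these series is a quadratic expression in theta
series with A = 10 and sign 1. With the factors suitably paired, both sides become the same
polynomial in those series. -/
theorem theta_level_ten (hq0 : q ≠ 0) (hq : ‖q‖ < 1) :
    theta (-1) q 5 3 ^ 2 * theta (-1) q 5 2 * theta (-1) q 5 0 =
      theta (-1) q 5 4 * theta (-1) q 5 1 * (theta (-1) q 5 2 * theta (-1) q 5 1 +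
        q * (theta (-1) q 5 4 * theta (-1) q 5 3)) ∧
    theta (-1) q 5 3 * theta (-1) q 5 1 * theta (-1) q 5 0 ^ 2 =
      (theta (-1) q 5 2 * theta (-1) q 5 1 + q * (theta (-1) q 5 4 * theta (-1) q 5 3)) *
      (theta (-1) q 5 2 * theta (-1) q 5 1 - q * (theta (-1) q 5 4 * theta (-1) q 5 3)) ∧
    theta (-1) q 5 4 * theta (-1) q 5 2 * (theta (-1) q 5 0 ^ 2 +
      q * (theta (-1) q 5 4 * theta (-1) q 5 2)) =
      theta (-1) q 5 3 ^ 2 * theta (-1) q 5 1 ^ 2 := by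
  have h (β γ : ℤ) := theta_mul_theta hq0 hq (A := 5) (by norm_num) β γ
  have p12 := h 4 3
  have p34 := h 2 1
  have p14 := h 4 1
  have p23 := h 3 2
  have p25 := h 3 0
  have p45 := h 1 0
  have p55 := h 0 0
  have p13 := h 4 2
  have p11 := h 4 4
  have p33 := h 2 2
  have p24 := h 3 1
  have p22 := h 3 3
  have p44 := h 1 1
  norm_num at p12 p34 p14 p23 p25 p45 p55 p13 p11 p33 p24 p22 p44
  refine ⟨?_, ?_, ?_⟩
  · calc _ = (theta (-1) q 5 3 * theta (-1) q 5 2) * (theta (-1) q 5 3 * theta (-1) q 5 0) := by ring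
      _ = _ := by rw [p23, p25, p14, p34, p12]; ring
  · calc _ = (theta (-1) q 5 3 * theta (-1) q 5 0) *
          (theta (-1) q 5 1 * theta (-1) q 5 0) := by ring
      _ = _ := by rw [p25, p45, p34, p12]; ring
  · calc _ = (theta (-1) q 5 0 * theta (-1) q 5 0) * (theta (-1) q 5 4 * theta (-1) q 5 2) +
          q * ((theta (-1) q 5 4 * theta (-1) q 5 4) * (theta (-1) q 5 2 * theta (-1) q 5 2)) := by
          ring
      _ = (theta (-1) q 5 3 * theta (-1) q 5 3) * (theta (-1) q 5 1 * theta (-1) q 5 1) := by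
          rw [p55, p13, p11, p33, p22, p44]; ring
      _ = _ := by ring

end ThetaSeries

end ElongatedDiamond

namespace ElongatedDiamond

open PowerSeries
open scoped PowerSeries.WithPiTopology NNReal ENNReal

/-! ### The identity theorem for convergent integral power series. -/

section Injectivity

theorem conv_intCast (c : ℤ) : Conv (c : ℤ⟦X⟧) := intCast_mem convRing c

theorem ev_intCast {q : ℂ} (hq : ‖q‖ < 1) (c : ℤ) : ev q (c : ℤ⟦X⟧) = c :=
  map_intCast (evHom q hq) c

theorem nrm_mono {r s : ℝ≥0} (h : r ≤ s) (f : ℤ⟦X⟧) : nrm r f ≤ nrm s f :=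
  ENNReal.tsum_le_tsum fun n => by gcongr

theorem nrm_X_mul (r : ℝ≥0) (f : ℤ⟦X⟧) : nrm r (X * f) = r * nrm r f := by
  rw [nrm, tsum_eq_zero_add' ENNReal.summable, nrm, ← ENNReal.tsum_mul_left]
  simp only [coeff_zero_X_mul, enorm_zero, zero_mul, zero_add, coeff_succ_X_mul]
  exact tsum_congr fun n => by ring

theorem Conv.of_X_mul {f : ℤ⟦X⟧} (h : Conv (X * f)) : Conv f := fun r hr => by
  -- The radius r may be 0; passing to a positive radius allows division by it.
  have hs : max r (1 / 2) < 1 := max_lt hr (by rw [← NNReal.coe_lt_coe]; norm_num)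
  have h1 := h _ hs
  rw [nrm_X_mul] at h1
  refine ne_top_of_le_ne_top (fun h2 => h1 ?_) (nrm_mono (le_max_left r (1 / 2)) f)
  rw [h2, ENNReal.mul_top]
  rw [Ne, ENNReal.coe_eq_zero]
  exact ((show (0 : ℝ≥0) < 1 / 2 by norm_num).trans_le (le_max_right _ _)).ne'

theorem Conv.exists_eq {f : ℤ⟦X⟧} (hf : Conv f) :
    ∃ g, Conv g ∧ f = ((constantCoeff f : ℤ) : ℤ⟦X⟧) + X * g := by
  obtain ⟨g, hg⟩ : X ∣ f - ((constantCoeff f : ℤ) : ℤ⟦X⟧) := X_dvd_iff.mpr (by simp)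
  refine ⟨g, Conv.of_X_mul ?_, by rw [← hg]; ring⟩
  rw [← hg]; exact hf.sub (conv_intCast _)

theorem Conv.constantCoeff_eq_zero {f : ℤ⟦X⟧} (hf : Conv f)
    (h : ∀ q : ℂ, q ≠ 0 → ‖q‖ < 1 → ev q f = 0) : constantCoeff f = 0 := by
  obtain ⟨g, hg, hfg⟩ := hf.exists_eq
  have hK := hg (1 / 2) (by rw [← NNReal.coe_lt_coe]; norm_num)
  set K := nrm (1 / 2) g with hKdef
  -- Evaluation along the sequence q = 2^(-(m+1)), which tends to 0, suffices.
  have hb : ∀ m : ℕ, ‖((constantCoeff f : ℤ) : ℂ)‖ ≤ (1 / 2) ^ (m + 1) * K.toReal := by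
    intro m
    have hq0 : ((1 / 2 : ℂ) ^ (m + 1)) ≠ 0 := pow_ne_zero _ (by norm_num)
    have hnorm : ‖(1 / 2 : ℂ) ^ (m + 1)‖ = (1 / 2) ^ (m + 1) := by simp
    have hle : (1 / 2 : ℝ) ^ (m + 1) ≤ 1 / 2 := by
      rw [pow_succ]
      have : (1 / 2 : ℝ) ^ m ≤ 1 := pow_le_one₀ (by norm_num) (by norm_num)
      linarith
    have hq : ‖(1 / 2 : ℂ) ^ (m + 1)‖ < 1 := by rw [hnorm]; linarith
    have h0 := h _ hq0 hq
    rw [hfg, ev_add (conv_intCast _) (conv_X.mul hg) hq, ev_intCast hq,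
      ev_mul conv_X hg hq, ev_X] at h0
    have h1 : ((constantCoeff f : ℤ) : ℂ) = -((1 / 2 : ℂ) ^ (m + 1) * ev ((1 / 2 : ℂ) ^ (m + 1)) g) := by
      linear_combination h0
    rw [h1, norm_neg, norm_mul, hnorm]
    gcongr
    have h2 := (enorm_ev_le g (q := (1 / 2 : ℂ) ^ (m + 1))).trans
      (nrm_mono (s := 1 / 2) (by rw [← NNReal.coe_le_coe, coe_nnnorm, hnorm]; exact_mod_cast hle) g)
    have h3 := ENNReal.toReal_mono hK h2
    simpa using h3
  have hlim : Filter.Tendsto (fun m : ℕ => (1 / 2 : ℝ) ^ (m + 1) * K.toReal) Filter.atTop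
      (nhds (0 * K.toReal)) :=
    (((tendsto_pow_atTop_nhds_zero_of_lt_one (by norm_num) (by norm_num)).comp
      (Filter.tendsto_add_atTop_nat 1))).mul_const _
  rw [zero_mul] at hlim
  have := ge_of_tendsto' hlim hb
  rw [norm_le_zero_iff] at this
  simpa using this

/-- A convergent power series vanishing on the punctured disc is zero. -/
theorem Conv.eq_zero {f : ℤ⟦X⟧} (hf : Conv f) (h : ∀ q : ℂ, q ≠ 0 → ‖q‖ < 1 → ev q f = 0) :
    f = 0 := by
  ext n
  induction n generalizing f with
  | zero =>
    simpa using hf.constantCoeff_eq_zero h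
  | succ n ih =>
    obtain ⟨g, hg, hfg⟩ := hf.exists_eq
    have hc : constantCoeff f = 0 := hf.constantCoeff_eq_zero h
    rw [hc, Int.cast_zero, zero_add] at hfg
    rw [hfg, coeff_succ_X_mul, map_zero]
    have := ih hg fun q hq0 hq => by
      have h0 := h q hq0 hq
      rw [hfg, ev_mul conv_X hg hq, ev_X] at h0
      exact (mul_eq_zero.mp h0).resolve_left hq0
    simpa using this

theorem Conv.ext {f g : ℤ⟦X⟧} (hf : Conv f) (hg : Conv g)
    (h : ∀ q : ℂ, q ≠ 0 → ‖q‖ < 1 → ev q f = ev q g) : f = g :=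
  sub_eq_zero.mp ((hf.sub hg).eq_zero fun q hq0 hq => by rw [ev_sub hf hg hq, h q hq0 hq, sub_self])

end Injectivity

end ElongatedDiamond

namespace ElongatedDiamond

open PowerSeries Filter
open scoped PowerSeries.WithPiTopology NNReal ENNReal

/-! ### Euler products and the formal theta identities. -/

section EulerProducts

/-- The product `∏ (1 - X^(m i + j))` over `i ≥ 0`. -/
def eprod (m j : ℕ) : ℤ⟦X⟧ := ∏' i : ℕ, (1 - X ^ (m * i + j))

theorem eprod_dvd {m j : ℕ} (hm : 0 < m) (hj : 0 < j) (i : ℕ) :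
    (X : ℤ⟦X⟧) ^ (i + 1) ∣ (1 - X ^ (m * i + j)) - 1 := by
  rw [show (1 - X ^ (m * i + j)) - 1 = (-X ^ (m * i + j) : ℤ⟦X⟧) by ring, dvd_neg]
  exact pow_dvd_pow _ (by nlinarith)

theorem nrm_eprod {m j : ℕ} (hm : 0 < m) (hj : 0 < j) (r : ℝ≥0) (hr : r < 1) :
    ∃ u : ℕ → ℝ≥0, Summable u ∧ ∀ i, nrm r ((1 - X ^ (m * i + j)) - 1) ≤ u i := by
  refine ⟨fun i => r ^ i, NNReal.summable_geometric hr, fun i => ?_⟩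
  rw [show (1 - X ^ (m * i + j)) - 1 = (-X ^ (m * i + j) : ℤ⟦X⟧) by ring, nrm_neg, nrm_X_pow]
  exact_mod_cast pow_le_pow_of_le_one zero_le hr.le (by nlinarith : i ≤ m * i + j)

theorem conv_eprod {m j : ℕ} (hm : 0 < m) (hj : 0 < j) : Conv (eprod m j) :=
  conv_tprod (eprod_dvd hm hj) (nrm_eprod hm hj)

theorem tendsto_ev_eprod {m j : ℕ} (hm : 0 < m) (hj : 0 < j) {q : ℂ} (hq : ‖q‖ < 1) :
    Tendsto (fun N => ∏ i ∈ Finset.range N, (1 - q ^ (m * i + j))) atTop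
      (nhds (ev q (eprod m j))) := by
  refine (tendsto_ev_prod (eprod_dvd hm hj) (fun i => conv_one.sub (conv_X_pow _))
    (nrm_eprod hm hj) hq).congr fun N => ?_
  refine Finset.prod_congr rfl fun i _ => ?_
  rw [ev_sub conv_one (conv_X_pow _) hq, ev_one, ev_X_pow]

theorem tendsto_eprod {m j : ℕ} (hm : 0 < m) (hj : 0 < j) :
    Tendsto (fun N => ∏ i ∈ Finset.range N, (1 - X ^ (m * i + j) : ℤ⟦X⟧)) atTop
      (nhds (eprod m j)) :=
  (multipliable_of_dvd (eprod_dvd hm hj)).hasProd.tendsto_prod_nat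

theorem constantCoeff_eprod {m j : ℕ} (hm : 0 < m) (hj : 0 < j) :
    constantCoeff (eprod m j) = 1 := by
  rw [← coeff_zero_eq_constantCoeff_apply, eprod, coeff_tprod (eprod_dvd hm hj) le_rfl]
  simp

theorem expand_eprod {m j s : ℕ} (hm : 0 < m) (hj : 0 < j) (hs : s ≠ 0) :
    expand s hs (eprod m j) = eprod (s * m) (s * j) := by
  have hs' := Nat.pos_of_ne_zero hs
  ext n
  have h : expand s hs (∏ i ∈ Finset.range n, (1 - X ^ (m * i + j) : ℤ⟦X⟧)) =
      ∏ i ∈ Finset.range n, (1 - X ^ (s * m * i + s * j)) := by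
    rw [map_prod]
    refine Finset.prod_congr rfl fun i _ => ?_
    rw [map_sub, map_one, map_pow, expand_X, ← pow_mul]
    ring_nf
  rw [eprod, eprod, coeff_tprod (eprod_dvd (by positivity) (by positivity)) le_rfl, ← h]
  by_cases hd : s ∣ n
  · obtain ⟨k, rfl⟩ := hd
    rw [coeff_expand_mul, coeff_expand_mul, coeff_tprod (eprod_dvd hm hj)]
    nlinarith
  · rw [coeff_expand_of_not_dvd s hs _ hd, coeff_expand_of_not_dvd s hs _ hd]

theorem prod_range_mul' {M : Type*} [CommMonoid M] (f : ℕ → M) (d N : ℕ) :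
    ∏ i ∈ Finset.range (d * N), f i =
      ∏ l ∈ Finset.range d, ∏ i ∈ Finset.range N, f (d * i + l) := by
  rw [Finset.prod_comm]
  induction N with
  | zero => simp
  | succ N ih => rw [Nat.mul_succ, Finset.prod_range_add, ih, Finset.prod_range_succ]

theorem eprod_split {m j : ℕ} (hm : 0 < m) (hj : 0 < j) (d : ℕ) (hd : 0 < d) :
    eprod m j = ∏ l ∈ Finset.range d, eprod (d * m) (j + m * l) := by
  have h1 : Tendsto (fun N : ℕ => d * N) atTop atTop :=
    tendsto_atTop_mono (fun n => Nat.le_mul_of_pos_left n hd) tendsto_id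
  refine tendsto_nhds_unique ((tendsto_eprod hm hj).comp h1) ?_
  have h2 := tendsto_finsetProd (Finset.range d)
    (fun l _ => tendsto_eprod (m := d * m) (j := j + m * l) (by positivity) (by positivity))
  refine h2.congr fun N => ?_
  rw [Function.comp_apply, prod_range_mul']
  refine Finset.prod_congr rfl fun l _ => Finset.prod_congr rfl fun i _ => ?_
  ring_nf

/-- The theta series as an infinite product. -/
theorem theta_eq_ev {A B : ℕ} (h : B < A) {q : ℂ} (hq0 : q ≠ 0) (hq : ‖q‖ < 1) :
    theta (-1) q A B = ev q (eprod (2 * A) (2 * A) *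
      (eprod (2 * A) (A + B) * eprod (2 * A) (A - B))) := by
  have hA : 0 < A := by omega
  have c1 := conv_eprod (m := 2 * A) (j := 2 * A) (by omega) (by omega)
  have c2 := conv_eprod (m := 2 * A) (j := A + B) (by omega) (by omega)
  have c3 := conv_eprod (m := 2 * A) (j := A - B) (by omega) (by omega)
  rw [ev_mul c1 (c2.mul c3) hq, ev_mul c2 c3 hq]
  have h1 := (tendsto_ev_eprod (m := 2 * A) (j := 2 * A) (by omega) (by omega) hq).mul
    ((tendsto_ev_eprod (m := 2 * A) (j := A + B) (by omega) (by omega) hq).mul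
    (tendsto_ev_eprod (m := 2 * A) (j := A - B) (by omega) (by omega) hq))
  have hs : ‖q ^ A‖ < 1 := by rw [norm_pow]; exact pow_lt_one₀ (norm_nonneg q) hq (by omega)
  have h2 := tendsto_triple_product (pow_ne_zero A hq0) hs (pow_ne_zero B hq0)
  have h3 : theta (-1) q A B = ∑' n : ℤ, (-1) ^ n * (q ^ A) ^ (n ^ 2) * (q ^ B) ^ n := by
    refine tsum_congr fun n => ?_
    rw [thetaTerm, zpow_add₀ hq0, zpow_mul, zpow_mul, zpow_natCast, zpow_natCast, mul_assoc]
  rw [h3]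
  refine tendsto_nhds_unique h2 (h1.congr fun N => ?_)
  rw [← Finset.prod_mul_distrib, ← Finset.prod_mul_distrib]
  refine Finset.prod_congr rfl fun i _ => ?_
  obtain ⟨D, rfl⟩ : ∃ D, A = B + D := ⟨A - B, by omega⟩
  rw [show B + D - B = D by omega]
  have e2 : q ^ B * (q ^ (B + D)) ^ (2 * i + 1) = q ^ (2 * (B + D) * i + (B + D + B)) := by ring
  have e3 : (q ^ B)⁻¹ * (q ^ (B + D)) ^ (2 * i + 1) = q ^ (2 * (B + D) * i + D) := by
    rw [inv_mul_eq_iff_eq_mul₀ (pow_ne_zero B hq0)]; ring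
  rw [e2, e3]; ring

/-- The formal theta product `∑ (-1)^n X^(A n^2 + B n)`. -/
def thetaProd (A B : ℕ) : ℤ⟦X⟧ :=
  eprod (2 * A) (2 * A) * (eprod (2 * A) (A + B) * eprod (2 * A) (A - B))

theorem conv_thetaProd {A B : ℕ} (h : B < A) : Conv (thetaProd A B) :=
  (conv_eprod (by omega) (by omega)).mul
    ((conv_eprod (by omega) (by omega)).mul (conv_eprod (by omega) (by omega)))

/-- The theta product as an element of the ring of convergent power series. -/
def thetaConv (A B : ℕ) (h : B < A) : convRing := ⟨thetaProd A B, conv_thetaProd h⟩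

/-- The variable as a convergent power series. -/
def convX : convRing := ⟨X, conv_X⟩

/-- This transfers the analytic theta identities to `ℤ⟦X⟧`; q = 0 is excluded because the theta
series involve negative powers of q. -/
theorem convRing_ext {f g : convRing}
    (h : ∀ (q : ℂ) (hq : ‖q‖ < 1), q ≠ 0 → evHom q hq f = evHom q hq g) : f = g :=
  Subtype.ext (Conv.ext f.2 g.2 fun q hq0 hq => h q hq hq0)

theorem evHom_thetaConv {A B : ℕ} (h : B < A) {q : ℂ} (hq : ‖q‖ < 1) (hq0 : q ≠ 0) :
    evHom q hq (thetaConv A B h) = theta (-1) q A B := (theta_eq_ev h hq0 hq).symm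

theorem evHom_convX {q : ℂ} (hq : ‖q‖ < 1) : evHom q hq convX = q := ev_X q

theorem thetaProd_sq_eq :
    thetaProd 1 0 ^ 2 = thetaProd 5 0 ^ 2 - 4 * X * (thetaProd 5 4 * thetaProd 5 2) := by
  have h : thetaConv 1 0 (by norm_num) ^ 2 = thetaConv 5 0 (by norm_num) ^ 2 -
      4 * convX * (thetaConv 5 4 (by norm_num) * thetaConv 5 2 (by norm_num)) :=
    convRing_ext fun q hq hq0 => by
      simpa only [map_sub, map_mul, map_pow, map_ofNat, evHom_convX,
        evHom_thetaConv _ hq hq0, Nat.cast_ofNat, Nat.cast_zero, Nat.cast_one]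
        using theta_sq_eq hq0 hq
  exact congrArg Subtype.val h

theorem thetaProd_mul_eq :
    thetaProd 5 3 * thetaProd 5 1 = thetaProd 25 5 ^ 2 -
      X ^ 2 * (thetaProd 25 15 * thetaProd 25 5) - X ^ 4 * thetaProd 25 15 ^ 2 := by
  have h : thetaConv 5 3 (by norm_num) * thetaConv 5 1 (by norm_num) =
      thetaConv 25 5 (by norm_num) ^ 2 -
      convX ^ 2 * (thetaConv 25 15 (by norm_num) * thetaConv 25 5 (by norm_num)) -
      convX ^ 4 * thetaConv 25 15 (by norm_num) ^ 2 :=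
    convRing_ext fun q hq hq0 => by
      simpa only [map_sub, map_mul, map_pow, evHom_convX,
        evHom_thetaConv _ hq hq0, Nat.cast_ofNat, Nat.cast_zero, Nat.cast_one]
        using theta_mul_theta_eq hq0 hq
  exact congrArg Subtype.val h

theorem thetaProd_level_ten :
    thetaProd 5 3 ^ 2 * thetaProd 5 2 * thetaProd 5 0 =
      thetaProd 5 4 * thetaProd 5 1 * (thetaProd 5 2 * thetaProd 5 1 +
        X * (thetaProd 5 4 * thetaProd 5 3)) ∧
    thetaProd 5 3 * thetaProd 5 1 * thetaProd 5 0 ^ 2 =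
      (thetaProd 5 2 * thetaProd 5 1 + X * (thetaProd 5 4 * thetaProd 5 3)) *
      (thetaProd 5 2 * thetaProd 5 1 - X * (thetaProd 5 4 * thetaProd 5 3)) ∧
    thetaProd 5 4 * thetaProd 5 2 * (thetaProd 5 0 ^ 2 +
      X * (thetaProd 5 4 * thetaProd 5 2)) =
      thetaProd 5 3 ^ 2 * thetaProd 5 1 ^ 2 := by
  set t0 := thetaConv 5 0 (by norm_num) with h0
  set t1 := thetaConv 5 1 (by norm_num) with h1
  set t2 := thetaConv 5 2 (by norm_num) with h2
  set t3 := thetaConv 5 3 (by norm_num) with h3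
  set t4 := thetaConv 5 4 (by norm_num) with h4
  have a : t3 ^ 2 * t2 * t0 = t4 * t1 * (t2 * t1 + convX * (t4 * t3)) :=
    convRing_ext fun q hq hq0 => by
      simpa only [h0, h1, h2, h3, h4, map_add, map_mul, map_pow, evHom_convX,
        evHom_thetaConv _ hq hq0, Nat.cast_ofNat, Nat.cast_zero, Nat.cast_one]
        using (theta_level_ten hq0 hq).1
  have b : t3 * t1 * t0 ^ 2 = (t2 * t1 + convX * (t4 * t3)) * (t2 * t1 - convX * (t4 * t3)) :=
    convRing_ext fun q hq hq0 => by
      simpa only [h0, h1, h2, h3, h4, map_add, map_sub, map_mul, map_pow, evHom_convX,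
        evHom_thetaConv _ hq hq0, Nat.cast_ofNat, Nat.cast_zero, Nat.cast_one]
        using (theta_level_ten hq0 hq).2.1
  have c : t4 * t2 * (t0 ^ 2 + convX * (t4 * t2)) = t3 ^ 2 * t1 ^ 2 :=
    convRing_ext fun q hq hq0 => by
      simpa only [h0, h1, h2, h3, h4, map_add, map_mul, map_pow, evHom_convX,
        evHom_thetaConv _ hq hq0, Nat.cast_ofNat, Nat.cast_zero, Nat.cast_one]
        using (theta_level_ten hq0 hq).2.2
  exact ⟨congrArg Subtype.val a, congrArg Subtype.val b, congrArg Subtype.val c⟩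

end EulerProducts

/-! ### Inverses of Euler products. -/

section InverseSeries

/-- The inverse of a power series with constant coefficient `1`. -/
def pinv (f : ℤ⟦X⟧) : ℤ⟦X⟧ := invOfUnit f 1

theorem mul_pinv {f : ℤ⟦X⟧} (h : constantCoeff f = 1) : f * pinv f = 1 :=
  mul_invOfUnit f 1 (by simpa using h)

theorem constantCoeff_pinv {f : ℤ⟦X⟧} : constantCoeff (pinv f) = 1 := by
  simp [pinv]

theorem pinv_unique {f g : ℤ⟦X⟧} (h : constantCoeff f = 1) (hg : f * g = 1) : g = pinv f := by
  calc g = g * (f * pinv f) := by rw [mul_pinv h, mul_one]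
    _ = (f * g) * pinv f := by ring
    _ = pinv f := by rw [hg, one_mul]

theorem expand_pinv {f : ℤ⟦X⟧} (h : constantCoeff f = 1) {s : ℕ} (hs : s ≠ 0) :
    expand s hs (pinv f) = pinv (expand s hs f) :=
  pinv_unique (by rw [constantCoeff_expand, h]) (by rw [← map_mul, mul_pinv h, map_one])

theorem pinv_one_sub_X_pow {e : ℕ} (he : e ≠ 0) :
    pinv (1 - X ^ e) = expand e he (mk 1) := by
  refine (pinv_unique (by simp [he]) ?_).symm
  rw [show (1 - X ^ e : ℤ⟦X⟧) = expand e he (1 - X) by rw [map_sub, map_one, expand_X], ← map_mul,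
    mul_comm, mk_one_mul_one_sub_eq_one, map_one]

theorem nrm_pinv_one_sub_X_pow_le {e : ℕ} (he : e ≠ 0) (r : ℝ≥0) :
    nrm r (pinv (1 - X ^ e)) ≤ (1 - (r : ℝ≥0∞))⁻¹ := by
  rw [pinv_one_sub_X_pow he, ← ENNReal.tsum_geometric]
  refine ENNReal.tsum_le_tsum fun n => mul_le_of_le_one_left bot_le ?_
  by_cases hd : e ∣ n
  · obtain ⟨k, rfl⟩ := hd
    rw [coeff_expand_mul]; simp
  · rw [coeff_expand_of_not_dvd e he _ hd]; simp

/-- The inverse is the product of the inverse factors. Each inverse factor is a geometric series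
with coefficients 0 and 1, so its norm is at most 1/(1 - r), and its distance from 1 is at most
r^i/(1 - r). -/
theorem conv_pinv_eprod {m j : ℕ} (hm : 0 < m) (hj : 0 < j) : Conv (pinv (eprod m j)) := by
  have hc : ∀ i, constantCoeff (1 - X ^ (m * i + j) : ℤ⟦X⟧) = 1 := fun i => by
    simp [hj.ne']
  have hd : ∀ i, pinv (1 - X ^ (m * i + j)) - 1 = X ^ (m * i + j) * pinv (1 - X ^ (m * i + j)) :=
    fun i => by linear_combination mul_pinv (hc i)
  have hdvd : ∀ i, (X : ℤ⟦X⟧) ^ (i + 1) ∣ pinv (1 - X ^ (m * i + j)) - 1 := fun i => by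
    rw [hd]; exact (pow_dvd_pow _ (by nlinarith)).mul_right _
  have hmul := (multipliable_of_dvd (eprod_dvd hm hj)).tprod_mul (multipliable_of_dvd hdvd)
  rw [tprod_congr fun i => mul_pinv (hc i), tprod_one] at hmul
  rw [← pinv_unique (constantCoeff_eprod hm hj) hmul.symm]
  refine conv_tprod hdvd fun r hr => ⟨fun i => r ^ i * (1 - r)⁻¹,
    (NNReal.summable_geometric hr).mul_right _, fun i => ?_⟩
  have hr' : (1 - r : ℝ≥0) ≠ 0 := (tsub_pos_of_lt hr).ne'
  rw [hd]
  refine (nrm_mul_le _ _ _).trans ?_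
  rw [nrm_X_pow, ENNReal.coe_mul, ENNReal.coe_inv hr', ENNReal.coe_sub, ENNReal.coe_one]
  refine mul_le_mul' ?_ (nrm_pinv_one_sub_X_pow_le (by omega) r)
  exact_mod_cast pow_le_pow_of_le_one zero_le hr.le (by nlinarith : i ≤ m * i + j)

end InverseSeries

end ElongatedDiamond

namespace ElongatedDiamond

open PowerSeries

/-! ### The Rogers-Ramanujan continued fraction and relations of level ten. -/

section LevelTen

/-- The Euler product `∏ (1 - X^(m n))` over `n ≥ 1`. -/
abbrev euler (m : ℕ) : ℤ⟦X⟧ := eprod m m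

/-- The numerator `(X, X^4, X^5; X^5)` of the Rogers-Ramanujan continued fraction. -/
def rrNum : ℤ⟦X⟧ := eprod 5 5 * (eprod 5 4 * eprod 5 1)

/-- The denominator `(X^2, X^3, X^5; X^5)` of the Rogers-Ramanujan continued fraction. -/
def rrDen : ℤ⟦X⟧ := eprod 5 5 * (eprod 5 3 * eprod 5 2)

/-- The Rogers-Ramanujan continued fraction without its factor `q^(1/5)`. -/
def rr : ℤ⟦X⟧ := rrNum * pinv rrDen

/-- Ramanujan's parameter `k(q) = r(q) r(q^2)^2`. -/
def kser : ℤ⟦X⟧ := X * rr * expand 2 two_ne_zero rr ^ 2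

/-- The Hauptmodul `x` as a formal power series. -/
def xser : ℤ⟦X⟧ := X * (euler 2 * euler 10 ^ 3) * (pinv (euler 1) ^ 3 * pinv (euler 5))

/-- The eta quotient that equals `(1 + 5 x) / (1 + 4 x)`. -/
def bser : ℤ⟦X⟧ := euler 10 * euler 2 ^ 3 * (pinv (euler 5) ^ 3 * pinv (euler 1))

theorem constantCoeff_rrNum : constantCoeff rrNum = 1 := by
  simp [rrNum, constantCoeff_eprod]

theorem constantCoeff_rrDen : constantCoeff rrDen = 1 := by
  simp [rrDen, constantCoeff_eprod]

theorem expand_two_rrNum : expand 2 two_ne_zero rrNum = thetaProd 5 3 := by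
  simp [rrNum, thetaProd, expand_eprod]

theorem expand_two_rrDen : expand 2 two_ne_zero rrDen = thetaProd 5 1 := by
  simp [rrDen, thetaProd, expand_eprod]

theorem eprod_five (j : ℕ) (hj : 0 < j) : eprod 5 j = eprod 10 j * eprod 10 (j + 5) := by
  rw [eprod_split (by norm_num) hj 2 (by norm_num)]
  simp [Finset.prod_range_succ]

theorem eprod_two (j : ℕ) (hj : 0 < j) : eprod 2 j = eprod 10 j * eprod 10 (j + 2) *
    eprod 10 (j + 4) * eprod 10 (j + 6) * eprod 10 (j + 8) := by
  rw [eprod_split (by norm_num) hj 5 (by norm_num)]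
  simp [Finset.prod_range_succ]

theorem eprod_one : eprod 1 1 = eprod 2 1 * eprod 2 2 := by
  rw [eprod_split (m := 1) (by norm_num) one_pos 2 (by norm_num)]
  simp [Finset.prod_range_succ]

theorem ne_zero_of_constantCoeff {f : ℤ⟦X⟧} (h : constantCoeff f = 1) : f ≠ 0 := by
  rintro rfl; simp at h

theorem algebraMap_pinv {f : ℤ⟦X⟧} (h : constantCoeff f = 1) :
    algebraMap ℤ⟦X⟧ (FractionRing ℤ⟦X⟧) (pinv f) = (algebraMap ℤ⟦X⟧ (FractionRing ℤ⟦X⟧) f)⁻¹ :=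
  eq_inv_of_mul_eq_one_right (by rw [← map_mul, mul_pinv h, map_one])

theorem algebraMap_eprod_ne_zero {m j : ℕ} (hm : 0 < m) (hj : 0 < j) :
    algebraMap ℤ⟦X⟧ (FractionRing ℤ⟦X⟧) (eprod m j) ≠ 0 :=
  (map_ne_zero_iff _ (IsFractionRing.injective _ _)).mpr
    (ne_zero_of_constantCoeff (constantCoeff_eprod hm hj))

local notation "φ" => algebraMap ℤ⟦X⟧ (FractionRing ℤ⟦X⟧)

theorem algebraMap_rr : φ rr = φ (eprod 5 4) * φ (eprod 5 1) / (φ (eprod 5 3) * φ (eprod 5 2)) := by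
  have h5 := algebraMap_eprod_ne_zero (m := 5) (j := 5) (by norm_num) (by norm_num)
  have h3 := algebraMap_eprod_ne_zero (m := 5) (j := 3) (by norm_num) (by norm_num)
  have h2 := algebraMap_eprod_ne_zero (m := 5) (j := 2) (by norm_num) (by norm_num)
  rw [rr, map_mul, algebraMap_pinv constantCoeff_rrDen, rrNum, rrDen]
  simp only [map_mul]
  field_simp

theorem expand_two_rr : expand 2 two_ne_zero rr = thetaProd 5 3 * pinv (thetaProd 5 1) := by
  rw [rr, map_mul, expand_pinv constantCoeff_rrDen, expand_two_rrNum, expand_two_rrDen]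

theorem constantCoeff_thetaProd {A B : ℕ} (h : B < A) : constantCoeff (thetaProd A B) = 1 := by
  rw [thetaProd, map_mul, map_mul, constantCoeff_eprod (by omega) (by omega),
    constantCoeff_eprod (by omega) (by omega), constantCoeff_eprod (by omega) (by omega)]
  norm_num

theorem algebraMap_thetaProd_ne_zero {A B : ℕ} (h : B < A) : φ (thetaProd A B) ≠ 0 :=
  (map_ne_zero_iff _ (IsFractionRing.injective _ _)).mpr
    (ne_zero_of_constantCoeff (constantCoeff_thetaProd h))

theorem algebraMap_expand_rr :
    φ (expand 2 two_ne_zero rr) = φ (thetaProd 5 3) / φ (thetaProd 5 1) := by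
  rw [expand_two_rr, map_mul, algebraMap_pinv (constantCoeff_thetaProd (by norm_num)), div_eq_mul_inv]

/-- Splitting the products of modulus 5 into modulus 10 writes r(q) in the same theta functions as
r(q²), so that `thetaProd_level_ten` applies to both. -/
theorem algebraMap_rr_eq : φ rr = φ (thetaProd 5 4) * φ (thetaProd 5 1) /
    (φ (thetaProd 5 3) * φ (thetaProd 5 2)) := by
  have h (j : ℕ) (hj : 0 < j) := algebraMap_eprod_ne_zero (m := 10) (j := j) (by norm_num) hj
  have h1 := h 1 (by norm_num)
  have h2 := h 2 (by norm_num)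
  have h3 := h 3 (by norm_num)
  have h7 := h 7 (by norm_num)
  have h8 := h 8 (by norm_num)
  have h10 := h 10 (by norm_num)
  rw [algebraMap_rr, eprod_five 4 (by norm_num), eprod_five 1 (by norm_num),
    eprod_five 3 (by norm_num), eprod_five 2 (by norm_num)]
  simp only [thetaProd, map_mul]
  norm_num
  field_simp

theorem algebraMap_kser : φ kser = φ X * (φ (thetaProd 5 4) * φ (thetaProd 5 3)) /
    (φ (thetaProd 5 2) * φ (thetaProd 5 1)) := by
  have h1 := algebraMap_thetaProd_ne_zero (A := 5) (B := 1) (by norm_num)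
  have h2 := algebraMap_thetaProd_ne_zero (A := 5) (B := 2) (by norm_num)
  have h3 := algebraMap_thetaProd_ne_zero (A := 5) (B := 3) (by norm_num)
  rw [kser, map_mul, map_mul, map_pow, algebraMap_rr_eq, algebraMap_expand_rr]
  field_simp

/-- The relation between the Rogers-Ramanujan continued fractions at `q` and `q^2`. -/
theorem rr_relation : expand 2 two_ne_zero rr * (1 - kser) = rr ^ 2 * (1 + kser) := by
  obtain ⟨p1, p2, -⟩ := thetaProd_level_ten
  -- Eliminate `thetaProd 5 0 ^ 2` between the square of `p1` and `p2`; a common factor with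
  -- constant term 1 then cancels.
  have key : thetaProd 5 3 ^ 3 * thetaProd 5 2 ^ 2 *
      (thetaProd 5 2 * thetaProd 5 1 - X * (thetaProd 5 4 * thetaProd 5 3)) =
      thetaProd 5 4 ^ 2 * thetaProd 5 1 ^ 3 *
      (thetaProd 5 2 * thetaProd 5 1 + X * (thetaProd 5 4 * thetaProd 5 3)) := by
    have hne : thetaProd 5 2 * thetaProd 5 1 + X * (thetaProd 5 4 * thetaProd 5 3) ≠ 0 :=
      ne_zero_of_constantCoeff (by simp [constantCoeff_thetaProd])
    refine mul_right_cancel₀ hne ?_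
    linear_combination (-(thetaProd 5 3 ^ 3 * thetaProd 5 2 ^ 2)) * p2 +
      (thetaProd 5 1 * (thetaProd 5 3 ^ 2 * thetaProd 5 2 * thetaProd 5 0 + thetaProd 5 4 *
        thetaProd 5 1 * (thetaProd 5 2 * thetaProd 5 1 + X * (thetaProd 5 4 * thetaProd 5 3)))) * p1
  have key' := congrArg φ key
  simp only [map_mul, map_add, map_sub, map_pow] at key'
  have h1 := algebraMap_thetaProd_ne_zero (A := 5) (B := 1) (by norm_num)
  have h2 := algebraMap_thetaProd_ne_zero (A := 5) (B := 2) (by norm_num)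
  have h3 := algebraMap_thetaProd_ne_zero (A := 5) (B := 3) (by norm_num)
  apply IsFractionRing.injective ℤ⟦X⟧ (FractionRing ℤ⟦X⟧)
  simp only [map_mul, map_add, map_sub, map_pow, map_one, algebraMap_kser, algebraMap_rr_eq,
    algebraMap_expand_rr]
  field_simp
  linear_combination key'

theorem algebraMap_euler :
    φ (euler 1) = φ (eprod 10 1) * φ (eprod 10 2) * φ (eprod 10 3) * φ (eprod 10 4) *
      φ (eprod 10 5) * φ (eprod 10 6) * φ (eprod 10 7) * φ (eprod 10 8) * φ (eprod 10 9) *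
      φ (eprod 10 10) ∧
    φ (euler 2) = φ (eprod 10 2) * φ (eprod 10 4) * φ (eprod 10 6) * φ (eprod 10 8) *
      φ (eprod 10 10) ∧
    φ (euler 5) = φ (eprod 10 5) * φ (eprod 10 10) := by
  rw [euler, euler, euler, eprod_one, eprod_two 1 one_pos, eprod_two 2 two_pos,
    eprod_five 5 (by norm_num)]
  norm_num
  ring

/-- The Hauptmodul in terms of Ramanujan's parameter. -/
theorem xser_relation : xser * (1 - 4 * kser - kser ^ 2) = kser := by
  obtain ⟨-, p2, -⟩ := thetaProd_level_ten
  have hx : φ xser * φ (thetaProd 1 0) ^ 2 = φ X * (φ (thetaProd 5 4) * φ (thetaProd 5 2)) := by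
    have h (j : ℕ) (hj : 0 < j) := algebraMap_eprod_ne_zero (m := 10) (j := j) (by norm_num) hj
    have h1 := h 1 (by norm_num)
    have h2 := h 2 (by norm_num)
    have h3 := h 3 (by norm_num)
    have h4 := h 4 (by norm_num)
    have h5 := h 5 (by norm_num)
    have h6 := h 6 (by norm_num)
    have h7 := h 7 (by norm_num)
    have h8 := h 8 (by norm_num)
    have h9 := h 9 (by norm_num)
    have h10 := h 10 (by norm_num)
    obtain ⟨e1, e2, e5⟩ := algebraMap_euler
    have ht : thetaProd 1 0 = eprod 2 2 * (eprod 2 1 * eprod 2 1) := rfl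
    rw [xser, ht, eprod_two 1 one_pos, eprod_two 2 two_pos]
    simp only [map_mul, map_pow, algebraMap_pinv (constantCoeff_eprod (m := 1) one_pos one_pos),
      algebraMap_pinv (constantCoeff_eprod (m := 5) (j := 5) (by norm_num) (by norm_num)), e1, e2, e5,
      thetaProd]
    norm_num
    field_simp
  rw [← map_pow, thetaProd_sq_eq] at hx
  have p2' := congrArg φ p2
  simp only [map_mul, map_add, map_sub, map_pow, map_ofNat] at hx p2'
  have h0 := algebraMap_thetaProd_ne_zero (A := 5) (B := 0) (by norm_num)
  have h1 := algebraMap_thetaProd_ne_zero (A := 5) (B := 1) (by norm_num)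
  have h2 := algebraMap_thetaProd_ne_zero (A := 5) (B := 2) (by norm_num)
  have h3 := algebraMap_thetaProd_ne_zero (A := 5) (B := 3) (by norm_num)
  apply IsFractionRing.injective ℤ⟦X⟧ (FractionRing ℤ⟦X⟧)
  simp only [map_mul, map_sub, map_pow, map_one, map_ofNat, algebraMap_kser]
  field_simp
  linear_combination (φ (thetaProd 5 3) * φ (thetaProd 5 1)) * hx - φ xser * p2'

/-- With θ_B = `thetaProd 5 B`, the identity `p3` gives bser = 1 + X θ₄θ₂/θ₀², and `p2` identifies
this last quotient with k/(1 - k²). -/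
theorem bser_relation : bser * (1 - kser ^ 2) = 1 + kser - kser ^ 2 := by
  obtain ⟨-, p2, p3⟩ := thetaProd_level_ten
  have hb : φ bser * (φ (thetaProd 5 4) * φ (thetaProd 5 2) * φ (thetaProd 5 0) ^ 2) =
      φ (thetaProd 5 3) ^ 2 * φ (thetaProd 5 1) ^ 2 := by
    have h (j : ℕ) (hj : 0 < j) := algebraMap_eprod_ne_zero (m := 10) (j := j) (by norm_num) hj
    have h1 := h 1 (by norm_num)
    have h2 := h 2 (by norm_num)
    have h3 := h 3 (by norm_num)
    have h4 := h 4 (by norm_num)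
    have h5 := h 5 (by norm_num)
    have h6 := h 6 (by norm_num)
    have h7 := h 7 (by norm_num)
    have h8 := h 8 (by norm_num)
    have h9 := h 9 (by norm_num)
    have h10 := h 10 (by norm_num)
    obtain ⟨e1, e2, e5⟩ := algebraMap_euler
    rw [bser]
    simp only [map_mul, map_pow, algebraMap_pinv (constantCoeff_eprod (m := 1) one_pos one_pos),
      algebraMap_pinv (constantCoeff_eprod (m := 5) (j := 5) (by norm_num) (by norm_num)), e1, e2, e5,
      thetaProd]
    norm_num
    field_simp
  have p2' := congrArg φ p2
  have p3' := congrArg φ p3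
  simp only [map_mul, map_add, map_sub, map_pow] at p2' p3'
  have h0 := algebraMap_thetaProd_ne_zero (A := 5) (B := 0) (by norm_num)
  have h1 := algebraMap_thetaProd_ne_zero (A := 5) (B := 1) (by norm_num)
  have h2 := algebraMap_thetaProd_ne_zero (A := 5) (B := 2) (by norm_num)
  have h3 := algebraMap_thetaProd_ne_zero (A := 5) (B := 3) (by norm_num)
  have h4 := algebraMap_thetaProd_ne_zero (A := 5) (B := 4) (by norm_num)
  have hb' : φ bser * φ (thetaProd 5 0) ^ 2 = φ (thetaProd 5 0) ^ 2 +
      φ X * (φ (thetaProd 5 4) * φ (thetaProd 5 2)) := by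
    refine mul_left_cancel₀ (mul_ne_zero h4 h2) ?_
    linear_combination hb - p3'
  apply IsFractionRing.injective ℤ⟦X⟧ (FractionRing ℤ⟦X⟧)
  simp only [map_mul, map_add, map_sub, map_pow, map_one, algebraMap_kser]
  field_simp
  linear_combination (φ (thetaProd 5 3) * φ (thetaProd 5 1)) * hb' - (φ bser - 1) * p2'

theorem rrNum_mul_rrDen : rrNum * rrDen = euler 1 * euler 5 := by
  rw [rrNum, rrDen, euler, euler, eprod_one, eprod_two 1 one_pos, eprod_two 2 two_pos,
    eprod_five 5 (by norm_num), eprod_five 4 (by norm_num), eprod_five 3 (by norm_num),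
    eprod_five 2 (by norm_num), eprod_five 1 (by norm_num)]
  norm_num
  ring

theorem expand_injective {s : ℕ} (hs : s ≠ 0) {f g : ℤ⟦X⟧} (h : expand s hs f = expand s hs g) :
    f = g := by
  ext n
  rw [← coeff_expand_mul s hs f, h, coeff_expand_mul]

/-- After q ↦ q², which is injective, this is `thetaProd_mul_eq`. Divided through, it is 1/p = 1/ρ -
1 - ρ, the form used in `pser_relation`. -/
theorem rr_quadratic : euler 1 * euler 5 = expand 5 (by norm_num) rrDen ^ 2 -
    X * (expand 5 (by norm_num) rrNum * expand 5 (by norm_num) rrDen) -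
    X ^ 2 * expand 5 (by norm_num) rrNum ^ 2 := by
  apply expand_injective two_ne_zero
  have ha : expand 2 two_ne_zero (expand 5 (by norm_num) rrNum) = thetaProd 25 15 := by
    simp [rrNum, thetaProd, expand_eprod]
  have hb : expand 2 two_ne_zero (expand 5 (by norm_num) rrDen) = thetaProd 25 5 := by
    simp [rrDen, thetaProd, expand_eprod]
  rw [← rrNum_mul_rrDen]
  simp only [map_mul, map_sub, map_pow, expand_X, ha, hb, expand_two_rrNum, expand_two_rrDen]
  rw [thetaProd_mul_eq]; ring

/-- The series `q (q^25; q^25) / (q; q)`. -/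
def pser : ℤ⟦X⟧ := X * euler 25 * pinv (euler 1)

/-- The Rogers-Ramanujan continued fraction `r(q^5)`. -/
def rhoser : ℤ⟦X⟧ := X * expand 5 (by norm_num) rr

theorem pser_relation : pser * (1 - rhoser - rhoser ^ 2) = rhoser := by
  have h1 := algebraMap_eprod_ne_zero (m := 1) (j := 1) one_pos one_pos
  have hd : constantCoeff (expand 5 (by norm_num) rrDen) = 1 := by
    rw [constantCoeff_expand, constantCoeff_rrDen]
  have hb : φ (expand 5 (by norm_num) rrDen) ≠ 0 :=
    (map_ne_zero_iff _ (IsFractionRing.injective _ _)).mpr (ne_zero_of_constantCoeff hd)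
  have hq := congrArg φ rr_quadratic
  have hm := congrArg (fun f => φ (expand 5 (by norm_num) f)) rrNum_mul_rrDen
  simp only [map_mul, map_sub, map_pow, euler, expand_eprod (m := 1) (j := 1) one_pos one_pos,
    expand_eprod (m := 5) (j := 5) (s := 5) (by norm_num) (by norm_num), Nat.reduceMul] at hq hm
  have h5 := algebraMap_eprod_ne_zero (m := 5) (j := 5) (by norm_num) (by norm_num)
  apply IsFractionRing.injective ℤ⟦X⟧ (FractionRing ℤ⟦X⟧)
  simp only [pser, rhoser, rr, map_mul, map_sub, map_pow, map_one, expand_pinv constantCoeff_rrDen,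
    algebraMap_pinv hd, algebraMap_pinv (constantCoeff_eprod (m := 1) one_pos one_pos), euler]
  refine mul_left_cancel₀ h5 ?_
  field_simp
  linear_combination (-φ (eprod 25 25)) * hq - φ (eprod 1 1) * hm

end LevelTen

end ElongatedDiamond

namespace ElongatedDiamond

open PowerSeries

/-! ### The operator U₅. -/

section Hecke

/-- The operator `U₅` that picks out the coefficients with index divisible by `5`. -/
def U : ℤ⟦X⟧ →+ ℤ⟦X⟧ where
  toFun f := PowerSeries.mk fun n => coeff (5 * n) f
  map_zero' := by ext n; simp
  map_add' f g := by ext n; simp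

theorem coeff_U (f : ℤ⟦X⟧) (n : ℕ) : coeff n (U f) = coeff (5 * n) f := by
  simp [U]

/-- The substitution `X ↦ X^5`. -/
def E5 : ℤ⟦X⟧ →ₐ[ℤ] ℤ⟦X⟧ := expand 5 (by norm_num)

theorem E5_apply (f : ℤ⟦X⟧) : E5 f = expand 5 (by norm_num) f := rfl

theorem coeff_E5_of_not_dvd (f : ℤ⟦X⟧) {n : ℕ} (h : ¬5 ∣ n) : coeff n (E5 f) = 0 :=
  coeff_expand_of_not_dvd 5 _ f h

theorem U_E5_mul (g f : ℤ⟦X⟧) : U (E5 g * f) = g * U f := by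
  ext n
  rw [coeff_U, coeff_mul, coeff_mul]
  symm
  refine Finset.sum_of_injOn (fun p => (5 * p.1, 5 * p.2)) ?_ ?_ ?_ ?_
  · intro a _ b _ h
    simp only [Prod.mk.injEq] at h
    exact Prod.ext (by omega) (by omega)
  · intro p hp
    simp only [SetLike.mem_coe, Finset.HasAntidiagonal.mem_antidiagonal] at hp ⊢
    omega
  · rintro ⟨a, b⟩ hp hn
    rw [Finset.HasAntidiagonal.mem_antidiagonal] at hp
    simp only at hp
    rw [coeff_E5_of_not_dvd, zero_mul]
    rintro ⟨c, rfl⟩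
    refine hn ⟨(c, n - c), ?_, Prod.ext (by dsimp only) (by dsimp only; omega)⟩
    simp only [SetLike.mem_coe, Finset.HasAntidiagonal.mem_antidiagonal]; omega
  · intro p _
    rw [coeff_U, E5_apply, coeff_expand_mul]

theorem U_one : U 1 = 1 := by
  ext n; rw [coeff_U, coeff_one, coeff_one]; simp

theorem U_E5 (g : ℤ⟦X⟧) : U (E5 g) = g := by simpa [U_one] using U_E5_mul g 1

theorem U_X_pow {i : ℕ} (hi : ¬5 ∣ i) : U (X ^ i) = 0 := by
  ext n
  rw [coeff_U, coeff_X_pow, if_neg (fun h => hi ⟨n, h.symm⟩), map_zero]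

end Hecke

/-! ### Computable arithmetic of integer polynomials. -/

section ListPolynomials

/-- Evaluation of the polynomial with the given list of coefficients. -/
def pev {R : Type*} [CommRing R] : List ℤ → R → R
  | [], _ => 0
  | a :: l, z => a + z * pev l z

/-- Sum of polynomials given by coefficient lists. -/
def padd : List ℤ → List ℤ → List ℤ
  | [], m => m
  | a :: l, [] => a :: l
  | a :: l, b :: m => (a + b) :: padd l m

/-- Product of polynomials given by coefficient lists. -/
def pmul : List ℤ → List ℤ → List ℤ
  | [], _ => []
  | a :: l, m => padd (m.map (a * ·)) (0 :: pmul l m)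

/-- Equality of polynomials given by coefficient lists. -/
def peq : List ℤ → List ℤ → Bool
  | [], m => m.all (· == 0)
  | a :: l, [] => a == 0 && peq l []
  | a :: l, b :: m => a == b && peq l m

/-- The homogenization `∑ l_r z^r w^(d - r)` of a polynomial with `d + 1` coefficients, together
with `w^(d + 1)`. -/
def phom (w : List ℤ) : List ℤ → List ℤ × List ℤ
  | [] => ([], [1])
  | a :: l => match phom w l with
    | (h, v) => (padd (v.map (a * ·)) (0 :: h), pmul w v)

variable {R : Type*} [CommRing R] (z : R)

theorem pev_nil : pev [] z = 0 := rfl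

theorem pev_cons (a : ℤ) (l : List ℤ) : pev (a :: l) z = a + z * pev l z := rfl

theorem pev_padd (l m : List ℤ) : pev (padd l m) z = pev l z + pev m z := by
  induction l generalizing m with
  | nil => simp [padd, pev]
  | cons a l ih =>
    cases m with
    | nil => simp [padd, pev]
    | cons b m => simp only [padd, pev, ih]; push_cast; ring

theorem pev_map (a : ℤ) (l : List ℤ) : pev (l.map (a * ·)) z = a * pev l z := by
  induction l with
  | nil => simp [pev]
  | cons b l ih => simp only [List.map_cons, pev, ih]; push_cast; ring

theorem pev_pmul (l m : List ℤ) : pev (pmul l m) z = pev l z * pev m z := by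
  induction l with
  | nil => simp [pmul, pev]
  | cons a l ih =>
    simp only [pmul, pev_padd, pev_map, pev_cons, ih]; push_cast; ring

theorem pev_eq_zero_of_all {m : List ℤ} (h : m.all (· == 0) = true) : pev m z = 0 := by
  induction m with
  | nil => rfl
  | cons a m ih =>
    simp only [List.all_cons, Bool.and_eq_true, beq_iff_eq] at h
    rw [pev_cons, ih h.2, h.1]; simp

theorem pev_eq_of_peq {l m : List ℤ} (h : peq l m = true) : pev l z = pev m z := by
  induction l generalizing m with
  | nil => rw [pev_eq_zero_of_all z h, pev_nil]
  | cons a l ih =>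
    cases m with
    | nil =>
      simp only [peq, Bool.and_eq_true, beq_iff_eq] at h
      rw [pev_cons, ih h.2, h.1]; simp [pev]
    | cons b m =>
      simp only [peq, Bool.and_eq_true, beq_iff_eq] at h
      rw [pev_cons, pev_cons, ih h.2, h.1]

theorem map_pev {S : Type*} [CommRing S] (f : R →+* S) (l : List ℤ) :
    f (pev l z) = pev l (f z) := by
  induction l with
  | nil => simp [pev]
  | cons a l ih => simp [pev, ih]

/-- The substitution x = z / w(z) with denominators cleared, stated without division. It converts
polynomials in x into polynomials in k. -/
theorem pev_phom {w l : List ℤ} {x : R} (h : pev w z * x = z) :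
    pev (phom w l).2 z = pev w z ^ l.length ∧
      pev l x * pev w z ^ l.length = pev w z * pev (phom w l).1 z := by
  induction l with
  | nil => simp [phom, pev]
  | cons a l ih =>
    obtain ⟨h1, h2⟩ := ih
    simp only [phom, List.length_cons, pev_pmul, pev_padd, pev_map, pev_cons, h1]
    constructor
    · ring
    · push_cast
      linear_combination (pev w z * x) * h2 + (pev w z * pev (phom w l).1 z) * h

end ListPolynomials

end ElongatedDiamond

namespace ElongatedDiamond

open PowerSeries

/-! ### Coordinate data for the algebra of rank five, and the resulting polynomials. -/

section FreeModule

/-- Coordinates with respect to the basis `1, e₁, e₂, e₃, e₄`, as polynomials in `k(q^5)`. -/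
structure Quint where
  /-- The coordinate at `1`. -/
  c0 : List ℤ
  /-- The coordinate at `e₁`. -/
  c1 : List ℤ
  /-- The coordinate at `e₂`. -/
  c2 : List ℤ
  /-- The coordinate at `e₃`. -/
  c3 : List ℤ
  /-- The coordinate at `e₄`. -/
  c4 : List ℤ

/-- Multiplication of coordinate vectors. -/
def Quint.mul (u v : Quint) : Quint where
  c0 := padd (pmul u.c0 v.c0) (pmul [0, 1, 0, -1]
    (padd (padd (pmul u.c1 v.c4) (pmul u.c4 v.c1)) (padd (pmul u.c2 v.c3) (pmul u.c3 v.c2))))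
  c1 := padd (padd (pmul u.c0 v.c1) (pmul u.c1 v.c0))
    (padd (pmul [0, 1, -1] (padd (pmul u.c2 v.c4) (pmul u.c4 v.c2)))
      (pmul [0, 1, 1] (pmul u.c3 v.c3)))
  c2 := padd (padd (pmul u.c0 v.c2) (pmul u.c2 v.c0))
    (padd (pmul [0, 1, 1] (padd (pmul u.c3 v.c4) (pmul u.c4 v.c3)))
      (pmul [1, 1] (pmul u.c1 v.c1)))
  c3 := padd (padd (pmul u.c0 v.c3) (pmul u.c3 v.c0))
    (padd (pmul [1, -1] (padd (pmul u.c1 v.c2) (pmul u.c2 v.c1)))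
      (pmul [0, 1, -1] (pmul u.c4 v.c4)))
  c4 := padd (padd (pmul u.c0 v.c4) (pmul u.c4 v.c0))
    (padd (pmul [1, 1] (padd (pmul u.c1 v.c3) (pmul u.c3 v.c1)))
      (pmul [1, -1] (pmul u.c2 v.c2)))

/-- Multiplication of a coordinate vector by a scalar. -/
def Quint.smul (w : List ℤ) (u : Quint) : Quint :=
  ⟨pmul w u.c0, pmul w u.c1, pmul w u.c2, pmul w u.c3, pmul w u.c4⟩

/-- Sum of coordinate vectors. -/
def Quint.add (u v : Quint) : Quint :=
  ⟨padd u.c0 v.c0, padd u.c1 v.c1, padd u.c2 v.c2, padd u.c3 v.c3, padd u.c4 v.c4⟩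

/-- Equality of coordinate vectors. -/
def Quint.eq (u v : Quint) : Bool :=
  peq u.c0 v.c0 && peq u.c1 v.c1 && peq u.c2 v.c2 && peq u.c3 v.c3 && peq u.c4 v.c4

/-- Coordinates of `x δ^5`. -/
def xCoord : Quint :=
  ⟨[0, 41, 204, 252, -228, -330, 228, 252, -204, 41],
  [1, 64, 252, 52, -30, 8, -268, 196, -19],
  [3, 107, 311, 311, -15, 49, 141, -147, 8],
  [8, 147, 141, -49, -15, -311, 311, -107, 3],
  [19, 196, 268, 8, 30, 52, -252, 64, -1]⟩

/-- Coordinates of `(x δ^5)^2`. -/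
def xCoord2 : Quint :=
  ⟨[0, 86, 7099, 89122, 318232, 335360, -245036, -647664, -252632, 231388, 410210, -231388, -252632,
    647664, -245036, -335360, 318232, -89122, 7099, -86],
  [0, 260, 13200, 123625, 339175, 260625, -275585, -430275, -24525, 8925, 62875, 365595, -397675,
    -124525, 467325, -282625, 60945, -3525, 25],
  [1, 679, 23752, 183622, 507010, 515074, -19394, -448962, -284652, 165360, -8058, -141422, 440174,
    -78306, -293510, 195562, -37637, 1609, -6],
  [6, 1609, 37637, 195562, 293510, -78306, -440174, -141422, 8058, 165360, 284652, -448962, 19394,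
    515074, -507010, 183622, -23752, 679, -1],
  [25, 3525, 60945, 282625, 467325, 124525, -397675, -365595, 62875, -8925, -24525, 430275, -275585,
    -260625, 339175, -123625, 13200, -260]⟩

/-- Coordinates of `(x δ^5)^3`. -/
def xCoord3 : Quint :=
  ⟨[0, 51, 24639, 1480067, 25353537, 168512085, 495262710, 535005750, -422804790, -1526894385,
    -907362255, 811045005, 1202328015, 351850665, -381545100, -665221260, 381545100, 351850665,
    -1202328015, 811045005, 907362255, -1526894385, 422804790, 535005750, -495262710, 168512085,
    -25353537, 1480067, -24639, 51],
  [0, 228, 63318, 2837667, 39151385, 216455120, 530387810, 428428250, -516975460, -1218685780,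
    -502451860, 632909225, 699613805, 10768800, -23172060, -136061220, -568141280, 764621980,
    162307630, -1254653595, 999215235, 208343760, -746919270, 459296490, -126871740, 15753620,
    -733456, 8879, -9],
  [0, 873, 152578, 5335047, 63175955, 325398760, 811633590, 864298160, -205226840, -1400481615,
    -1107139780, 149031335, 791916675, 435457240, -250024980, 65452440, 203655240, -792348005,
    372285210, 788799365, -978307095, 90460800, 454493310, -308462600, 82120080, -9029365, 341384,
    -2931, 1],
  [1, 2931, 341384, 9029365, 82120080, 308462600, 454493310, -90460800, -978307095, -788799365,
    372285210, 792348005, 203655240, -65452440, -250024980, -435457240, 791916675, -149031335,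
    -1107139780, 1400481615, -205226840, -864298160, 811633590, -325398760, 63175955, -5335047,
    152578, -873],
  [9, 8879, 733456, 15753620, 126871740, 459296490, 746919270, 208343760, -999215235, -1254653595,
    -162307630, 764621980, 568141280, -136061220, 23172060, 10768800, -699613805, 632909225,
    502451860, -1218685780, 516975460, 428428250, -530387810, 216455120, -39151385, 2837667, -63318,
    228]⟩

/-- Coordinates of `(x δ^5)^4`. -/
def xCoord4 : Quint :=
  ⟨[0, 12, 31762, 6259336, 326772639, 6610527720, 62582882482, 307070192132, 787760008776,
    803723811424, -819078175240, -3095881409392, -2380323544092, 1822399442064, 4227344410936,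
    1647370499200, -1925035428360, -2161412560360, -496917793780, 700555901280, 1090976637050,
    -700555901280, -496917793780, 2161412560360, -1925035428360, -1647370499200, 4227344410936,
    -1822399442064, -2380323544092, 3095881409392, -819078175240, -803723811424, 787760008776,
    -307070192132, 62582882482, -6610527720, 326772639, -6259336, 31762, -12],
  [0, 86, 105014, 15077153, 635388495, 10844509325, 88628052451, 378810664014, 836637257898,
    649353849510, -1026502084350, -2709682398686, -1522968681194, 1736945135922, 2843305578950,
    776985137750, -1294937948030, -1174431894070, 27573440310, 47100891300, 261597692500,
    909785278860, -1420999962260, -120307172470, 2587337651550, -2637597794750, -601217252842,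
    3148769437742, -2143017704966, -241101036290, 1172601199850, -760218055982, 245406083702,
    -43027280136, 3900774780, -161627925, 2466637, -8777, 1],
  [0, 472, 321636, 34915020, 1224455120, 18410036280, 138979918297, 575116657911, 1312806433385,
    1343309511335, -633597959535, -3334259843137, -3088923847631, 558319620575, 3198756741325,
    2073244276675, -396610059235, -1374236355805, -674657475075, 439672018675, -121626533675,
    -268049095605, 1414207566635, -950758022075, -1468609836325, 2722726914325, -654179784109,
    -2013670653667, 1940346998035, -194991562915, -693089450385, 499984496321, -160136166177,
    26404080905, -2147514245, 75828645, -916521, 2177],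
  [0, 2177, 916521, 75828645, 2147514245, 26404080905, 160136166177, 499984496321, 693089450385,
    -194991562915, -1940346998035, -2013670653667, 654179784109, 2722726914325, 1468609836325,
    -950758022075, -1414207566635, -268049095605, 121626533675, 439672018675, 674657475075,
    -1374236355805, 396610059235, 2073244276675, -3198756741325, 558319620575, 3088923847631,
    -3334259843137, 633597959535, 1343309511335, -1312806433385, 575116657911, -138979918297,
    18410036280, -1224455120, 34915020, -321636, 472],
  [1, 8777, 2466637, 161627925, 3900774780, 43027280136, 245406083702, 760218055982, 1172601199850,
    241101036290, -2143017704966, -3148769437742, -601217252842, 2637597794750, 2587337651550,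
    120307172470, -1420999962260, -909785278860, 261597692500, -47100891300, 27573440310,
    1174431894070, -1294937948030, -776985137750, 2843305578950, -1736945135922, -1522968681194,
    2709682398686, -1026502084350, -649353849510, 836637257898, -378810664014, 88628052451,
    -10844509325, 635388495, -15077153, 105014, -86]⟩

/-- Coordinates of `(x δ^5)^5`. -/
def xCoord5 : Quint :=
  ⟨[0, 1, 21274, 11970402, 1544768647, 74409976305, 1671186558897, 19892097766458, 135679484225164,
    548205904722344, 1257778356657420, 1148551342232754, -1674584222598109, -5953115485185187,
    -5162520957309947, 3763861607617210, 11228212859289558, 6148086455996727, -5812993627362644,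
    -9565907161107804, -2613359599930690, 4116366061607346, 3833631017800114, 684288966568532,
    -1301530149050768, -1819508912702400, 1301530149050768, 684288966568532, -3833631017800114,
    4116366061607346, 2613359599930690, -9565907161107804, 5812993627362644, 6148086455996727,
    -11228212859289558, 3763861607617210, 5162520957309947, -5953115485185187, 1674584222598109,
    1148551342232754, -1257778356657420, 548205904722344, -135679484225164, 19892097766458,
    -1671186558897, 74409976305, -1544768647, 11970402, -21274, 1],
  [0, 15, 88875, 34795400, 3587852950, 145936267300, 2849048851180, 29981125570175, 182419778611725,
    657691305331800, 1322099170259700, 901555069339335, -2066647054743175, -5466578996847075,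
    -3593628722447475, 4059620237912850, 8481461276480820, 3337821936370850, -4632695749302950,
    -5825432083148100, -1088966377169400, 2539184071292140, 1990265644891100, -125838702495750,
    -90843153472250, -502455512981500, -1489984549978980, 2613690181393250, -90534712213050,
    -4914355955652650, 6039391469232150, 843378773542240, -8645613472931100, 7182315644571175,
    1596206162520275, -6768533256763900, 4351902190963530, 98921513730600, -1808531716219600,
    1261859666730575, -458579503020075, 99438622925260, -12906056884200, 954370821775, -36763291175,
    639379925, -3891355, 4550],
  [0, 130, 338260, 96369650, 8122497500, 285601644900, 5005306872635, 48796777797845,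
    283426299204600, 1008949606505500, 2119909944021850, 1984165084310870, -1666913970024460,
    -7068850960061450, -7047129765705125, 1525915178222175, 9817478825967840, 7618212288305580,
    -1716480375177200, -6651495124905500, -3692675265004200, 935278715195280, 2431967484114710,
    1077305246819250, -790895905190000, 238193729868000, 360860801995340, -2490907104958820,
    2106755820252200, 2482955968522500, -6157260181252050, 2549049822542430, 5280049701412960,
    -7147953950373950, 1076885820691500, 4318267185319050, -3697732041812340, 502614870452220,
    1035193514029775, -815373229520375, 298882131609400, -62670560518380, 7621987839690,
    -512186592850, 17323518500, -252623850, 1187415, -845],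
  [0, 845, 1187415, 252623850, 17323518500, 512186592850, 7621987839690, 62670560518380,
    298882131609400, 815373229520375, 1035193514029775, -502614870452220, -3697732041812340,
    -4318267185319050, 1076885820691500, 7147953950373950, 5280049701412960, -2549049822542430,
    -6157260181252050, -2482955968522500, 2106755820252200, 2490907104958820, 360860801995340,
    -238193729868000, -790895905190000, -1077305246819250, 2431967484114710, -935278715195280,
    -3692675265004200, 6651495124905500, -1716480375177200, -7618212288305580, 9817478825967840,
    -1525915178222175, -7047129765705125, 7068850960061450, -1666913970024460, -1984165084310870,
    2119909944021850, -1008949606505500, 283426299204600, -48796777797845, 5005306872635,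
    -285601644900, 8122497500, -96369650, 338260, -130],
  [0, 4550, 3891355, 639379925, 36763291175, 954370821775, 12906056884200, 99438622925260,
    458579503020075, 1261859666730575, 1808531716219600, 98921513730600, -4351902190963530,
    -6768533256763900, -1596206162520275, 7182315644571175, 8645613472931100, 843378773542240,
    -6039391469232150, -4914355955652650, 90534712213050, 2613690181393250, 1489984549978980,
    -502455512981500, 90843153472250, -125838702495750, -1990265644891100, 2539184071292140,
    1088966377169400, -5825432083148100, 4632695749302950, 3337821936370850, -8481461276480820,
    4059620237912850, 3593628722447475, -5466578996847075, 2066647054743175, 901555069339335,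
    -1322099170259700, 657691305331800, -182419778611725, 29981125570175, -2849048851180,
    145936267300, -3587852950, 34795400, -88875, 15]⟩

/-- Coordinates of `δ^2 (1 + k - k^2) pser`. -/
def pCoord : Quint :=
  ⟨[0, 5, 0, -10, 0, 5],
  [1, 0, 6, 4, -3],
  [1, 5, 1, -1, 2],
  [2, 1, 1, -5, 1],
  [3, 4, -6, 0, -1]⟩

/-- The coefficient of `x^0` in the modular equation of `x`. -/
def modCoeff0 : List ℤ :=
  [0, -1, -20, -150, -500, -625]

/-- The coefficient of `x^1` in the modular equation of `x`. -/
def modCoeff1 : List ℤ :=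
  [0, -15, -305, -2325, -7875, -10000]

/-- The coefficient of `x^2` in the modular equation of `x`. -/
def modCoeff2 : List ℤ :=
  [0, -85, -1750, -13525, -46500, -60000]

/-- The coefficient of `x^3` in the modular equation of `x`. -/
def modCoeff3 : List ℤ :=
  [0, -215, -4475, -35000, -122000, -160000]

/-- The coefficient of `x^4` in the modular equation of `x`. -/
def modCoeff4 : List ℤ :=
  [0, -205, -4300, -34000, -120000, -160000]

/-- The polynomial `U(x)` in `x`. -/
def uPoly1 : List ℤ :=
  [0, 41, 860, 6800, 24000, 32000]

/-- The polynomial `U(x^2)` in `x`. -/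
def uPoly2 : List ℤ :=
  [0, 86, 10195, 366600, 6534800, 68384000, 450720000, 1907200000, 5056000000, 7680000000,
    5120000000]

/-- The polynomial `U(x^3)` in `x`. -/
def uPoly3 : List ℤ :=
  [0, 51, 27495, 2836265, 128688900, 3343692000, 56283680000, 656205600000, 5502096000000,
    33821312000000, 153192960000000, 506956800000000, 1195008000000000, 1904640000000000,
    1843200000000000, 819200000000000]

/-- The polynomial `U(x^4)` in `x`. -/
def uPoly4 : List ℤ :=
  [0, 12, 32674, 8579260, 831492275, 42958434000, 1396773180000, 31314949600000, 511802288800000,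
    6319880448000000, 60349364480000000, 452174745600000000, 2679038592000000000,
    12574269440000000000, 46561935360000000000, 134544588800000000000, 297365504000000000000,
    485949440000000000000, 553779200000000000000, 393216000000000000000, 131072000000000000000]

/-- The polynomial `(1 + 5 x) U(x^0 pser)` in `x`. -/
def hPoly0 : List ℤ :=
  [0, 5, 40, 80]

/-- The polynomial `(1 + 5 x) U(x^1 pser)` in `x`. -/
def hPoly1 : List ℤ :=
  [0, 36, 2009, 40360, 415600, 2456000, 8480000, 16000000, 12800000]

/-- The polynomial `(1 + 5 x) U(x^2 pser)` in `x`. -/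
def hPoly2 : List ℤ :=
  [0, 33, 9317, 606565, 18553800, 333858000, 3918240000, 31610400000, 179590400000, 720960000000,
    2009600000000, 3712000000000, 4096000000000, 2048000000000]

/-- The polynomial `(1 + 5 x) U(x^3 pser)` in `x`. -/
def hPoly3 : List ℤ :=
  [0, 10, 15180, 2659560, 184615375, 7078112500, 174023340000, 2976547600000, 37187756000000,
    349729760000000, 2520440000000000, 14042092800000000, 60527513600000000, 200379392000000000,
    500746240000000000, 915046400000000000, 1155072000000000000, 901120000000000000,
    327680000000000000]

/-- The polynomial `(1 + 5 x) U(x^4 pser)` in `x`. -/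
def hPoly4 : List ℤ :=
  [0, 1, 12304, 5541850, 791543225, 56968107375, 2515864930000, 75783116100000, 1660174988800000,
    27579539260000000, 357417129280000000, 3684370155520000000, 30608105088000000000,
    206606231680000000000, 1137696015360000000000, 5111468288000000000000, 18664894464000000000000,
    54927695872000000000000, 128413696000000000000000, 233139404800000000000000,
    317063168000000000000000, 304087040000000000000000, 183500800000000000000000,
    52428800000000000000000]

theorem xCoord_mul_self : (xCoord.mul xCoord).eq xCoord2 = true := by decide +kernel
theorem xCoord_mul_xCoord2 : (xCoord.mul xCoord2).eq xCoord3 = true := by decide +kernel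
theorem xCoord_mul_xCoord3 : (xCoord.mul xCoord3).eq xCoord4 = true := by decide +kernel
theorem xCoord_mul_xCoord4 : (xCoord.mul xCoord4).eq xCoord5 = true := by decide +kernel

end FreeModule

end ElongatedDiamond

namespace ElongatedDiamond

open PowerSeries

/-! ### Verification of the coordinates, the modular equation, and the initial values of U. -/

section FreeModuleEvaluation

/-- Ramanujan's parameter at `q^5`. -/
def k5 : ℤ⟦X⟧ := E5 kser

/-- The Rogers-Ramanujan continued fraction `r(q^10)`. -/
def sigmaser : ℤ⟦X⟧ := expand 2 two_ne_zero rhoser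

/-- The element of `ℤ⟦X⟧` with the given coordinates. -/
def qev (u : Quint) : ℤ⟦X⟧ :=
  pev u.c0 k5 + pev u.c1 k5 * (rhoser * (1 + k5)) + pev u.c2 k5 * (sigmaser * (1 - k5)) +
    pev u.c3 k5 * (rhoser * sigmaser * (1 + k5)) + pev u.c4 k5 * (sigmaser ^ 2 * (1 - k5))

theorem sigmaser_eq : sigmaser = X ^ 2 * E5 (expand 2 two_ne_zero rr) := by
  rw [sigmaser, rhoser, map_mul, expand_X, E5_apply, ← expand_mul, ← expand_mul]

theorem k5_eq : rhoser * sigmaser ^ 2 = k5 := by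
  rw [sigmaser_eq, rhoser, k5, kser, map_mul, map_mul, map_pow, E5_apply X, expand_X]
  simp only [E5_apply]
  ring

theorem sigmaser_relation : sigmaser * (1 - k5) = rhoser ^ 2 * (1 + k5) := by
  have h := congrArg E5 rr_relation
  simp only [map_mul, map_sub, map_add, map_one, map_pow] at h
  rw [sigmaser_eq, rhoser, k5, ← E5_apply]
  linear_combination X ^ 2 * h

/-- The multiplication table follows from ρσ² = κ and σ(1 - κ) = ρ²(1 + κ). The factors 1 ± κ in the
basis make all structure constants polynomials in κ. -/
theorem qev_mul (u v : Quint) : qev (u.mul v) = qev u * qev v := by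
  have hk := k5_eq
  have hs := sigmaser_relation
  simp only [qev, Quint.mul, pev_padd, pev_pmul, pev_cons, pev_nil]
  push_cast
  generalize pev u.c0 k5 = u0
  generalize pev u.c1 k5 = u1
  generalize pev u.c2 k5 = u2
  generalize pev u.c3 k5 = u3
  generalize pev u.c4 k5 = u4
  generalize pev v.c0 k5 = v0
  generalize pev v.c1 k5 = v1
  generalize pev v.c2 k5 = v2
  generalize pev v.c3 k5 = v3
  generalize pev v.c4 k5 = v4
  generalize k5 = k at hk hs ⊢
  generalize rhoser = r at hk hs ⊢
  generalize sigmaser = s at hk hs ⊢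
  have r11 : (r * (1 + k)) * (r * (1 + k)) = (1 + k) * (s * (1 - k)) := by
    linear_combination (-(1 + k)) * hs
  have r13 : (r * (1 + k)) * (r * s * (1 + k)) = (1 + k) * (s ^ 2 * (1 - k)) := by
    linear_combination (-(s * (1 + k))) * hs
  have r14 : (r * (1 + k)) * (s ^ 2 * (1 - k)) = k * (1 - k ^ 2) := by
    linear_combination (1 - k ^ 2) * hk
  have r23 : (s * (1 - k)) * (r * s * (1 + k)) = k * (1 - k ^ 2) := by
    linear_combination (1 - k ^ 2) * hk
  have r24 : (s * (1 - k)) * (s ^ 2 * (1 - k)) = k * (1 - k) * (r * (1 + k)) := by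
    linear_combination (s ^ 2 * (1 - k)) * hs + ((1 - k) * r * (1 + k)) * hk
  have r33 : (r * s * (1 + k)) * (r * s * (1 + k)) = k * (1 + k) * (r * (1 + k)) := by
    linear_combination (r * (1 + k) ^ 2) * hk
  have r34 : (r * s * (1 + k)) * (s ^ 2 * (1 - k)) = k * (1 + k) * (s * (1 - k)) := by
    linear_combination (s * (1 + k) * (1 - k)) * hk
  have r44 : (s ^ 2 * (1 - k)) * (s ^ 2 * (1 - k)) = k * (1 - k) * (r * s * (1 + k)) := by
    linear_combination (s ^ 3 * (1 - k)) * hs + (r * s * (1 - k) * (1 + k)) * hk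
  linear_combination (-(u1 * v1)) * r11 - (u1 * v3 + u3 * v1) * r13 - (u1 * v4 + u4 * v1) * r14 -
    (u2 * v3 + u3 * v2) * r23 - (u2 * v4 + u4 * v2) * r24 - (u3 * v3) * r33 -
    (u3 * v4 + u4 * v3) * r34 - (u4 * v4) * r44

theorem qev_smul (w : List ℤ) (u : Quint) : qev (u.smul w) = pev w k5 * qev u := by
  simp only [qev, Quint.smul, pev_pmul]; ring

theorem qev_add (u v : Quint) : qev (u.add v) = qev u + qev v := by
  simp only [qev, Quint.add, pev_padd]; ring

theorem qev_eq {u v : Quint} (h : u.eq v = true) : qev u = qev v := by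
  simp only [Quint.eq, Bool.and_eq_true] at h
  obtain ⟨⟨⟨⟨h0, h1⟩, h2⟩, h3⟩, h4⟩ := h
  rw [qev, qev, pev_eq_of_peq _ h0, pev_eq_of_peq _ h1, pev_eq_of_peq _ h2, pev_eq_of_peq _ h3,
    pev_eq_of_peq _ h4]

theorem pev_k5 (l : List ℤ) : pev l k5 = E5 (pev l kser) :=
  (map_pev kser (E5 : ℤ⟦X⟧ →+* ℤ⟦X⟧) l).symm

theorem U_X_pow_mul_E5 {i : ℕ} (hi : ¬5 ∣ i) (g : ℤ⟦X⟧) : U (X ^ i * E5 g) = 0 := by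
  rw [mul_comm, U_E5_mul, U_X_pow hi, mul_zero]

/-- The i-th basis element is X^i times a series in X^5, for i = 0, ..., 4; only i = 0 survives U.
-/
theorem U_qev (u : Quint) : U (qev u) = pev u.c0 kser := by
  have h : qev u = E5 (pev u.c0 kser) + X ^ 1 * E5 (pev u.c1 kser * (rr * (1 + kser))) +
      X ^ 2 * E5 (pev u.c2 kser * (expand 2 two_ne_zero rr * (1 - kser))) +
      X ^ 3 * E5 (pev u.c3 kser * (rr * expand 2 two_ne_zero rr * (1 + kser))) +
      X ^ 4 * E5 (pev u.c4 kser * (expand 2 two_ne_zero rr ^ 2 * (1 - kser))) := by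
    simp only [qev, pev_k5]
    simp only [sigmaser_eq, rhoser, k5, map_mul, map_add, map_sub, map_one, map_pow, ← E5_apply]
    ring
  rw [h, map_add, map_add, map_add, map_add, U_E5, U_X_pow_mul_E5 (by norm_num),
    U_X_pow_mul_E5 (by norm_num), U_X_pow_mul_E5 (by norm_num), U_X_pow_mul_E5 (by norm_num)]
  ring

theorem constantCoeff_kser : constantCoeff kser = 0 := by simp [kser]

theorem constantCoeff_k5 : constantCoeff k5 = 0 := by
  rw [k5, E5_apply, constantCoeff_expand, constantCoeff_kser]

theorem kser_ne_zero : kser ≠ 0 := by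
  have h : rr ≠ 0 := ne_zero_of_constantCoeff (by simp [rr, constantCoeff_rrNum, constantCoeff_pinv])
  have h2 : expand 2 two_ne_zero rr ≠ 0 := fun h0 => h (expand_injective two_ne_zero (by rw [h0, map_zero]))
  exact mul_ne_zero (mul_ne_zero X_ne_zero h) (pow_ne_zero 2 h2)

theorem k5_ne_zero : k5 ≠ 0 := fun h =>
  kser_ne_zero (expand_injective (s := 5) (by norm_num) (by rw [← E5_apply, ← k5, h, map_zero]))

theorem pev_ne_zero {z : ℤ⟦X⟧} (hz : constantCoeff z = 0) (l : List ℤ) : pev (1 :: l) z ≠ 0 :=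
  ne_zero_of_constantCoeff (by simp [pev_cons, hz])

theorem pser_expand_relation : expand 2 two_ne_zero pser * (1 - sigmaser - sigmaser ^ 2) = sigmaser := by
  have h := congrArg (expand 2 two_ne_zero) pser_relation
  simp only [map_mul, map_sub, map_one, map_pow] at h
  exact h

/-- The coordinates are those of κ(1 - κ²)(1/ρ - 1 - ρ), where κ/ρ = σ². -/
theorem pser_mul_inverse :
    pser * qev ⟨[0, -1, 0, 1], [0, -1, 1], [], [], [1, 1]⟩ = k5 * (1 - k5 ^ 2) := by
  have hr : rhoser ≠ 0 := fun h => k5_ne_zero (by rw [← k5_eq, h, zero_mul])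
  refine mul_left_cancel₀ hr ?_
  simp only [qev, pev_cons, pev_nil]
  push_cast
  linear_combination (k5 * (1 - k5 ^ 2)) * pser_relation + pser * (1 - k5 ^ 2) * k5_eq

/-- Likewise for κ(1 - κ²)(1/σ - 1 - σ), where κ/σ = ρσ. -/
theorem pser_expand_mul_inverse :
    expand 2 two_ne_zero pser * qev ⟨[0, -1, 0, 1], [], [0, -1, -1], [1, -1], []⟩ =
      k5 * (1 - k5 ^ 2) := by
  have hr : sigmaser ≠ 0 := fun h => k5_ne_zero (by rw [← k5_eq, h]; ring)
  refine mul_left_cancel₀ hr ?_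
  simp only [qev, pev_cons, pev_nil]
  push_cast
  linear_combination (k5 * (1 - k5 ^ 2)) * pser_expand_relation +
    expand 2 two_ne_zero pser * (1 - k5 ^ 2) * k5_eq

/-- The list of coefficients of `δ = 1 - 4 k - k^2`. -/
def dl : List ℤ := [1, -4, -1]

/-- The list of coefficients of `ε = 1 + k - k^2`. -/
def el : List ℤ := [1, 1, -1]

/-- Powers of polynomials given by coefficient lists. -/
def lpow (l : List ℤ) : ℕ → List ℤ
  | 0 => [1]
  | n + 1 => pmul l (lpow l n)

theorem pev_lpow {R : Type*} [CommRing R] (l : List ℤ) (n : ℕ) (z : R) :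
    pev (lpow l n) z = pev l z ^ n := by
  induction n with
  | zero => simp [lpow, pev]
  | succ n ih => rw [lpow, pev_pmul, ih, pow_succ']

theorem pev_el : pev el k5 = 1 + k5 - k5 ^ 2 := by
  simp only [el, pev_cons, pev_nil]; push_cast; ring

/-- No inversion is carried out: the proposed coordinates of p are certified by one product with the
explicit multiple of 1/p. -/
theorem pCoord_mul_inverse : (pCoord.mul ⟨[0, -1, 0, 1], [0, -1, 1], [], [], [1, 1]⟩).eq
    ⟨pmul [0, 1, 0, -1] (pmul (lpow dl 2) el), [], [], [], []⟩ = true := by decide +kernel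

theorem one_sub_k5_sq_ne_zero : 1 - k5 ^ 2 ≠ 0 :=
  ne_zero_of_constantCoeff (by simp [constantCoeff_k5])

/-- The coordinates of `pser`. -/
theorem pser_coord : pev dl k5 ^ 2 * pev el k5 * pser = qev pCoord := by
  have h := qev_eq pCoord_mul_inverse
  rw [qev_mul] at h
  have h2 := pser_mul_inverse
  set P := qev ⟨[0, -1, 0, 1], [0, -1, 1], [], [], [1, 1]⟩
  have hP : P ≠ 0 := fun h0 => mul_ne_zero k5_ne_zero one_sub_k5_sq_ne_zero (by rw [← h2, h0, mul_zero])
  refine mul_right_cancel₀ hP ?_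
  rw [h, mul_assoc, h2]
  simp only [qev, pev_pmul, pev_lpow, pev_nil, pev_cons]
  push_cast
  ring

/-- The certificate for x = b(q^5) p³ / p(q²), with b = `bser`, again by multiplication with a
multiple of 1/p(q²). -/
theorem xCoord_relation : (((pCoord.mul pCoord).mul pCoord).mul
    ⟨[0, -1, 0, 1], [], [0, -1, -1], [1, -1], []⟩).eq
    (xCoord.smul (pmul (pmul [0, 1, 0, -1] [1, 0, -1]) (pmul dl (lpow el 2)))) = true := by
  decide +kernel

theorem euler_pinv (m : ℕ) (hm : 0 < m) : euler m * pinv (euler m) = 1 :=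
  mul_pinv (constantCoeff_eprod hm hm)

/-- The Hauptmodul `x(q^5)`. -/
def tser : ℤ⟦X⟧ := E5 xser

theorem E5_bser : E5 bser = euler 50 * euler 10 ^ 3 * (pinv (euler 25) ^ 3 * pinv (euler 5)) := by
  simp only [bser, E5_apply, map_mul, map_pow, expand_pinv (constantCoeff_eprod (m := 5) (j := 5)
    (by norm_num) (by norm_num)), expand_pinv (constantCoeff_eprod (m := 1) (j := 1)
    (by norm_num) (by norm_num)), euler]
  rw [expand_eprod (by norm_num) (by norm_num), expand_eprod (by norm_num) (by norm_num),
    expand_eprod (by norm_num) (by norm_num), expand_eprod (by norm_num) (by norm_num)]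

/-- A cancellation of eta quotients that brings x into the algebra: p, p(q²) and b(q^5) are already
known in terms of ρ, σ and κ. -/
theorem xser_mul_pser_expand : xser * expand 2 two_ne_zero pser = E5 bser * pser ^ 3 := by
  rw [E5_bser]
  simp only [xser, pser, map_mul, expand_X, expand_pinv (constantCoeff_eprod (m := 1) (j := 1)
    (by norm_num) (by norm_num)), euler]
  rw [expand_eprod (by norm_num) (by norm_num), expand_eprod (by norm_num) (by norm_num)]
  have h2 := euler_pinv 2 (by norm_num)
  have h25 := euler_pinv 25 (by norm_num)
  have h25' : euler 25 ^ 3 * pinv (euler 25) ^ 3 = 1 := by rw [← mul_pow, h25, one_pow]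
  simp only [euler] at h2 h25'
  linear_combination
    (X ^ 3 * eprod 10 10 ^ 3 * (pinv (eprod 1 1) ^ 3 * pinv (eprod 5 5)) * eprod 50 50) * h2 -
    (X ^ 3 * eprod 50 50 * eprod 10 10 ^ 3 * pinv (eprod 5 5) * pinv (eprod 1 1) ^ 3) * h25'

theorem E5_bser_relation : E5 bser * (1 - k5 ^ 2) = pev el k5 := by
  have h := congrArg E5 bser_relation
  rw [pev_el]
  simp only [map_mul, map_sub, map_add, map_one, map_pow] at h
  exact h

/-- The coordinates of `xser`. -/
theorem xser_coord : pev dl k5 ^ 5 * xser = qev xCoord := by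
  have h := qev_eq xCoord_relation
  rw [qev_mul, qev_mul, qev_mul, qev_smul, ← pser_coord] at h
  have h2 := pser_expand_mul_inverse
  set S := qev ⟨[0, -1, 0, 1], [], [0, -1, -1], [1, -1], []⟩
  simp only [pev_pmul, pev_lpow, pev_cons, pev_nil] at h
  push_cast at h
  have hd : pev dl k5 ≠ 0 := pev_ne_zero constantCoeff_k5 _
  have he : pev el k5 ≠ 0 := pev_ne_zero constantCoeff_k5 _
  have hk := k5_ne_zero
  have h1 := one_sub_k5_sq_ne_zero
  refine mul_left_cancel₀ (mul_ne_zero (mul_ne_zero (mul_ne_zero hk (pow_ne_zero 2 h1)) hd)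
    (pow_ne_zero 3 he)) ?_
  linear_combination pev el k5 * h - (xser * pev dl k5 ^ 6 * pev el k5 ^ 3 * (1 - k5 ^ 2)) * h2 +
    (S * (1 - k5 ^ 2) * pev dl k5 ^ 6 * pev el k5 ^ 3) * xser_mul_pser_expand +
    (S * pser ^ 3 * pev dl k5 ^ 6 * pev el k5 ^ 3) * E5_bser_relation

theorem xser_coord_two : pev dl k5 ^ 10 * xser ^ 2 = qev xCoord2 := by
  rw [← qev_eq xCoord_mul_self, qev_mul, ← xser_coord]; ring

theorem xser_coord_three : pev dl k5 ^ 15 * xser ^ 3 = qev xCoord3 := by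
  rw [← qev_eq xCoord_mul_xCoord2, qev_mul, ← xser_coord, ← xser_coord_two]; ring

theorem xser_coord_four : pev dl k5 ^ 20 * xser ^ 4 = qev xCoord4 := by
  rw [← qev_eq xCoord_mul_xCoord3, qev_mul, ← xser_coord, ← xser_coord_three]; ring

theorem xser_coord_five : pev dl k5 ^ 25 * xser ^ 5 = qev xCoord5 := by
  rw [← qev_eq xCoord_mul_xCoord4, qev_mul, ← xser_coord, ← xser_coord_four]; ring

theorem pev_dl_ne_zero {z : ℤ⟦X⟧} (hz : constantCoeff z = 0) : pev dl z ≠ 0 :=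
  pev_ne_zero hz _

theorem pev_dl_mul_xser : pev dl kser * xser = kser := by
  have h := xser_relation
  simp only [dl, pev_cons, pev_nil]
  push_cast
  linear_combination h

theorem pev_dl_mul_tser : pev dl k5 * tser = k5 := by
  have := congrArg E5 pev_dl_mul_xser
  rwa [map_mul, ← pev_k5] at this

theorem pev_phom_eq {l : List ℤ} {n : ℕ} (hl : l.length = n + 1) {z x : ℤ⟦X⟧}
    (hz : constantCoeff z = 0) (h : pev dl z * x = z) :
    pev l x * pev dl z ^ n = pev (phom dl l).1 z := by
  have h2 := (pev_phom z (l := l) h).2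
  rw [hl] at h2
  refine mul_left_cancel₀ (pev_dl_ne_zero hz) ?_
  rw [← h2]; ring

/-- The modular equation multiplied by δ(κ)^25: each x^j absorbs δ^(5j), each coefficient of degree
5 in t = κ/δ(κ) absorbs δ^5, and the missing powers are supplied by `lpow`. -/
theorem modular_equation_coord :
    (xCoord5.add (((xCoord4.smul (phom dl modCoeff4).1).add
      (xCoord3.smul (pmul (lpow dl 5) (phom dl modCoeff3).1))).add
      (((xCoord2.smul (pmul (lpow dl 10) (phom dl modCoeff2).1)).add
        (xCoord.smul (pmul (lpow dl 15) (phom dl modCoeff1).1))).add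
        ⟨pmul (lpow dl 20) (phom dl modCoeff0).1, [], [], [], []⟩))).eq ⟨[], [], [], [], []⟩ =
      true := by
  decide +kernel

/-- The modular equation of degree five of the Hauptmodul. -/
theorem modular_equation :
    xser ^ 5 + pev modCoeff4 tser * xser ^ 4 + pev modCoeff3 tser * xser ^ 3 +
      pev modCoeff2 tser * xser ^ 2 + pev modCoeff1 tser * xser + pev modCoeff0 tser = 0 := by
  have h := qev_eq modular_equation_coord
  simp only [qev_add, qev_smul, ← xser_coord, ← xser_coord_two, ← xser_coord_three,
    ← xser_coord_four, ← xser_coord_five, pev_pmul, pev_lpow] at h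
  have e (l : List ℤ) (hl : l.length = 5 + 1) :=
    pev_phom_eq hl constantCoeff_k5 pev_dl_mul_tser
  rw [← e modCoeff4 rfl, ← e modCoeff3 rfl, ← e modCoeff2 rfl, ← e modCoeff1 rfl] at h
  simp only [qev, pev_nil, pev_pmul, pev_lpow] at h
  rw [← e modCoeff0 rfl] at h
  have hd : pev dl k5 ≠ 0 := pev_ne_zero constantCoeff_k5 _
  refine mul_left_cancel₀ (pow_ne_zero 25 hd) ?_
  linear_combination h

/-- Since δ(κ)^n is a series in q^5, it leaves U as δ(k)^n. What remains is the first coordinate at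
k, and dividing by δ(k)^n turns it into a polynomial in x = k/δ(k). -/
theorem U_xser_pow_eq {l : List ℤ} {u : Quint} {n j : ℕ} (hl : l.length = n + 1)
    (hu : pev dl k5 ^ n * xser ^ j = qev u) (h : peq u.c0 (phom dl l).1 = true) :
    U (xser ^ j) = pev l xser := by
  have h1 := congrArg U hu
  rw [U_qev, pev_k5, ← map_pow, U_E5_mul, pev_eq_of_peq _ h,
    ← pev_phom_eq hl constantCoeff_kser pev_dl_mul_xser] at h1
  refine mul_left_cancel₀ (pow_ne_zero n (pev_dl_ne_zero constantCoeff_kser)) ?_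
  rw [h1]; ring

theorem U_xser : U (xser ^ 1) = pev uPoly1 xser :=
  U_xser_pow_eq (n := 5) rfl (by rw [pow_one, xser_coord]) (by decide +kernel)

theorem U_xser_two : U (xser ^ 2) = pev uPoly2 xser :=
  U_xser_pow_eq (n := 10) rfl xser_coord_two (by decide +kernel)

theorem U_xser_three : U (xser ^ 3) = pev uPoly3 xser :=
  U_xser_pow_eq (n := 15) rfl xser_coord_three (by decide +kernel)

theorem U_xser_four : U (xser ^ 4) = pev uPoly4 xser :=
  U_xser_pow_eq (n := 20) rfl xser_coord_four (by decide +kernel)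

/-- The series `1 + 5 x`. -/
def yser : ℤ⟦X⟧ := 1 + 5 * xser

theorem U_xser_pow_mul_pser_eq {l : List ℤ} {u : Quint} {n j : ℕ} (hl : l.length = n + 3 + 1)
    (hu : pev dl k5 ^ n * xser ^ j = qev u)
    (h : peq (u.mul pCoord).c0 (phom dl l).1 = true) :
    yser * U (xser ^ j * pser) = pev l xser := by
  have h1 := congrArg U (qev_mul u pCoord)
  rw [← pser_coord, ← hu, U_qev, pev_eq_of_peq _ h,
    ← pev_phom_eq hl constantCoeff_kser pev_dl_mul_xser, show pev dl k5 ^ n * xser ^ j *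
      (pev dl k5 ^ 2 * pev el k5 * pser) = E5 (pev dl kser ^ (n + 2) * pev el kser) *
      (xser ^ j * pser) by rw [map_mul, map_pow, ← pev_k5, ← pev_k5]; ring, U_E5_mul] at h1
  -- From δ x = k: 1 + k - k² = δ + 5k = δ(1 + 5x). This is where the denominator y comes from.
  have hy : pev el kser = yser * pev dl kser := by
    have := pev_dl_mul_xser
    simp only [el, dl, yser, pev_cons, pev_nil] at this ⊢
    push_cast at this ⊢
    linear_combination (-5) * this
  rw [hy] at h1
  refine mul_left_cancel₀ (pow_ne_zero (n + 3) (pev_dl_ne_zero constantCoeff_kser)) ?_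
  linear_combination -h1

theorem U_pser : yser * U (xser ^ 0 * pser) = pev hPoly0 xser :=
  U_xser_pow_mul_pser_eq (n := 0) (u := ⟨[1], [], [], [], []⟩) rfl
    (by simp [qev, pev]) (by decide +kernel)

theorem U_xser_mul_pser : yser * U (xser ^ 1 * pser) = pev hPoly1 xser :=
  U_xser_pow_mul_pser_eq (n := 5) rfl (by rw [pow_one, xser_coord]) (by decide +kernel)

theorem U_xser_two_mul_pser : yser * U (xser ^ 2 * pser) = pev hPoly2 xser :=
  U_xser_pow_mul_pser_eq (n := 10) rfl xser_coord_two (by decide +kernel)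

theorem U_xser_three_mul_pser : yser * U (xser ^ 3 * pser) = pev hPoly3 xser :=
  U_xser_pow_mul_pser_eq (n := 15) rfl xser_coord_three (by decide +kernel)

theorem U_xser_four_mul_pser : yser * U (xser ^ 4 * pser) = pev hPoly4 xser :=
  U_xser_pow_mul_pser_eq (n := 20) rfl xser_coord_four (by decide +kernel)

end FreeModuleEvaluation

end ElongatedDiamond

namespace ElongatedDiamond

open PowerSeries

/-! ### The multiplier A and the degree five recurrence. -/

section ShiftedHecke

/-- The generating function `D₅ = E(q²)^5 / E(q)^16`. -/
def dser : ℤ⟦X⟧ := euler 2 ^ 5 * pinv (euler 1) ^ 16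

/-- The inverse of `dser`. -/
def dinv : ℤ⟦X⟧ := euler 1 ^ 16 * pinv (euler 2) ^ 5

/-- The multiplier `q^6 D₅(q) / D₅(q^25)`. -/
def aser : ℤ⟦X⟧ := X ^ 6 * dser * E5 (E5 dinv)

theorem dser_mul_dinv : dser * dinv = 1 := by
  have h1 : euler 1 ^ 16 * pinv (euler 1) ^ 16 = 1 := by
    rw [← mul_pow, euler_pinv 1 one_pos, one_pow]
  have h2 : euler 2 ^ 5 * pinv (euler 2) ^ 5 = 1 := by
    rw [← mul_pow, euler_pinv 2 two_pos, one_pow]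
  rw [dser, dinv]
  linear_combination (euler 1 ^ 16 * pinv (euler 1) ^ 16) * h2 + h1

theorem E5_euler {m : ℕ} (hm : 0 < m) : E5 (euler m) = euler (5 * m) := by
  rw [E5_apply, euler, expand_eprod hm hm]

theorem E5_pinv_euler {m : ℕ} (hm : 0 < m) : E5 (pinv (euler m)) = pinv (euler (5 * m)) := by
  rw [E5_apply, expand_pinv (constantCoeff_eprod hm hm), ← E5_apply, E5_euler hm]

theorem E5_dinv : E5 dinv = euler 5 ^ 16 * pinv (euler 10) ^ 5 := by
  rw [dinv, map_mul, map_pow, map_pow, E5_euler one_pos, E5_pinv_euler two_pos,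
    mul_one, show 5 * 2 = 10 from rfl]

theorem E5_E5_dinv : E5 (E5 dinv) = euler 25 ^ 16 * pinv (euler 50) ^ 5 := by
  rw [E5_dinv, map_mul, map_pow, map_pow, E5_euler (by norm_num), E5_pinv_euler (by norm_num)]

/-- Up to b(q^5)^5, a series in q^5 which passes through U, the multiplier is x^5 p, and U(x^m p) is
known. -/
theorem aser_mul_E5_bser : aser * E5 bser ^ 5 = xser ^ 5 * pser := by
  have h1 : euler 25 ^ 15 * pinv (euler 25) ^ 15 = 1 := by
    rw [← mul_pow, euler_pinv 25 (by norm_num), one_pow]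
  have h2 : euler 50 ^ 5 * pinv (euler 50) ^ 5 = 1 := by
    rw [← mul_pow, euler_pinv 50 (by norm_num), one_pow]
  rw [aser, E5_E5_dinv, E5_bser, dser, xser, pser]
  generalize euler 25 = a at *
  generalize pinv a = a' at *
  generalize euler 50 = b at *
  generalize pinv b = b' at *
  generalize pinv (euler 1) = c
  generalize pinv (euler 5) = e
  linear_combination (X ^ 6 * euler 2 ^ 5 * c ^ 16 * a * euler 10 ^ 15 * e ^ 5) *
    (b ^ 5 * b' ^ 5 * h1 + h2)

/-- In terms of k, 1 + 4x = (1 - k²)/δ and 1 + 5x = (1 + k - k²)/δ, so `bser_relation` is the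
quotient of the two. -/
theorem one_add_four_xser_mul_bser : (1 + 4 * xser) * bser = yser := by
  have h1 := pev_dl_mul_xser
  have h2 := bser_relation
  have hd : pev dl kser = 1 - 4 * kser - kser ^ 2 := by
    simp only [dl, pev_cons, pev_nil]; push_cast; ring
  refine mul_left_cancel₀ (pev_dl_ne_zero constantCoeff_kser) ?_
  rw [hd] at h1 ⊢
  rw [yser]
  linear_combination (4 * bser - 5) * h1 + h2

theorem bser_pow_mul_U (f : ℤ⟦X⟧) : bser ^ 5 * U (aser * f) = U (xser ^ 5 * pser * f) := by
  have h : E5 bser ^ 5 * (aser * f) = xser ^ 5 * pser * f := by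
    linear_combination f * aser_mul_E5_bser
  rw [← U_E5_mul, map_pow, h]

theorem yser_pow_mul_U (f : ℤ⟦X⟧) :
    yser ^ 6 * U (aser * f) = (1 + 4 * xser) ^ 5 * (yser * U (f * xser ^ 5 * pser)) := by
  have h := bser_pow_mul_U f
  rw [show f * xser ^ 5 * pser = xser ^ 5 * pser * f by ring, ← h, ← one_add_four_xser_mul_bser]
  ring

/-- The recursion satisfied by `U (x^m g)` for fixed `g`. -/
theorem U_xser_pow_add_five (g : ℤ⟦X⟧) (m : ℕ) :
    U (xser ^ (m + 5) * g) = -(pev modCoeff4 xser * U (xser ^ (m + 4) * g) +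
      pev modCoeff3 xser * U (xser ^ (m + 3) * g) + pev modCoeff2 xser * U (xser ^ (m + 2) * g) +
      pev modCoeff1 xser * U (xser ^ (m + 1) * g) + pev modCoeff0 xser * U (xser ^ m * g)) := by
  have e (l : List ℤ) : pev l tser = E5 (pev l xser) :=
    (map_pev xser (E5 : ℤ⟦X⟧ →+* ℤ⟦X⟧) l).symm
  have h := modular_equation
  simp only [e] at h
  simp only [← U_E5_mul, ← map_add, ← map_neg]
  congr 1
  linear_combination (xser ^ m * g) * h

end ShiftedHecke

/-! ### Membership in ℤ[x] and the growth of the power of y. -/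

section Polynomiality

/-- The subring `ℤ[x]`. -/
def xring : Subalgebra ℤ ℤ⟦X⟧ := (Polynomial.aeval xser : Polynomial ℤ →ₐ[ℤ] ℤ⟦X⟧).range

theorem xser_mem_xring : xser ∈ xring := ⟨Polynomial.X, Polynomial.aeval_X _⟩

theorem pev_mem {S : Subalgebra ℤ ℤ⟦X⟧} {z : ℤ⟦X⟧} (hz : z ∈ S) (l : List ℤ) : pev l z ∈ S := by
  induction l with
  | nil => exact S.zero_mem
  | cons a l ih => exact S.add_mem (intCast_mem S a) (S.mul_mem hz ih)

theorem yser_mem_xring : yser ∈ xring :=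
  xring.add_mem xring.one_mem (xring.mul_mem (ofNat_mem xring 5) xser_mem_xring)

theorem mem_of_recursion {u : ℕ → ℤ⟦X⟧} (h0 : u 0 ∈ xring) (h1 : u 1 ∈ xring) (h2 : u 2 ∈ xring)
    (h3 : u 3 ∈ xring) (h4 : u 4 ∈ xring)
    (hr : ∀ m, u (m + 5) = -(pev modCoeff4 xser * u (m + 4) + pev modCoeff3 xser * u (m + 3) +
      pev modCoeff2 xser * u (m + 2) + pev modCoeff1 xser * u (m + 1) + pev modCoeff0 xser * u m))
    (m : ℕ) : u m ∈ xring := by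
  induction m using Nat.strong_induction_on with
  | _ m ih =>
    match m, ih with
    | 0, _ => exact h0
    | 1, _ => exact h1
    | 2, _ => exact h2
    | 3, _ => exact h3
    | 4, _ => exact h4
    | m + 5, ih =>
      have e (l : List ℤ) := pev_mem xser_mem_xring l
      rw [hr]
      refine xring.neg_mem (xring.add_mem (xring.add_mem (xring.add_mem (xring.add_mem ?_ ?_) ?_)
        ?_) ?_) <;> exact xring.mul_mem (e _) (ih _ (by omega))

theorem U_xser_pow_mem (m : ℕ) : U (xser ^ m) ∈ xring := by
  refine mem_of_recursion (u := fun m => U (xser ^ m)) ?_ ?_ ?_ ?_ ?_ (fun m => ?_) m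
  · simp only [pow_zero, U_one]; exact xring.one_mem
  · simp only [U_xser]; exact pev_mem xser_mem_xring _
  · simp only [U_xser_two]; exact pev_mem xser_mem_xring _
  · simp only [U_xser_three]; exact pev_mem xser_mem_xring _
  · simp only [U_xser_four]; exact pev_mem xser_mem_xring _
  · simpa only [mul_one] using U_xser_pow_add_five 1 m

theorem yser_mul_U_xser_pow_mul_pser_mem (m : ℕ) : yser * U (xser ^ m * pser) ∈ xring := by
  refine mem_of_recursion (u := fun m => yser * U (xser ^ m * pser)) ?_ ?_ ?_ ?_ ?_ (fun m => ?_) m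
  · simp only [U_pser]; exact pev_mem xser_mem_xring _
  · simp only [U_xser_mul_pser]; exact pev_mem xser_mem_xring _
  · simp only [U_xser_two_mul_pser]; exact pev_mem xser_mem_xring _
  · simp only [U_xser_three_mul_pser]; exact pev_mem xser_mem_xring _
  · simp only [U_xser_four_mul_pser]; exact pev_mem xser_mem_xring _
  · simp only [U_xser_pow_add_five pser m]; ring

theorem U_tser_mul (f : ℤ⟦X⟧) : U (tser * f) = xser * U f := U_E5_mul xser f

/-- `U` maps `ℤ[x, x(q^5)]` into `ℤ[x]`, and likewise for `f ↦ y U (f p)`. -/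
theorem U_mem_of_mem_adjoin {f : ℤ⟦X⟧} (hf : f ∈ Algebra.adjoin ℤ {xser, tser}) :
    U f ∈ xring ∧ yser * U (f * pser) ∈ xring := by
  -- Strengthened so that induction handles products: multiplication by f preserves the set of all g
  -- having the property for every power of x. The original claim is g = 1, m = 0.
  suffices h : ∀ g : ℤ⟦X⟧, (∀ m, U (xser ^ m * g) ∈ xring ∧ yser * U (xser ^ m * g * pser) ∈ xring) →
      ∀ m, U (xser ^ m * (f * g)) ∈ xring ∧ yser * U (xser ^ m * (f * g) * pser) ∈ xring by
    have := h 1 (fun m => by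
      rw [mul_one]; exact ⟨U_xser_pow_mem m, yser_mul_U_xser_pow_mul_pser_mem m⟩) 0
    simpa using this
  induction hf using Algebra.adjoin_induction with
  | mem z hz =>
    intro g hg m
    rcases hz with rfl | rfl
    · rw [← mul_assoc, ← pow_succ]; exact hg (m + 1)
    · rw [show xser ^ m * (tser * g) = tser * (xser ^ m * g) by ring, mul_assoc, U_tser_mul,
        U_tser_mul, mul_left_comm]
      exact ⟨xring.mul_mem xser_mem_xring (hg m).1, xring.mul_mem xser_mem_xring (hg m).2⟩
  | algebraMap r =>
    intro g hg m
    rw [show xser ^ m * (algebraMap ℤ ℤ⟦X⟧ r * g) = r • (xser ^ m * g) by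
      rw [eq_intCast, zsmul_eq_mul]; ring, show r • (xser ^ m * g) * pser =
      r • (xser ^ m * g * pser) by rw [zsmul_eq_mul, zsmul_eq_mul, mul_assoc], map_zsmul, map_zsmul,
      show yser * r • U (xser ^ m * g * pser) = r • (yser * U (xser ^ m * g * pser)) by
        rw [zsmul_eq_mul, zsmul_eq_mul, mul_left_comm]]
    exact ⟨zsmul_mem (hg m).1 r, zsmul_mem (hg m).2 r⟩
  | add a b _ _ ha hb =>
    intro g hg m
    rw [add_mul, mul_add, add_mul, map_add, map_add, mul_add]
    exact ⟨xring.add_mem (ha g hg m).1 (hb g hg m).1, xring.add_mem (ha g hg m).2 (hb g hg m).2⟩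
  | mul a b _ _ ha hb =>
    intro g hg m
    rw [mul_assoc]
    exact ha _ (hb g hg) m

/-- The cofactor of `y` in `y(q^5)^5`. -/
def ycof : ℤ⟦X⟧ :=
  (yser ^ 4 - 5 * yser ^ 3 + 10 * yser ^ 2 - 10 * yser + 5) +
    5 * pev modCoeff4 tser * (yser ^ 3 - 4 * yser ^ 2 + 6 * yser - 4) +
    25 * pev modCoeff3 tser * (yser ^ 2 - 3 * yser + 3) +
    125 * pev modCoeff2 tser * (yser - 2) + 625 * pev modCoeff1 tser

/-- Substitute x = (y - 1)/5 in 5^5 times the modular equation. The term free of y is -(1 + 5t)^5,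
and `ycof` is the rest divided by y. -/
theorem yser_mul_ycof : yser * ycof = E5 yser ^ 5 := by
  have hy : E5 yser = 1 + 5 * tser := by rw [yser, map_add, map_one, map_mul, map_ofNat, tser]
  have h := modular_equation
  rw [hy, ycof]
  have hx : (5 : ℤ⟦X⟧) * xser = yser - 1 := by rw [yser]; ring
  generalize yser = y at *
  have e1 : pev modCoeff4 tser = -205 * tser - 4300 * tser ^ 2 - 34000 * tser ^ 3 -
      120000 * tser ^ 4 - 160000 * tser ^ 5 := by
    simp only [modCoeff4, pev_cons, pev_nil]; push_cast; ring
  have e2 : pev modCoeff3 tser = -215 * tser - 4475 * tser ^ 2 - 35000 * tser ^ 3 -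
      122000 * tser ^ 4 - 160000 * tser ^ 5 := by
    simp only [modCoeff3, pev_cons, pev_nil]; push_cast; ring
  have e3 : pev modCoeff2 tser = -85 * tser - 1750 * tser ^ 2 - 13525 * tser ^ 3 -
      46500 * tser ^ 4 - 60000 * tser ^ 5 := by
    simp only [modCoeff2, pev_cons, pev_nil]; push_cast; ring
  have e4 : pev modCoeff1 tser = -15 * tser - 305 * tser ^ 2 - 2325 * tser ^ 3 -
      7875 * tser ^ 4 - 10000 * tser ^ 5 := by
    simp only [modCoeff1, pev_cons, pev_nil]; push_cast; ring
  have e5 : pev modCoeff0 tser = -1 * tser - 20 * tser ^ 2 - 150 * tser ^ 3 -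
      500 * tser ^ 4 - 625 * tser ^ 5 := by
    simp only [modCoeff0, pev_cons, pev_nil]; push_cast; ring
  have h' : (5 * xser) ^ 5 + 5 * pev modCoeff4 tser * (5 * xser) ^ 4 +
      25 * pev modCoeff3 tser * (5 * xser) ^ 3 + 125 * pev modCoeff2 tser * (5 * xser) ^ 2 +
      625 * pev modCoeff1 tser * (5 * xser) + 3125 * pev modCoeff0 tser = 0 := by
    linear_combination 3125 * h
  rw [hx] at h'
  rw [e1, e2, e3, e4, e5] at h'
  rw [e1, e2, e3, e4]
  linear_combination h'

theorem xser_mem_adjoin : xser ∈ Algebra.adjoin ℤ {xser, tser} :=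
  Algebra.subset_adjoin (by simp)

theorem tser_mem_adjoin : tser ∈ Algebra.adjoin ℤ {xser, tser} :=
  Algebra.subset_adjoin (by simp)

theorem xring_le_adjoin : xring ≤ Algebra.adjoin ℤ {xser, tser} := by
  rintro _ ⟨g, rfl⟩
  exact Polynomial.aeval_mem_adjoin_singleton ℤ xser |> fun h =>
    Algebra.adjoin_mono (by simp) h

theorem ycof_mem_adjoin : ycof ∈ Algebra.adjoin ℤ {xser, tser} := by
  set S := Algebra.adjoin ℤ {xser, tser}
  have hy : yser ∈ S := xring_le_adjoin yser_mem_xring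
  have ha (l : List ℤ) : pev l tser ∈ S := pev_mem tser_mem_adjoin l
  have hn (n : ℕ) [n.AtLeastTwo] : (OfNat.ofNat n : ℤ⟦X⟧) ∈ S := ofNat_mem S n
  have h1 := S.sub_mem (S.add_mem (S.sub_mem (S.pow_mem hy 4) (S.mul_mem (hn 5) (S.pow_mem hy 3)))
    (S.mul_mem (hn 10) (S.pow_mem hy 2))) (S.mul_mem (hn 10) hy)
  have h2 := S.sub_mem (S.add_mem (S.sub_mem (S.pow_mem hy 3) (S.mul_mem (hn 4) (S.pow_mem hy 2)))
    (S.mul_mem (hn 6) hy)) (hn 4)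
  have h3 := S.add_mem (S.sub_mem (S.pow_mem hy 2) (S.mul_mem (hn 3) hy)) (hn 3)
  exact S.add_mem (S.add_mem (S.add_mem (S.add_mem (S.add_mem h1 (hn 5))
    (S.mul_mem (S.mul_mem (hn 5) (ha _)) h2)) (S.mul_mem (S.mul_mem (hn 25) (ha _)) h3))
    (S.mul_mem (S.mul_mem (hn 125) (ha _)) (S.sub_mem hy (hn 2)))) (S.mul_mem (hn 625) (ha _))

theorem E5_yser_pow_mul_mem {f : ℤ⟦X⟧} {n : ℕ} (hf : yser ^ n * f ∈ xring) :
    E5 yser ^ (5 * n) * f ∈ Algebra.adjoin ℤ {xser, tser} := by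
  rw [pow_mul, ← yser_mul_ycof, mul_pow, mul_right_comm]
  exact mul_mem (xring_le_adjoin hf) (pow_mem ycof_mem_adjoin n)

/-- Moved inside U, y^(5n) becomes y(q^5)^(5n) = y^n ycof^n; here y^n clears the denominator of f
and ycof^n stays in ℤ[x, t]. -/
theorem yser_pow_mul_U_mem {f : ℤ⟦X⟧} {n : ℕ} (hf : yser ^ n * f ∈ xring) :
    yser ^ (5 * n) * U f ∈ xring := by
  rw [← U_E5_mul, map_pow]
  exact (U_mem_of_mem_adjoin (E5_yser_pow_mul_mem hf)).1

/-- The six further powers of y are five from b^5 = y^5/(1 + 4x)^5 and one from y U(x^m p). -/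
theorem yser_pow_mul_U_aser_mem {f : ℤ⟦X⟧} {n : ℕ} (hf : yser ^ n * f ∈ xring) :
    yser ^ (5 * n + 6) * U (aser * f) ∈ xring := by
  have h : E5 yser ^ (5 * n) * f * xser ^ 5 ∈ Algebra.adjoin ℤ {xser, tser} :=
    mul_mem (E5_yser_pow_mul_mem hf) (pow_mem xser_mem_adjoin 5)
  have h2 := (U_mem_of_mem_adjoin h).2
  rw [pow_add, mul_assoc, yser_pow_mul_U, show yser ^ (5 * n) * ((1 + 4 * xser) ^ 5 *
    (yser * U (f * xser ^ 5 * pser))) = (1 + 4 * xser) ^ 5 *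
    (yser * (yser ^ (5 * n) * U (f * xser ^ 5 * pser))) by ring, ← U_E5_mul, map_pow]
  refine xring.mul_mem (xring.pow_mem (xring.add_mem xring.one_mem
    (xring.mul_mem (ofNat_mem xring 4) xser_mem_xring)) 5) ?_
  convert h2 using 3
  ring

end Polynomiality

end ElongatedDiamond

namespace ElongatedDiamond

open PowerSeries

/-! ### The weight filtration and its behaviour under U. -/

section Weights

/-- The filtration on polynomials in which `x` has weight `5` and `5` has weight `-10`. -/
def Wt (c : ℕ) (g : Polynomial ℤ) : Prop := ∀ m, (5 : ℤ) ^ ((5 * m - c + 9) / 10) ∣ g.coeff m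

theorem Wt.mono {c c' : ℕ} (h : c ≤ c') {g : Polynomial ℤ} (hg : Wt c g) : Wt c' g :=
  fun m => (pow_dvd_pow 5 (by omega)).trans (hg m)

theorem Wt.add {c : ℕ} {g h : Polynomial ℤ} (hg : Wt c g) (hh : Wt c h) : Wt c (g + h) := by
  intro m
  rw [Polynomial.coeff_add]
  exact dvd_add (hg m) (hh m)

theorem Wt.neg {c : ℕ} {g : Polynomial ℤ} (hg : Wt c g) : Wt c (-g) := by
  intro m
  rw [Polynomial.coeff_neg, dvd_neg]
  exact hg m

/-- The exponent is ⌈(5m - c)/10⌉ truncated at 0, which is subadditive in (m, c). -/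
theorem Wt.mul {c c' : ℕ} {g h : Polynomial ℤ} (hg : Wt c g) (hh : Wt c' h) :
    Wt (c + c') (g * h) := by
  intro m
  rw [Polynomial.coeff_mul]
  refine Finset.dvd_sum fun p hp => ?_
  rw [Finset.HasAntidiagonal.mem_antidiagonal] at hp
  refine (pow_dvd_pow 5 ?_).trans (pow_add (5 : ℤ) _ _ ▸ mul_dvd_mul (hg p.1) (hh p.2))
  omega

theorem Wt.one : Wt 0 1 := by
  intro m
  rw [Polynomial.coeff_one]
  split_ifs with h
  · subst h; simp
  · exact dvd_zero _

theorem Wt.pow {c : ℕ} {g : Polynomial ℤ} (hg : Wt c g) (n : ℕ) : Wt (n * c) (g ^ n) := by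
  induction n with
  | zero => simpa using Wt.one
  | succ n ih => rw [pow_succ, Nat.succ_mul]; exact ih.mul hg

theorem Wt.sum {ι : Type*} {c : ℕ} {s : Finset ι} {g : ι → Polynomial ℤ}
    (h : ∀ i ∈ s, Wt c (g i)) : Wt c (∑ i ∈ s, g i) := by
  intro m
  rw [Polynomial.finsetSum_coeff]
  exact Finset.dvd_sum fun i hi => h i hi m

/-- Multiplying by a constant divisible by `5^v` lowers the weight by `10 v`. -/
theorem Wt.intCast_mul {c c' v : ℕ} (hc : c ≤ c' + 10 * v) {a : ℤ} (ha : 5 ^ v ∣ a)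
    {g : Polynomial ℤ} (hg : Wt c g) : Wt c' ((a : Polynomial ℤ) * g) := by
  intro m
  rw [Polynomial.coeff_intCast_mul]
  refine (pow_dvd_pow 5 ?_).trans (pow_add (5 : ℤ) _ _ ▸ mul_dvd_mul ha (hg m))
  omega

/-- Decides the weight of a polynomial given by a coefficient list that starts at index `i`. -/
def wtList (c : ℕ) : ℕ → List ℤ → Bool
  | _, [] => true
  | i, a :: l => decide (a % 5 ^ ((5 * i - c + 9) / 10) = 0) && wtList c (i + 1) l

theorem wt_pev_aux {c i : ℕ} {l : List ℤ} (h : wtList c i l = true) (m : ℕ) :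
    (5 : ℤ) ^ ((5 * (i + m) - c + 9) / 10) ∣ (pev l (Polynomial.X : Polynomial ℤ)).coeff m := by
  induction l generalizing i m with
  | nil => simp [pev]
  | cons a l ih =>
    simp only [wtList, Bool.and_eq_true, decide_eq_true_eq] at h
    rw [pev_cons, Polynomial.coeff_add, ← Polynomial.C_eq_intCast, Polynomial.coeff_C]
    cases m with
    | zero => simpa using Int.dvd_of_emod_eq_zero h.1
    | succ m =>
      have := ih h.2 m
      rw [show i + 1 + m = i + (m + 1) by ring] at this
      simpa using this

theorem wt_pev {c : ℕ} {l : List ℤ} (h : wtList c 0 l = true) :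
    Wt c (pev l (Polynomial.X : Polynomial ℤ)) := by
  intro m
  simpa using wt_pev_aux h m

/-- Evaluation of polynomials at `x`. -/
def xev : Polynomial ℤ →ₐ[ℤ] ℤ⟦X⟧ := Polynomial.aeval xser

theorem xev_X : xev Polynomial.X = xser := Polynomial.aeval_X _

theorem xev_pev (l : List ℤ) : xev (pev l Polynomial.X) = pev l xser := by
  rw [← xev_X]; exact map_pev _ (xev : Polynomial ℤ →+* ℤ⟦X⟧) l

theorem map_xev (V : ℤ⟦X⟧ →+ ℤ⟦X⟧) (g : Polynomial ℤ) :
    V (xev g) = ∑ m ∈ Finset.range (g.natDegree + 1), (g.coeff m : ℤ⟦X⟧) * V (xser ^ m) := by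
  conv_lhs => rw [g.as_sum_range_C_mul_X_pow]
  rw [map_sum, map_sum]
  refine Finset.sum_congr rfl fun m _ => ?_
  rw [map_mul, map_pow, xev_X, xev, Polynomial.aeval_C, eq_intCast, ← zsmul_eq_mul, map_zsmul,
    zsmul_eq_mul]

/-- In the modular equation the coefficient of x^i has weight 5 - i, so the recurrence raises the
weight by one for each step in m. -/
theorem wt_of_recursion {c : ℕ} {u : ℕ → ℤ⟦X⟧}
    (h : ∀ i < 5, ∃ g, Wt (i + c) g ∧ xev g = u i)
    (hr : ∀ m, u (m + 5) = -(pev modCoeff4 xser * u (m + 4) + pev modCoeff3 xser * u (m + 3) +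
      pev modCoeff2 xser * u (m + 2) + pev modCoeff1 xser * u (m + 1) + pev modCoeff0 xser * u m))
    (m : ℕ) : ∃ g, Wt (m + c) g ∧ xev g = u m := by
  induction m using Nat.strong_induction_on with
  | _ m ih =>
    rcases lt_or_ge m 5 with hm | hm
    · exact h m hm
    · obtain ⟨m, rfl⟩ := Nat.exists_eq_add_of_le' hm
      obtain ⟨g0, w0, e0⟩ := ih m (by omega)
      obtain ⟨g1, w1, e1⟩ := ih (m + 1) (by omega)
      obtain ⟨g2, w2, e2⟩ := ih (m + 2) (by omega)
      obtain ⟨g3, w3, e3⟩ := ih (m + 3) (by omega)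
      obtain ⟨g4, w4, e4⟩ := ih (m + 4) (by omega)
      have a0 := (wt_pev (c := 5) (l := modCoeff0) (by decide)).mul w0
      have a1 := (wt_pev (c := 4) (l := modCoeff1) (by decide)).mul w1
      have a2 := (wt_pev (c := 3) (l := modCoeff2) (by decide)).mul w2
      have a3 := (wt_pev (c := 2) (l := modCoeff3) (by decide)).mul w3
      have a4 := (wt_pev (c := 1) (l := modCoeff4) (by decide)).mul w4
      refine ⟨_, ((((a4.mono ?_).add (a3.mono ?_)).add (a2.mono ?_)).add (a1.mono ?_)).add
        (a0.mono ?_) |>.neg, ?_⟩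
      any_goals omega
      simp only [map_neg, map_add, map_mul, xev_pev, e0, e1, e2, e3, e4, hr]

theorem exists_wt_U_xser_pow (m : ℕ) : ∃ g, Wt (m + 6) g ∧ xev g = U (xser ^ m) := by
  refine wt_of_recursion (u := fun m => U (xser ^ m)) (fun i hi => ?_) (fun m => ?_) m
  · interval_cases i
    · exact ⟨1, Wt.one.mono (by omega), by simp [U_one]⟩
    · exact ⟨_, wt_pev (l := uPoly1) (by decide), by rw [xev_pev, U_xser]⟩
    · exact ⟨_, wt_pev (l := uPoly2) (by decide), by rw [xev_pev, U_xser_two]⟩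
    · exact ⟨_, wt_pev (l := uPoly3) (by decide), by rw [xev_pev, U_xser_three]⟩
    · exact ⟨_, wt_pev (l := uPoly4) (by decide), by rw [xev_pev, U_xser_four]⟩
  · simpa only [mul_one] using U_xser_pow_add_five 1 m

theorem exists_wt_U_xser_pow_mul_pser (m : ℕ) :
    ∃ g, Wt (m + 9) g ∧ xev g = yser * U (xser ^ m * pser) := by
  refine wt_of_recursion (u := fun m => yser * U (xser ^ m * pser)) (fun i hi => ?_)
    (fun m => ?_) m
  · interval_cases i
    · exact ⟨_, wt_pev (l := hPoly0) (by decide), by rw [xev_pev, U_pser]⟩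
    · exact ⟨_, wt_pev (l := hPoly1) (by decide), by rw [xev_pev, U_xser_mul_pser]⟩
    · exact ⟨_, wt_pev (l := hPoly2) (by decide), by rw [xev_pev, U_xser_two_mul_pser]⟩
    · exact ⟨_, wt_pev (l := hPoly3) (by decide), by rw [xev_pev, U_xser_three_mul_pser]⟩
    · exact ⟨_, wt_pev (l := hPoly4) (by decide), by rw [xev_pev, U_xser_four_mul_pser]⟩
  · simp only [U_xser_pow_add_five pser m]; ring

end Weights

/-! ### The 5-adic completion of the filtration. -/

section Completion

/-- Series that are `5`-adic limits of polynomials in `x` of weight at most `c`. -/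
def Lam (c : ℕ) (f : ℤ⟦X⟧) : Prop := ∀ M : ℕ, ∃ g h, Wt c g ∧ f = xev g + 5 ^ M * h

theorem Lam.mono {c c' : ℕ} (h : c ≤ c') {f : ℤ⟦X⟧} (hf : Lam c f) : Lam c' f := by
  intro M
  obtain ⟨g, h', hg, e⟩ := hf M
  exact ⟨g, h', hg.mono h, e⟩

theorem Lam.of_wt {c : ℕ} {g : Polynomial ℤ} (hg : Wt c g) : Lam c (xev g) :=
  fun _ => ⟨g, 0, hg, by simp⟩

theorem Lam.one : Lam 0 1 := by simpa using Lam.of_wt Wt.one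

theorem Lam.mul {c c' : ℕ} {f f' : ℤ⟦X⟧} (hf : Lam c f) (hf' : Lam c' f') :
    Lam (c + c') (f * f') := by
  intro M
  obtain ⟨g, h, hg, e⟩ := hf M
  obtain ⟨g', h', hg', e'⟩ := hf' M
  refine ⟨g * g', h * xev g' + xev g * h' + 5 ^ M * h * h', hg.mul hg', ?_⟩
  rw [e, e', map_mul]; ring

theorem Lam.pow {f : ℤ⟦X⟧} (hf : Lam 0 f) (n : ℕ) : Lam 0 (f ^ n) := by
  induction n with
  | zero => rw [pow_zero]; exact Lam.one
  | succ n ih => rw [pow_succ]; exact ih.mul hf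

theorem map_five_pow_mul (V : ℤ⟦X⟧ →+ ℤ⟦X⟧) (M : ℕ) (h : ℤ⟦X⟧) :
    V (5 ^ M * h) = 5 ^ M * V h := by
  have e (k : ℤ⟦X⟧) : (5 : ℤ⟦X⟧) ^ M * k = (5 ^ M : ℕ) • k := by
    rw [nsmul_eq_mul]; push_cast; ring
  rw [e, e, map_nsmul]

/-- An additive map that sends `x^m` to a series of weight `m + w`, maps weight `c` to weight
`c / 5 + w`. -/
theorem Lam.map {V : ℤ⟦X⟧ →+ ℤ⟦X⟧} {w : ℕ} (hV : ∀ m, ∃ g, Wt (m + w) g ∧ xev g = V (xser ^ m))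
    {c : ℕ} {f : ℤ⟦X⟧} (hf : Lam c f) : Lam (c / 5 + w) (V f) := by
  choose p hp hpV using hV
  intro M
  obtain ⟨g, h, hg, e⟩ := hf M
  refine ⟨∑ m ∈ Finset.range (g.natDegree + 1), (g.coeff m : Polynomial ℤ) * p m, V h,
    Wt.sum fun m _ => Wt.intCast_mul ?_ (hg m) (hp m), ?_⟩
  -- If x^m lies beyond weight c, so that 5m > c, its coefficient carries 5^v with 10v ≥ 5m - c ≥ m
  -- - ⌊c/5⌋; this compensates the weight m + w of its image.
  · omega
  · rw [e, map_add, map_five_pow_mul, map_sum, map_xev]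
    congr 1
    refine Finset.sum_congr rfl fun m _ => ?_
    rw [map_mul, map_intCast, hpV]

theorem Lam.U {c : ℕ} {f : ℤ⟦X⟧} (hf : Lam c f) : Lam (c / 5 + 6) (U f) :=
  hf.map exists_wt_U_xser_pow

/-- The inverse of `y`. -/
def yinv : ℤ⟦X⟧ := pinv yser

theorem constantCoeff_xser : constantCoeff xser = 0 := by simp [xser]

theorem yser_mul_yinv : yser * yinv = 1 :=
  mul_pinv (by simp [yser, constantCoeff_xser])

/-- In 1/y = Σ (-5x)^n the n-th term has weight at most 5n - 10n ≤ 0. Truncation at M leaves a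
multiple of 5^M, which is why limits are allowed. -/
theorem lam_yinv : Lam 0 yinv := by
  intro M
  refine ⟨∑ n ∈ Finset.range M, (((-5) ^ n : ℤ) : Polynomial ℤ) * Polynomial.X ^ n, yinv * (-xser) ^ M,
    Wt.sum fun n _ => ?_, ?_⟩
  · have hX : Wt 5 (Polynomial.X : Polynomial ℤ) := by
      intro m
      rw [Polynomial.coeff_X]
      split_ifs with h
      · subst h; simp
      · exact dvd_zero _
    refine Wt.intCast_mul (v := n) ?_ ?_ (hX.pow n)
    · omega
    · rw [neg_pow]; exact Dvd.intro_left _ rfl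
  · have h := mul_neg_geom_sum (-5 * xser) M
    have h2 := yser_mul_yinv
    have e : xev (∑ n ∈ Finset.range M, (((-5) ^ n : ℤ) : Polynomial ℤ) * Polynomial.X ^ n) =
        ∑ n ∈ Finset.range M, (-5 * xser) ^ n := by
      rw [map_sum]
      refine Finset.sum_congr rfl fun n _ => ?_
      rw [map_mul, map_pow, xev_X, map_intCast, mul_pow]; push_cast; ring
    rw [e]
    rw [show (1 : ℤ⟦X⟧) - -5 * xser = yser by rw [yser]; ring] at h
    have h3 : (-5 * xser) ^ M = 5 ^ M * (-xser) ^ M := by rw [← mul_pow]; congr 1; ring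
    rw [h3] at h
    linear_combination (-yinv) * h + (∑ n ∈ Finset.range M, (-5 * xser) ^ n) * h2

theorem wt_one_add_four_X : Wt 5 (1 + 4 * Polynomial.X : Polynomial ℤ) := by
  have : (1 + 4 * Polynomial.X : Polynomial ℤ) = pev [1, 4] Polynomial.X := by
    simp [pev]; ring
  rw [this]; exact wt_pev (by decide)

theorem xev_one_add_four_X : xev (1 + 4 * Polynomial.X) = 1 + 4 * xser := by
  rw [map_add, map_one, map_mul, xev_X, map_ofNat]

/-- The map `f ↦ U (A f)`. -/
def UA : ℤ⟦X⟧ →+ ℤ⟦X⟧ := U.comp (AddMonoidHom.mulLeft aser)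

theorem UA_apply (f : ℤ⟦X⟧) : UA f = U (aser * f) := rfl

theorem UA_eq (f : ℤ⟦X⟧) :
    UA f = yinv ^ 6 * ((1 + 4 * xser) ^ 5 * (yser * U (f * xser ^ 5 * pser))) := by
  have h1 : yinv ^ 6 * yser ^ 6 = 1 := by rw [← mul_pow, mul_comm, yser_mul_yinv, one_pow]
  rw [UA_apply, ← yser_pow_mul_U, ← mul_assoc, h1, one_mul]

/-- The map `f ↦ y U (f x^5 p)`. -/
def UP : ℤ⟦X⟧ →+ ℤ⟦X⟧ :=
  (AddMonoidHom.mulLeft yser).comp (U.comp (AddMonoidHom.mulRight (xser ^ 5 * pser)))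

theorem UP_apply (f : ℤ⟦X⟧) : UP f = yser * U (f * xser ^ 5 * pser) := by
  rw [mul_assoc f]; rfl

theorem Lam.UP {c : ℕ} {f : ℤ⟦X⟧} (hf : Lam c f) : Lam (c / 5 + 14) (UP f) := by
  refine hf.map fun m => ?_
  obtain ⟨g, hg, e⟩ := exists_wt_U_xser_pow_mul_pser (m + 5)
  exact ⟨g, hg, by rw [e, UP_apply, ← pow_add]⟩

/-- The 25 is the weight of (1 + 4x)^5; the factor y⁻⁶ costs nothing. -/
theorem lam_of_UP {c : ℕ} {f : ℤ⟦X⟧} (hf : Lam c (UP f)) : Lam (c + 25) (UA f) := by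
  rw [UA_eq, ← UP_apply, ← mul_assoc]
  have h := ((lam_yinv.pow 6).mul (Lam.of_wt (wt_one_add_four_X.pow 5))).mul hf
  rw [map_pow, xev_one_add_four_X] at h
  exact h.mono (by omega)

theorem Lam.UA {c : ℕ} {f : ℤ⟦X⟧} (hf : Lam c f) : Lam (c / 5 + 39) (UA f) :=
  (lam_of_UP hf.UP).mono (by omega)

end Completion

/-! ### Divisibility of a series in x versus divisibility of its polynomial. -/

section Divisibility

theorem dvd_of_dvd_xser_mul {N : ℤ} (hN : N ≠ 0) {w : ℤ⟦X⟧} (h : (N : ℤ⟦X⟧) ∣ xser * w) :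
    (N : ℤ⟦X⟧) ∣ w := by
  obtain ⟨k, hk⟩ := h
  have hu : (euler 2 * euler 10 ^ 3 * (pinv (euler 1) ^ 3 * pinv (euler 5))) *
      (pinv (euler 2) * pinv (euler 10) ^ 3 * (euler 1 ^ 3 * euler 5)) = 1 := by
    have e (m : ℕ) (hm : 0 < m) (n : ℕ) : euler m ^ n * pinv (euler m) ^ n = 1 := by
      rw [← mul_pow, euler_pinv m hm, one_pow]
    have h1 := e 1 one_pos 3
    have h2 := e 2 two_pos 1
    have h5 := e 5 (by norm_num) 1
    have h10 := e 10 (by norm_num) 3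
    calc _ = (euler 2 ^ 1 * pinv (euler 2) ^ 1) * (euler 10 ^ 3 * pinv (euler 10) ^ 3) *
        ((euler 1 ^ 3 * pinv (euler 1) ^ 3) * (euler 5 ^ 1 * pinv (euler 5) ^ 1)) := by ring
      _ = 1 := by rw [h1, h2, h5, h10]; ring
  have hX : (X : ℤ⟦X⟧) ∣ k := by
    rw [X_dvd_iff]
    have := congrArg constantCoeff hk
    rw [map_mul, constantCoeff_xser, zero_mul, map_mul, map_intCast] at this
    exact (mul_eq_zero.1 this.symm).resolve_left (by simpa using hN)
  obtain ⟨k', rfl⟩ := hX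
  rw [xser] at hk
  set v := euler 2 * euler 10 ^ 3 * (pinv (euler 1) ^ 3 * pinv (euler 5))
  set v' := pinv (euler 2) * pinv (euler 10) ^ 3 * (euler 1 ^ 3 * euler 5)
  refine ⟨v' * k', mul_left_cancel₀ (X_ne_zero (R := ℤ)) ?_⟩
  linear_combination v' * hk - X * w * hu

/-- Since x is X times a unit, the constant term of the series is that of g. Subtract it, divide by
x, and descend on the degree. -/
theorem dvd_of_dvd_xev {N : ℤ} (hN : N ≠ 0) {g : Polynomial ℤ} (h : (N : ℤ⟦X⟧) ∣ xev g) :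
    (N : Polynomial ℤ) ∣ g := by
  induction hn : g.natDegree using Nat.strong_induction_on generalizing g with
  | _ n ih =>
    have e : xev g = xser * xev g.divX + (g.coeff 0 : ℤ) := by
      conv_lhs => rw [← Polynomial.divX_mul_X_add g]
      rw [map_add, map_mul, xev_X, mul_comm]
      congr 1
      rw [xev, Polynomial.aeval_C, eq_intCast]
    have h0 : N ∣ g.coeff 0 := by
      obtain ⟨k, hk⟩ := h
      have := congrArg constantCoeff (e.symm.trans hk)
      rw [map_add, map_mul, constantCoeff_xser, zero_mul, zero_add, map_mul, map_intCast,
        map_intCast] at this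
      exact ⟨_, by simpa using this⟩
    have h0' (R : Type) [CommRing R] : (N : R) ∣ (g.coeff 0 : ℤ) := by
      obtain ⟨k, hk⟩ := h0
      exact ⟨k, by rw [hk]; push_cast; rfl⟩
    rcases Nat.eq_zero_or_pos n with h1 | h1
    · rw [Polynomial.eq_C_of_natDegree_eq_zero (hn.trans h1)]
      exact h0' (Polynomial ℤ)
    · have h2 : (N : ℤ⟦X⟧) ∣ xser * xev g.divX := by
        rw [e] at h
        exact (dvd_add_left (h0' _)).1 h
      have h3 := ih _ (by rw [Polynomial.natDegree_divX_eq_natDegree_tsub_one]; omega)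
        (dvd_of_dvd_xser_mul hN h2) rfl
      rw [← Polynomial.divX_mul_X_add g]
      exact dvd_add (h3.mul_right _) (h0' (Polynomial ℤ))

/-- A polynomial approximating 5f modulo 5^(M+1) is itself divisible by 5 by `dvd_of_dvd_xev`;
dividing lowers every positive exponent by one, that is, raises the weight by 10. -/
theorem Lam.of_five_mul {c : ℕ} {f : ℤ⟦X⟧} (hf : Lam c (5 * f)) : Lam (c + 10) f := by
  intro M
  obtain ⟨g, h, hg, e⟩ := hf (M + 1)
  have hd : ((5 : ℤ) : ℤ⟦X⟧) ∣ xev g := ⟨f - 5 ^ M * h, by push_cast; linear_combination -e⟩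
  obtain ⟨g', rfl⟩ := dvd_of_dvd_xev (by norm_num) hd
  refine ⟨g', h, fun m => ?_, ?_⟩
  · have := hg m
    rw [Polynomial.coeff_intCast_mul] at this
    rcases Nat.eq_zero_or_pos (5 * m - c) with h0 | h0
    · rw [show (5 * m - (c + 10) + 9) / 10 = 0 by omega]; simp
    · rw [show (5 * m - c + 9) / 10 = (5 * m - (c + 10) + 9) / 10 + 1 by omega, pow_succ',
        Int.cast_id] at this
      exact Int.dvd_of_mul_dvd_mul_left (by norm_num) this
  · have h5 : (5 : ℤ⟦X⟧) ≠ 0 := fun h => by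
      have h2 := congrArg constantCoeff h
      rw [map_ofNat, map_zero] at h2
      norm_num at h2
    refine mul_left_cancel₀ h5 ?_
    rw [e, map_mul, map_intCast]; push_cast; ring

end Divisibility

end ElongatedDiamond

namespace ElongatedDiamond

open PowerSeries

/-! ### Congruences modulo 5 and the gain of a factor 5 per double step. -/

section ModFive

theorem dvd_pev {R : Type*} [CommRing R] (N : ℤ) (l : List ℤ) (z : R)
    (h : l.all (fun a => decide (a % N = 0)) = true) : (N : R) ∣ pev l z := by
  induction l with
  | nil => exact dvd_zero _
  | cons a l ih =>
    simp only [List.all_cons, Bool.and_eq_true, decide_eq_true_eq] at h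
    rw [pev_cons]
    obtain ⟨k, hk⟩ := Int.dvd_of_emod_eq_zero h.1
    refine dvd_add ⟨k, by rw [hk]; push_cast; rfl⟩ ((ih h.2).mul_left z)

theorem dvd_map_sub {N : ℤ} (V : ℤ⟦X⟧ →+ ℤ⟦X⟧) {a b : ℤ⟦X⟧} (h : (N : ℤ⟦X⟧) ∣ a - b) :
    (N : ℤ⟦X⟧) ∣ V a - V b := by
  obtain ⟨k, hk⟩ := h
  refine ⟨V k, ?_⟩
  rw [← map_sub, hk, ← zsmul_eq_mul, map_zsmul, zsmul_eq_mul]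

theorem dvd_map {N : ℤ} (V : ℤ⟦X⟧ →+ ℤ⟦X⟧) {a : ℤ⟦X⟧} (h : (N : ℤ⟦X⟧) ∣ a) :
    (N : ℤ⟦X⟧) ∣ V a := by
  simpa using dvd_map_sub V (a := a) (b := 0) (by simpa using h)

/-- Modulo 5 the only lower coefficient of the modular equation that survives is the -t in
`modCoeff0`, removed by `padd modCoeff0 [0, 1]`. -/
theorem five_dvd_xser_pow_five_sub_tser : ((5 : ℤ) : ℤ⟦X⟧) ∣ xser ^ 5 - tser := by
  have h := modular_equation
  have h0 : ((5 : ℤ) : ℤ⟦X⟧) ∣ pev (padd modCoeff0 [0, 1]) tser := dvd_pev 5 _ _ (by decide)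
  have h1 : ((5 : ℤ) : ℤ⟦X⟧) ∣ pev modCoeff1 tser := dvd_pev 5 _ _ (by decide)
  have h2 : ((5 : ℤ) : ℤ⟦X⟧) ∣ pev modCoeff2 tser := dvd_pev 5 _ _ (by decide)
  have h3 : ((5 : ℤ) : ℤ⟦X⟧) ∣ pev modCoeff3 tser := dvd_pev 5 _ _ (by decide)
  have h4 : ((5 : ℤ) : ℤ⟦X⟧) ∣ pev modCoeff4 tser := dvd_pev 5 _ _ (by decide)
  have e : xser ^ 5 - tser = -(pev modCoeff4 tser * xser ^ 4 + pev modCoeff3 tser * xser ^ 3 +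
      pev modCoeff2 tser * xser ^ 2 + pev modCoeff1 tser * xser +
      pev (padd modCoeff0 [0, 1]) tser) := by
    rw [pev_padd, show pev [0, 1] tser = tser by simp [pev]]
    linear_combination h
  rw [e, dvd_neg]
  exact dvd_add (dvd_add (dvd_add (dvd_add (h4.mul_right _) (h3.mul_right _)) (h2.mul_right _))
    (h1.mul_right _)) h0

/-- Modulo 5, y ≡ 1 and (1 + 4x)^5 ≡ 1 - x^5 ≡ 1 - t. The latter is a series in q^5, hence passes
through the next U. -/
theorem five_dvd_yinv_pow_mul_sub (w : ℤ⟦X⟧) :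
    ((5 : ℤ) : ℤ⟦X⟧) ∣ yinv ^ 6 * ((1 + 4 * xser) ^ 5 * w) - (1 - tser) * w := by
  have h1 := yser_mul_yinv
  rw [yser] at h1
  obtain ⟨k, hk⟩ := five_dvd_xser_pow_five_sub_tser
  obtain ⟨a, ha⟩ : ∃ a, yinv ^ 6 = 1 + 5 * a :=
    ⟨-(xser * yinv) * (yinv ^ 5 + yinv ^ 4 + yinv ^ 3 + yinv ^ 2 + yinv + 1), by
      linear_combination (yinv ^ 5 + yinv ^ 4 + yinv ^ 3 + yinv ^ 2 + yinv + 1) * h1⟩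
  refine ⟨((4 * xser + 32 * xser ^ 2 + 128 * xser ^ 3 + 256 * xser ^ 4 + 205 * xser ^ 5 - k) +
    a * (1 + 4 * xser) ^ 5) * w, ?_⟩
  rw [ha]
  push_cast at hk ⊢
  linear_combination (-w) * hk

theorem U_one_sub_tser_mul (w : ℤ⟦X⟧) : U ((1 - tser) * w) = (1 - xser) * U w := by
  rw [← U_E5_mul, map_sub, map_one, tser]

/-- The source of the extra factor 5: U(x²) and U(x³) are congruent modulo 5. -/
theorem five_dvd_U_of_five_dvd_sub {w : ℤ⟦X⟧} {c : ℤ}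
    (h : ((5 : ℤ) : ℤ⟦X⟧) ∣ w - c * (xser ^ 2 - xser ^ 3)) : ((5 : ℤ) : ℤ⟦X⟧) ∣ U w := by
  have h1 := dvd_map_sub U h
  have h2 : ((5 : ℤ) : ℤ⟦X⟧) ∣ U (xser ^ 2) - U (xser ^ 3) := by
    have h3 : ((5 : ℤ) : ℤ⟦X⟧) ∣ pev (padd uPoly2 (uPoly3.map (-1 * ·))) xser :=
      dvd_pev 5 _ _ (by decide)
    rw [pev_padd, pev_map] at h3
    rw [U_xser_two, U_xser_three]
    convert h3 using 1
    push_cast; ring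
  rw [← zsmul_eq_mul, map_zsmul, zsmul_eq_mul, map_sub] at h1
  exact (dvd_sub_left (h2.mul_left _)).1 h1

theorem five_dvd_U_UA_of_UP {f : ℤ⟦X⟧} (h : ((5 : ℤ) : ℤ⟦X⟧) ∣ U (UP f)) :
    ((5 : ℤ) : ℤ⟦X⟧) ∣ U (UA f) := by
  have h1 := dvd_map_sub U (five_dvd_yinv_pow_mul_sub (UP f))
  rw [U_one_sub_tser_mul, UP_apply, ← UA_eq, ← UP_apply] at h1
  exact (dvd_sub_left (h.mul_left _)).1 h1

theorem five_dvd_UP_sub (f : ℤ⟦X⟧) :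
    ((5 : ℤ) : ℤ⟦X⟧) ∣ UP f - xser * (yser * U (f * pser)) := by
  have h := dvd_map_sub U (a := f * xser ^ 5 * pser) (b := tser * (f * pser)) (N := 5) (by
    rw [show f * xser ^ 5 * pser - tser * (f * pser) = (xser ^ 5 - tser) * (f * pser) by ring]
    exact five_dvd_xser_pow_five_sub_tser.mul_right _)
  rw [U_tser_mul] at h
  rw [UP_apply, mul_left_comm, ← mul_sub]
  exact h.mul_left _

/-- The list condition says y U(f p) ≡ c(x - x²) modulo 5. As x^5 ≡ t contributes a further factor x
after U, UP f ≡ c(x² - x³). -/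
theorem five_dvd_U_UP_of_list {f : ℤ⟦X⟧} {l : List ℤ} (c : ℤ) (hf : yser * U (f * pser) = pev l xser)
    (hl : (padd l [0, -c, c]).all (fun a => decide (a % 5 = 0)) = true) :
    ((5 : ℤ) : ℤ⟦X⟧) ∣ U (UP f) := by
  refine five_dvd_U_of_five_dvd_sub (c := c) ?_
  have h1 := five_dvd_UP_sub f
  have h2 : ((5 : ℤ) : ℤ⟦X⟧) ∣ pev (padd l [0, -c, c]) xser := dvd_pev 5 _ _ hl
  rw [hf] at h1
  convert dvd_add h1 (h2.mul_left xser) using 1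
  rw [pev_padd]
  simp only [pev_cons, pev_nil]; push_cast; ring

theorem five_dvd_U_UA_xser_pow {m : ℕ} (hm : m ≤ 5) : ((5 : ℤ) : ℤ⟦X⟧) ∣ U (UA (xser ^ m)) := by
  refine five_dvd_U_UA_of_UP ?_
  interval_cases m
  · exact five_dvd_U_UP_of_list 0 U_pser (by decide)
  · exact five_dvd_U_UP_of_list 1 U_xser_mul_pser (by decide)
  · exact five_dvd_U_UP_of_list 3 U_xser_two_mul_pser (by decide)
  · exact five_dvd_U_UP_of_list 0 U_xser_three_mul_pser (by decide)
  · exact five_dvd_U_UP_of_list 1 U_xser_four_mul_pser (by decide)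
  -- Modulo 5, UP(x^5) ≡ x · UP(1), and UP(1) ≡ x · y U(p) ≡ 0.
  · have h1 := five_dvd_UP_sub (xser ^ 5)
    have h2 := five_dvd_UP_sub 1
    have h3 : ((5 : ℤ) : ℤ⟦X⟧) ∣ yser * U (1 * pser) := by
      rw [← pow_zero xser, U_pser]; exact dvd_pev 5 _ _ (by decide)
    have h4 : ((5 : ℤ) : ℤ⟦X⟧) ∣ UP 1 := (dvd_sub_left (h3.mul_left _)).1 h2
    rw [UP_apply, one_mul] at h4
    exact dvd_map U ((dvd_sub_left (h4.mul_left _)).1 h1)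

/-- Weight 25 forces the coefficients of x^m with m ≥ 6 to be divisible by 5, so only the six
verified powers matter. -/
theorem five_dvd_U_UA {f : ℤ⟦X⟧} (hf : Lam 25 f) : ((5 : ℤ) : ℤ⟦X⟧) ∣ U (UA f) := by
  obtain ⟨g, h, hg, rfl⟩ := hf 1
  rw [map_add, map_add, map_five_pow_mul, map_five_pow_mul, pow_one]
  refine dvd_add ?_ ⟨U (UA h), by push_cast; rfl⟩
  change ((5 : ℤ) : ℤ⟦X⟧) ∣ (U.comp UA) (xev g)
  rw [map_xev]
  refine Finset.dvd_sum fun m _ => ?_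
  rcases le_or_gt m 5 with hm | hm
  · exact (five_dvd_U_UA_xser_pow hm).mul_left _
  · obtain ⟨k, hk⟩ := (dvd_pow_self (5 : ℤ) (by omega)).trans (hg m)
    have h5 : ((5 : ℤ) : ℤ⟦X⟧) ∣ ((g.coeff m : ℤ) : ℤ⟦X⟧) := ⟨k, by rw [hk]; push_cast; rfl⟩
    exact h5.mul_right _

/-- The weight runs 25, then 25/5 + 39 = 44 after `UA`, ⌊44/5⌋ + 6 = 14 after `U`, and 24 after
division by 5. -/
theorem lam_step {f : ℤ⟦X⟧} (hf : Lam 25 f) : ∃ f', Lam 25 f' ∧ U (UA f) = 5 * f' := by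
  obtain ⟨f', h⟩ := five_dvd_U_UA hf
  have h2 := hf.UA.U
  push_cast at h
  rw [h] at h2
  exact ⟨f', h2.of_five_mul.mono (by omega), h⟩

/-- The polynomial `y U(x^5 p)` in `x`. -/
def hPoly5 : List ℤ :=
  (padd (padd (padd (padd (pmul modCoeff4 hPoly4) (pmul modCoeff3 hPoly3)) (pmul modCoeff2 hPoly2))
    (pmul modCoeff1 hPoly1)) (pmul modCoeff0 hPoly0)).map (-1 * ·)

theorem UP_one : UP 1 = pev hPoly5 xser := by
  have h := U_xser_pow_add_five pser 0
  simp only [zero_add] at h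
  rw [UP_apply, one_mul, h, hPoly5]
  simp only [pev_map, pev_padd, pev_pmul, ← U_pser, ← U_xser_mul_pser, ← U_xser_two_mul_pser,
    ← U_xser_three_mul_pser, ← U_xser_four_mul_pser]
  push_cast; ring

/-- The first double step gains 25, since UP(1) ≡ 5(x² - x³) modulo 25: one factor 5 is visible and
the other comes from U(x²) ≡ U(x³). The weights run 30, 40, 14, 24. -/
theorem exists_U_UA_one :
    ∃ f f', UA 1 = 5 * f ∧ Lam 25 f' ∧ U (UA 1) = 25 * f' := by
  have hlam : Lam 30 (UA 1) := by
    refine lam_of_UP (c := 5) ?_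
    rw [UP_one, ← xev_pev]
    exact Lam.of_wt (wt_pev (by decide +kernel))
  obtain ⟨k, hk⟩ : ((25 : ℤ) : ℤ⟦X⟧) ∣ pev (padd hPoly5 [0, 0, -5, 5]) xser :=
    dvd_pev 25 _ _ (by decide +kernel)
  rw [pev_padd, ← UP_one] at hk
  simp only [pev_cons, pev_nil] at hk
  push_cast at hk
  have hw : UP 1 = 5 * (xser ^ 2 - xser ^ 3 + 5 * k) := by linear_combination hk
  set w := xser ^ 2 - xser ^ 3 + 5 * k with hw'
  have hf : UA 1 = 5 * (yinv ^ 6 * ((1 + 4 * xser) ^ 5 * w)) := by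
    rw [UA_eq, ← UP_apply, hw]; ring
  have h1 := dvd_map_sub U (five_dvd_yinv_pow_mul_sub w)
  rw [U_one_sub_tser_mul] at h1
  have h2 : ((5 : ℤ) : ℤ⟦X⟧) ∣ U w :=
    five_dvd_U_of_five_dvd_sub (c := 1) ⟨k, by rw [hw']; push_cast; ring⟩
  obtain ⟨f', hf'⟩ := (dvd_sub_left (h2.mul_left _)).1 h1
  push_cast at hf'
  rw [hf] at hlam
  have h3 := hlam.of_five_mul.U
  rw [hf'] at h3
  refine ⟨_, f', hf, h3.of_five_mul.mono (by omega), ?_⟩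
  have := map_five_pow_mul U 1 (yinv ^ 6 * ((1 + 4 * xser) ^ 5 * w))
  rw [pow_one] at this
  rw [hf, this, hf']
  ring

end ModFive

/-! ### The alternating sequence and the formal theorem. -/

section MainSequence

/-- The formal counterparts of the functions `L_α`. -/
def ell : ℕ → ℤ⟦X⟧
  | 0 => 1
  | n + 1 => if Even n then UA (ell n) else U (ell n)

theorem ell_succ_of_even {n : ℕ} (h : Even n) : ell (n + 1) = UA (ell n) := by
  rw [ell, if_pos h]

theorem ell_succ_of_odd {n : ℕ} (h : Odd n) : ell (n + 1) = U (ell n) := by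
  rw [ell, if_neg (Nat.not_even_iff_odd.2 h)]

theorem exists_ell_even (j : ℕ) : ∃ f, Lam 25 f ∧ ell (2 * j + 2) = 5 ^ (j + 2) * f := by
  induction j with
  | zero =>
    obtain ⟨_, f', _, hf', h⟩ := exists_U_UA_one
    refine ⟨f', hf', ?_⟩
    rw [ell_succ_of_odd (by decide), ell_succ_of_even (by decide), ell, h]
    norm_num
  | succ j ih =>
    obtain ⟨f, hf, e⟩ := ih
    obtain ⟨f', hf', h⟩ := lam_step hf
    refine ⟨f', hf', ?_⟩
    rw [ell_succ_of_odd ⟨j + 1, rfl⟩, show 2 * (j + 1) = 2 * j + 2 by ring,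
      ell_succ_of_even ⟨j + 1, by ring⟩, e, map_five_pow_mul, map_five_pow_mul, h]
    ring

theorem five_pow_dvd_ell {n : ℕ} (hn : 1 ≤ n) : (((5 ^ (n / 2 + 1) : ℤ)) : ℤ⟦X⟧) ∣ ell n := by
  push_cast
  rcases Nat.even_or_odd' n with ⟨j, rfl | rfl⟩
  · obtain ⟨j, rfl⟩ := Nat.exists_eq_add_of_le' (show 1 ≤ j by omega)
    obtain ⟨f, _, e⟩ := exists_ell_even j
    rw [show 2 * (j + 1) / 2 + 1 = j + 2 by omega]
    exact ⟨f, e⟩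
  · rw [show (2 * j + 1) / 2 + 1 = j + 1 by omega]
    rcases j with _ | j
    · obtain ⟨f, _, h, _⟩ := exists_U_UA_one
      refine ⟨f, ?_⟩
      rw [ell_succ_of_even (by decide), ell, h]; norm_num
    · obtain ⟨f, _, e⟩ := exists_ell_even j
      refine ⟨UA f, ?_⟩
      rw [show 2 * (j + 1) = 2 * j + 2 by ring, ell_succ_of_even ⟨j + 1, by ring⟩, e,
        map_five_pow_mul]

/-- From 5^(n+1) = 4ψ(n) + 1 follows ψ(n+1) = 5ψ(n) + 1, while β drops from 1 to 0. -/
theorem psi_sub_beta_succ_of_even {n : ℕ} (hn : Even n) :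
    psi (n + 1) - beta (n + 1) = 5 * (psi n - beta n) + 6 := by
  have h : 5 ^ (n + 1) % 4 = 1 := by simp [Nat.pow_mod]
  have h1 : 5 ≤ 5 ^ (n + 1) := by simpa using Nat.pow_le_pow_right (n := 5) (by norm_num) (Nat.le_add_left 1 n)
  obtain ⟨j, rfl⟩ := hn
  rw [psi, psi, beta, beta, pow_succ 5 (j + j + 1)]
  omega

theorem psi_sub_beta_succ_of_odd {n : ℕ} (hn : Odd n) :
    psi (n + 1) - beta (n + 1) = 5 * (psi n - beta n) := by
  have h : 5 ^ (n + 1) % 4 = 1 := by simp [Nat.pow_mod]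
  obtain ⟨j, rfl⟩ := hn
  rw [psi, psi, beta, beta, pow_succ 5 (2 * j + 1 + 1)]
  generalize 5 ^ (2 * j + 1 + 1) = p at *
  omega

/-- The recursion of ψ - β, starting from 0, is exactly the growth of the denominator under the two
operators. -/
theorem yser_pow_mul_ell_mem (n : ℕ) : yser ^ (psi n - beta n) * ell n ∈ xring := by
  induction n with
  | zero => rw [ell, mul_one]; exact xring.pow_mem yser_mem_xring _
  | succ n ih =>
    rcases Nat.even_or_odd n with h | h
    · rw [ell_succ_of_even h, psi_sub_beta_succ_of_even h]
      exact yser_pow_mul_U_aser_mem ih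
    · rw [ell_succ_of_odd h, psi_sub_beta_succ_of_odd h]
      exact yser_pow_mul_U_mem ih

/-- The formal version of the main theorem. -/
theorem exists_yser_pow_mul_ell {n : ℕ} (hn : 1 ≤ n) :
    ∃ g, yser ^ (psi n - beta n) * ell n = 5 ^ (n / 2 + 1) * xev g := by
  obtain ⟨g, hg⟩ := yser_pow_mul_ell_mem n
  have h := (five_pow_dvd_ell hn).mul_left (yser ^ (psi n - beta n))
  rw [← hg] at h
  obtain ⟨g', rfl⟩ := dvd_of_dvd_xev (pow_ne_zero _ (by norm_num)) h
  refine ⟨g', ?_⟩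
  rw [← hg]
  change xev _ = _
  rw [map_mul, map_intCast]
  push_cast; rfl

end MainSequence

end ElongatedDiamond

namespace ElongatedDiamond

open PowerSeries Filter
open scoped PowerSeries.WithPiTopology NNReal ENNReal

/-! ### The sequence as a generating function along 5^α n + λ_α. -/

section ArithmeticProgressions

theorem genFun_five : genFun 5 = dser := by
  have h1 : Tendsto (fun N => ∏ i ∈ Finset.range N, factor 5 i) atTop (nhds (genFun 5)) :=
    (multipliable_factor 5).hasProd.tendsto_prod_nat
  have h2 := h1.mul ((tendsto_eprod (m := 1) (j := 1) one_pos one_pos).pow 16)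
  have h3 := (tendsto_eprod (m := 2) (j := 2) two_pos two_pos).pow 5
  have h4 : genFun 5 * euler 1 ^ 16 = euler 2 ^ 5 := by
    refine tendsto_nhds_unique h2 (h3.congr fun N => ?_)
    rw [← Finset.prod_pow, ← Finset.prod_pow, ← Finset.prod_mul_distrib]
    refine Finset.prod_congr rfl fun i _ => ?_
    rw [one_mul, factor_mul 5 i, mul_add, mul_one]
  have h5 : euler 1 ^ 16 * pinv (euler 1) ^ 16 = 1 := by
    rw [← mul_pow, euler_pinv 1 one_pos, one_pow]
  rw [dser, ← h4, mul_assoc, h5, mul_one]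

/-- The generating function of `d₅` along the progression `5^α n + λ_α`. -/
def sser (α : ℕ) : ℤ⟦X⟧ := PowerSeries.mk fun n => d 5 (5 ^ α * n + lam α)

theorem lam_succ (α : ℕ) : lam (α + 1) = 3 * 5 ^ α + lam α := by
  have h : 5 ^ α % 4 = 1 := by simp [Nat.pow_mod]
  rw [lam, lam, pow_succ]
  omega

theorem coeff_sser_add (α n : ℕ) : coeff (5 * n + 3) (sser α) = coeff n (sser (α + 1)) := by
  rw [sser, sser, coeff_mk, coeff_mk, lam_succ]
  congr 1; ring

/-- The shift by X² selects the indices 5n - 2 = 5(n - 1) + 3, and the residue 3 is that of λ_{α+1}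
= λ_α + 3·5^α. -/
theorem U_X_sq_mul_sser (α : ℕ) : U (X ^ 2 * sser α) = X * sser (α + 1) := by
  ext n
  rw [coeff_U, coeff_X_pow_mul']
  rcases n with _ | n
  · simp
  · rw [if_pos (by omega), coeff_succ_X_mul, ← coeff_sser_add]
    congr 1

theorem U_X_pow_seven_mul_sser (α : ℕ) : U (X ^ 7 * sser α) = X ^ 2 * sser (α + 1) := by
  ext n
  rw [coeff_U, coeff_X_pow_mul', coeff_X_pow_mul']
  rcases lt_or_ge n 2 with h | h
  · rw [if_neg (by omega), if_neg (by omega)]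
  · obtain ⟨n, rfl⟩ := Nat.exists_eq_add_of_le' h
    rw [if_pos (by omega), if_pos (by omega), Nat.add_sub_cancel, ← coeff_sser_add]
    congr 1

/-- Here 5n - 6 = 5(n - 2) + 4 and λ₁ = 4. -/
theorem U_X_pow_six_mul_dser : U (X ^ 6 * dser) = X ^ 2 * sser 1 := by
  ext n
  rw [coeff_U, coeff_X_pow_mul', coeff_X_pow_mul']
  rcases lt_or_ge n 2 with h | h
  · rw [if_neg (by omega), if_neg (by omega)]
  · obtain ⟨n, rfl⟩ := Nat.exists_eq_add_of_le' h
    rw [if_pos (by omega), if_pos (by omega), Nat.add_sub_cancel, sser, coeff_mk, d, genFun_five]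
    congr 1

/-- The prefactor at each stage is a series in q^5 exactly when U needs it: 1/D(q^5) leaves U as
1/D(q), and A replaces 1/D(q) by X^6/D(q^25), which leaves U as 1/D(q^5). -/
theorem ell_eq {n : ℕ} (hn : 1 ≤ n) :
    ell n = (if Odd n then E5 dinv * X ^ 2 else dinv * X) * sser n := by
  induction n, hn using Nat.le_induction with
  | base =>
    rw [ell_succ_of_even (by decide), ell, if_pos odd_one, UA_apply, aser, mul_one,
      mul_comm, U_E5_mul, U_X_pow_six_mul_dser, mul_assoc]
  | succ n _ ih =>
    rcases Nat.even_or_odd n with h | h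
    · have e : aser * (dinv * X * sser n) = E5 (E5 dinv) * (X ^ 7 * sser n) := by
        rw [aser]; linear_combination (X ^ 7 * sser n * E5 (E5 dinv)) * dser_mul_dinv
      rw [if_neg (Nat.not_odd_iff_even.2 h)] at ih
      rw [ell_succ_of_even h, if_pos h.add_one, UA_apply, ih, e, U_E5_mul,
        U_X_pow_seven_mul_sser, mul_assoc]
    · rw [if_pos h] at ih
      rw [ell_succ_of_odd h, if_neg (Nat.not_odd_iff_even.2 h.add_one), ih, mul_assoc, U_E5_mul,
        U_X_sq_mul_sser, mul_assoc]

end ArithmeticProgressions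

/-! ### Convergence of the series involved. -/

section Convergence

theorem conv_euler {m : ℕ} (hm : 0 < m) : Conv (euler m) := conv_eprod hm hm

theorem conv_pinv_euler {m : ℕ} (hm : 0 < m) : Conv (pinv (euler m)) := conv_pinv_eprod hm hm

/-- The norm of U f at radius r is part of the norm of f at radius r^(1/5). -/
theorem Conv.U {f : ℤ⟦X⟧} (hf : Conv f) : Conv (U f) := by
  intro r hr
  set s : ℝ≥0 := r ^ (1 / 5 : ℝ)
  have hs5 : s ^ 5 = r := by
    rw [← NNReal.rpow_natCast, ← NNReal.rpow_mul]; norm_num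
  have hs : s < 1 := NNReal.rpow_lt_one hr (by norm_num)
  refine ne_top_of_le_ne_top (hf s hs) ?_
  have h : nrm r (ElongatedDiamond.U f) =
      ∑' n : ℕ, (fun m => ‖coeff m f‖ₑ * (s : ℝ≥0∞) ^ m) (5 * n) := by
    rw [nrm]
    refine tsum_congr fun n => ?_
    rw [coeff_U, ← hs5]; push_cast; rw [← pow_mul]
  rw [h]
  exact ENNReal.tsum_comp_le_tsum_of_injective (mul_right_injective₀ (by norm_num)) _

theorem conv_dser : Conv dser :=
  ((conv_euler two_pos).pow 5).mul ((conv_pinv_euler one_pos).pow 16)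

/-- As λ₀ = 1, `sser 0` is D without its constant term, divided by X; each further series comes from
the previous one by U. -/
theorem conv_sser (α : ℕ) : Conv (sser α) := by
  induction α with
  | zero =>
    refine Conv.of_X_mul ?_
    have : dser = ((constantCoeff dser : ℤ) : ℤ⟦X⟧) + X * sser 0 := by
      ext n
      rcases n with _ | n
      · simp
      · rw [map_add, coeff_succ_X_mul, sser, coeff_mk, ← eq_intCast (C (R := ℤ)), coeff_C,
          if_neg (by omega), d, genFun_five, zero_add, pow_zero, one_mul]
        rfl
    rw [show X * sser 0 = dser - ((constantCoeff dser : ℤ) : ℤ⟦X⟧) by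
      rw [eq_sub_iff_add_eq']; exact this.symm]
    exact conv_dser.sub (conv_intCast _)
  | succ α ih =>
    refine Conv.of_X_mul ?_
    rw [← U_X_sq_mul_sser]
    exact ((conv_X_pow 2).mul ih).U

theorem conv_xser : Conv xser :=
  (conv_X.mul ((conv_euler two_pos).mul ((conv_euler (by norm_num)).pow 3))).mul
    (((conv_pinv_euler one_pos).pow 3).mul (conv_pinv_euler (by norm_num)))

theorem ev_pinv_euler {m : ℕ} (hm : 0 < m) {q : ℂ} (hq : ‖q‖ < 1) :
    ev q (pinv (euler m)) = (ev q (euler m))⁻¹ := by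
  refine (inv_eq_of_mul_eq_one_right ?_).symm
  rw [← ev_mul (conv_euler hm) (conv_pinv_euler hm) hq, euler_pinv m hm, ev_one]

theorem map_aeval_int {R S : Type*} [CommRing R] [CommRing S] [Algebra ℤ R] [Algebra ℤ S]
    (f : R →+* S) (x : R) (g : Polynomial ℤ) :
    f (Polynomial.aeval x g) = Polynomial.aeval (f x) g := by
  rw [Polynomial.aeval_def, Polynomial.hom_eval₂, Polynomial.aeval_def]
  congr 1
  exact Subsingleton.elim _ _

theorem conv_xev (g : Polynomial ℤ) : Conv (xev g) := by
  have h := map_aeval_int convRing.subtype ⟨xser, conv_xser⟩ g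
  rw [xev]
  exact (congrArg Conv h).mp (Polynomial.aeval (⟨xser, conv_xser⟩ : convRing) g).2

theorem ev_xev (g : Polynomial ℤ) {q : ℂ} (hq : ‖q‖ < 1) :
    ev q (xev g) = Polynomial.aeval (ev q xser) g := by
  have h := map_aeval_int convRing.subtype ⟨xser, conv_xser⟩ g
  have h2 := map_aeval_int (evHom q hq) ⟨xser, conv_xser⟩ g
  rw [xev]
  exact (congrArg (ev q) h.symm).trans h2

end Convergence

/-! ### Evaluation on the upper half plane. -/

section UpperHalfPlane

variable (τ : UpperHalfPlane)

theorem norm_nome_lt_one : ‖nome τ‖ < 1 := UpperHalfPlane.norm_exp_two_pi_I_lt_one τ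

theorem poch_eq {a : ℕ} (ha : 0 < a) : poch a τ = ev (nome τ) (euler a) := by
  have hq := norm_nome_lt_one τ
  have h1 : Multipliable fun i : ℕ => 1 - nome τ ^ (a * (i + 1)) := by
    simp only [pow_mul]
    refine ModularForm.multipliable_one_sub_pow ?_
    rw [norm_pow]
    exact pow_lt_one₀ (norm_nonneg _) hq ha.ne'
  refine tendsto_nhds_unique h1.hasProd.tendsto_prod_nat ?_
  simp only [mul_add, mul_one]
  exact tendsto_ev_eprod ha ha hq

theorem hauptmodul_eq : hauptmodul τ = ev (nome τ) xser := by
  have hq := norm_nome_lt_one τ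
  have c1 := conv_pinv_euler (m := 1) one_pos
  have c2 := conv_euler (m := 2) two_pos
  have c5 := conv_pinv_euler (m := 5) (by norm_num)
  have c10 := conv_euler (m := 10) (by norm_num)
  rw [xser, ev_mul (conv_X.mul (c2.mul (c10.pow 3))) ((c1.pow 3).mul c5) hq,
    ev_mul conv_X (c2.mul (c10.pow 3)) hq, ev_mul c2 (c10.pow 3) hq,
    ev_mul (c1.pow 3) c5 hq, ev_pow c10 hq, ev_pow c1 hq, ev_X, ev_pinv_euler one_pos hq,
    ev_pinv_euler (by norm_num) hq, hauptmodul, poch_eq τ one_pos, poch_eq τ two_pos,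
    poch_eq τ (by norm_num), poch_eq τ (by norm_num)]
  rw [div_eq_mul_inv, mul_inv, inv_pow]

theorem conv_euler_pow_mul_pinv {a b : ℕ} (ha : 0 < a) (hb : 0 < b) :
    Conv (euler a ^ 16 * pinv (euler b) ^ 5) :=
  ((conv_euler ha).pow 16).mul ((conv_pinv_euler hb).pow 5)

theorem ev_euler_pow_mul_pinv {a b : ℕ} (ha : 0 < a) (hb : 0 < b) :
    ev (nome τ) (euler a ^ 16 * pinv (euler b) ^ 5) = poch a τ ^ 16 / poch b τ ^ 5 := by
  have hq := norm_nome_lt_one τ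
  rw [ev_mul ((conv_euler ha).pow 16) ((conv_pinv_euler hb).pow 5) hq, ev_pow (conv_euler ha) hq,
    ev_pow (conv_pinv_euler hb) hq, ev_pinv_euler hb hq, ← poch_eq τ ha, ← poch_eq τ hb, inv_pow,
    div_eq_mul_inv]

theorem term_eq (α n : ℕ) : term α τ n =
    nome τ ^ (if Odd α then 2 else 1) * (((coeff n (sser α) : ℤ) : ℂ) * nome τ ^ n) := by
  rw [term, sser, coeff_mk, pow_add]; ring

theorem summable_term (α : ℕ) : Summable (term α τ) := by
  simp only [funext (term_eq τ α)]
  exact ((conv_sser α).summable (norm_nome_lt_one τ)).mul_left _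

theorem conv_ell {n : ℕ} (hn : 1 ≤ n) : Conv (ell n) := by
  rw [ell_eq hn]
  refine Conv.mul ?_ (conv_sser n)
  split_ifs
  · rw [E5_dinv]
    exact (conv_euler_pow_mul_pinv (by norm_num) (by norm_num)).mul (conv_X_pow 2)
  · exact (conv_euler_pow_mul_pinv one_pos two_pos).mul conv_X

theorem L_eq {α : ℕ} (hα : 1 ≤ α) : L α τ = ev (nome τ) (ell α) := by
  have hq := norm_nome_lt_one τ
  have hs := conv_sser α
  have ht : ∑' n, term α τ n = nome τ ^ (if Odd α then 2 else 1) * ev (nome τ) (sser α) := by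
    simp only [term_eq]
    rw [tsum_mul_left, ev]
  rw [L, ht, ell_eq hα]
  split_ifs
  · have hc := conv_euler_pow_mul_pinv (a := 5) (b := 10) (by norm_num) (by norm_num)
    rw [E5_dinv, ev_mul (hc.mul (conv_X_pow 2)) hs hq, ev_mul hc (conv_X_pow 2) hq, ev_X_pow,
      ev_euler_pow_mul_pinv τ (by norm_num) (by norm_num), mul_assoc]
  · have hc := conv_euler_pow_mul_pinv (a := 1) (b := 2) one_pos two_pos
    rw [dinv, ev_mul (hc.mul conv_X) hs hq, ev_mul hc conv_X hq, ev_X,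
      ev_euler_pow_mul_pinv τ one_pos two_pos, mul_assoc, pow_one]

theorem conv_yser : Conv yser :=
  conv_one.add ((ofNat_mem convRing 5 : Conv 5).mul conv_xser)

theorem ev_yser : ev (nome τ) yser = 1 + 5 * hauptmodul τ := by
  have hq := norm_nome_lt_one τ
  have h5 : Conv (5 : ℤ⟦X⟧) := ofNat_mem convRing 5
  rw [yser, ev_add conv_one (h5.mul conv_xser) hq, ev_one, ev_mul h5 conv_xser hq, hauptmodul_eq]
  congr 2
  exact map_ofNat (evHom (nome τ) hq) 5

end UpperHalfPlane

end ElongatedDiamond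

end

/-- For `α ≥ 1` the series in `L_α` converges on the upper half plane, and
`(1+5x)^(ψ(α)-β(α)) / 5^(⌊α/2⌋+1) * L_α` lies in `ℤ[x]`, the subring generated by `x` in the ring of
functions on the upper half plane. -/
theorem theorem1p2 (α : ℕ) (hα : 1 ≤ α) :
    (∀ τ : UpperHalfPlane, Summable (ElongatedDiamond.term α τ)) ∧
    (fun τ : UpperHalfPlane =>
        (1 + 5 * ElongatedDiamond.hauptmodul τ) ^
            (ElongatedDiamond.psi α - ElongatedDiamond.beta α) / 5 ^ (α / 2 + 1) *
          ElongatedDiamond.L α τ) ∈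
      (Algebra.adjoin ℤ {ElongatedDiamond.hauptmodul} : Subalgebra ℤ (UpperHalfPlane → ℂ)) := by
  refine ⟨fun τ => ElongatedDiamond.summable_term τ α, ?_⟩
  obtain ⟨g, hg⟩ := ElongatedDiamond.exists_yser_pow_mul_ell hα
  have h := Polynomial.aeval_mem_adjoin_singleton ℤ (p := g) ElongatedDiamond.hauptmodul
  convert h using 1
  funext τ
  have hq := ElongatedDiamond.norm_nome_lt_one τ
  have h1 := congrArg (ElongatedDiamond.ev (ElongatedDiamond.nome τ)) hg
  have h5 : ElongatedDiamond.Conv 5 := ofNat_mem ElongatedDiamond.convRing 5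
  have e5 : ElongatedDiamond.ev (ElongatedDiamond.nome τ) 5 = 5 :=
    map_ofNat (ElongatedDiamond.evHom (ElongatedDiamond.nome τ) hq) 5
  rw [ElongatedDiamond.ev_mul (ElongatedDiamond.conv_yser.pow _) (ElongatedDiamond.conv_ell hα) hq,
    ElongatedDiamond.ev_pow ElongatedDiamond.conv_yser hq, ElongatedDiamond.ev_yser,
    ← ElongatedDiamond.L_eq τ hα,
    ElongatedDiamond.ev_mul (h5.pow _) (ElongatedDiamond.conv_xev g) hq,
    ElongatedDiamond.ev_pow h5 hq, e5, ElongatedDiamond.ev_xev g hq,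
    ← ElongatedDiamond.hauptmodul_eq] at h1
  -- The polynomial g does not depend on τ, so the pointwise identities give membership in the ring
  -- generated by the function x.
  have h2 := ElongatedDiamond.map_aeval_int (Pi.evalRingHom (fun _ : UpperHalfPlane => ℂ) τ)
    ElongatedDiamond.hauptmodul g
  simp only [Pi.evalRingHom_apply] at h2
  rw [h2, div_mul_eq_mul_div, h1, mul_div_cancel_left₀ _ (pow_ne_zero _ (by norm_num))]
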